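/- **Setting.** Let $T,L,\rho>0$ and let $\mathcal E=\{e_1,\dots,e_K\}$ be a finite set of market states. For $i\ne j$ let $q^{i,j}:[-L,L]\to[0,\infty)$ be continuous. Let $\varsigma$ be a finite measure on a Borel set $\mathcal Z\subseteq\mathbb R$, and let $G:[0,T]\times\mathcal E\times\mathcal Z\to\mathbb R$ be measurable, continuous in time, with $1+G>0$. Put $\eta(t,e_i,A)=\varsigma(\{\zeta\in\mathcal Z: G(t,e_i,\zeta)\in A\setminus\{0\}\})$ for Borel $A\subseteq\mathbb R$. On a probability space with a filtration $\mathbb F$ satisfying the usual conditions, let $\mathcal N(ds,d\zeta)$ be an $\mathbb F$-Poisson random measure on $[0,\infty)\times\mathcal Z$ with intensity $ds\,\varsigma(d\zeta)$. A strategy $h$ is *admissible*, $h\in\mathcal H$, if it is $\mathbb F$-predictable, takes values in $[-L,L]$, and almost surely $\eta(s,e_i,\{z:\exists r\in[0,T],\ 1+h_rz\le 0\})=0$ for all $s\in[0,T]$ and all $i$. Fix $(t,w,e_i)\in[0,T]\times(0,\infty)\times\mathcal E$. For each $h\in\mathcal H$ let $(Y,W)=(Y^{(h)},W^{(h)})$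 be a state process of $h$ on $[t,T]$ started from $(t,w,e_i)$: $Y$ and $W$ are càdlàg and adapted, $Y_t=e_i$, and $Y$ has generator $Q(h_s)=(q^{k,j}(h_s))$, that is, for every $f:\mathcal E\to\mathbb R$, $$f(Y_u)-\int_t^u\sum_{k}\mathbf 1_{\{Y_r=e_k\}}\sum_{j\ne k}\big(f(e_j)-f(e_k)\big)\,q^{k,j}(h_r)\,dr,\qquad u\in[t,T],$$ is an $\mathbb F$-martingale; almost surely $Y$ and $\mathcal N$ have no common jump times on $(t,T]$; and $W_t=w$, $$dW_s=W_{s-}\Big((1-h_s)\rho\,ds+h_s\int_{\mathcal Z}G(s,Y_{s-},\zeta)\,\mathcal N(ds,d\zeta)\Big).$$ Write $\mathbb E^{t,w,i}$ for expectations of functionals of these processes. Let $U:(0,\infty)\to\mathbb R$ be continuously differentiable, strictly increasing and strictly concave, with $U'(0+)=\infty$ and $U'(\infty)=0$. The expected utility $\mathbb E^{t,w,i}[U(W_T)]$ is understood as $\mathbb E[U(W_T)^+]-\mathbb E[U(W_T)^-]\in[-\infty,\infty]$ (and as $-\infty$ if both terms are infinite), and $V(t,w,e_i)=\sup_{h\in\mathcal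 H}\mathbb E^{t,w,i}[U(W^{(h)}_T)]$. For $a\in[-L,L]$ let $$\mathcal L^a\Upsilon(s,x,e_k)=\partial_s\Upsilon(s,x,e_k)+\partial_x\Upsilon(s,x,e_k)\,x(1-a)\rho+\sum_{j\ne k}\big(\Upsilon(s,x,e_j)-\Upsilon(s,x,e_k)\big)q^{k,j}(a)+\int_{\mathbb R}\big[\Upsilon(s,x(1+az),e_k)-\Upsilon(s,x,e_k)\big]\eta(s,e_k,dz).$$ **Theorem.** Let $\Upsilon$ be a real function on $[0,T]\times(0,\infty)\times\mathcal E$, extended arbitrarily to nonpositive wealth (the extension plays no role if $1+az>0$ for $\eta(s,e_k,dz)$-almost every $z$, for all $a\in[-L,L]$ and all $s,k$). Let $\Upsilon$ be a classical solution of the HJB equation: $\Upsilon$ is continuous and continuously differentiable in $(s,x)$ on $[0,T]\times(0,\infty)$ for each market state, for all $(s,x,e_k)\in[0,T)\times(0,\infty)\times\mathcal E$ the integral in $\mathcal L^a\Upsilon(s,x,e_k)$ converges absolutely for every $a\in[-L,L]$ and $\sup_{a\in[-L,L]}\mathcal L^a\Upsilon(s,x,e_k)=0$, and $\Upsilon(T,x,e_k)=U(x)$.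 Assume that for every $h\in\mathcal H$ $$\mathbb E^{t,w,i}\Big[\int_t^T\!\!\int_{\mathbb R}\big|\Upsilon(s,W_{s-}(1+h_sz),Y_{s-})-\Upsilon(s,W_{s-},Y_{s-})\big|\,\eta(s,Y_{s-},dz)\,ds\Big]<\infty,$$ $$\mathbb E^{t,w,i}\Big[\int_t^T\sum_{j=1}^K\sum_{k\ne j}\big|\Upsilon(s,W_{s-},e_j)-\Upsilon(s,W_{s-},Y_{s-})\big|\,q^{k,j}(h_s)\mathbf 1_{\{Y_{s-}=e_k\}}\,ds\Big]<\infty.$$ Then: 1. for every $h\in\mathcal H$, $\mathbb E^{t,w,i}[U(W^{(h)}_T)^+]<\infty$ and $\Upsilon(t,w,e_i)\ge\mathbb E^{t,w,i}[U(W^{(h)}_T)]$; 2. if $h^*\in\mathcal H$ satisfies, for every $s\in[t,T)$, $$h^*_s\in\operatorname*{arg\,max}_{a\in[-L,L]}\mathcal L^a\Upsilon\big(s,W^{(h^*)}_s,Y^{(h^*)}_s\big)\quad\text{almost surely},$$ then $\Upsilon(t,w,e_i)=V(t,w,e_i)=\mathbb E^{t,w,i}[U(W^{(h^*)}_T)]$,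 so $h^*$ is optimal. -/

import Mathlib

open MeasureTheory ProbabilityTheory Set Filter Topology
open scoped NNReal ENNReal

noncomputable section

namespace LargeInvestor

/-- Lebesgue measure on the time axis `[0, ∞)`. -/
def leb : Measure ℝ≥0 := Measure.comap ((↑) : ℝ≥0 → ℝ) volume

/-- The deterministic data of the market with `K` market states: horizon `T`, bound `L` on the
portfolio weights, interest rate `ρ`, controlled transition rates `q i j` (only the entries with
`i ≠ j` matter), mark space `Z ⊆ ℝ`, finite jump intensity `ς` on `Z`, jump size function `G`. -/
structure Market (K : ℕ) where
  T : ℝ≥0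
  T_pos : 0 < T
  L : ℝ
  L_pos : 0 < L
  ρ : ℝ
  ρ_pos : 0 < ρ
  q : Fin K → Fin K → ℝ → ℝ
  q_nonneg : ∀ i j, i ≠ j → ∀ a ∈ Icc (-L) L, 0 ≤ q i j a
  q_cont : ∀ i j, i ≠ j → ContinuousOn (q i j) (Icc (-L) L)
  Z : Set ℝ
  Z_meas : MeasurableSet Z
  ς : Measure Z
  ς_finite : IsFiniteMeasure ς
  G : ℝ≥0 → Fin K → Z → ℝ
  G_meas : ∀ i, Measurable (fun p : ℝ≥0 × Z => G p.1 i p.2)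
  G_cont : ∀ i ζ, ContinuousOn (fun s => G s i ζ) (Icc 0 T)
  G_gt : ∀ s ∈ Icc 0 T, ∀ i ζ, 0 < 1 + G s i ζ

variable {K : ℕ} {Ω : Type*} {mΩ : MeasurableSpace Ω}

/-- The jump intensity kernel of the return process: `η(t, e_i, A)` is the `ς`-mass of the marks
`ζ` with `G(t, e_i, ζ) ∈ A \ {0}`. -/
def Market.η (M : Market K) (t : ℝ≥0) (i : Fin K) : Measure ℝ :=
  (M.ς.map (M.G t i)).restrict {0}ᶜ

/-- The usual conditions: right-continuity, and all null sets belong to the initial σ-algebra. -/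
def UsualConditions (P : Measure Ω) (𝓕 : Filtration ℝ≥0 mΩ) : Prop :=
  𝓕.IsRightContinuous ∧ ∀ A : Set Ω, P A = 0 → MeasurableSet[𝓕 0] A

/-- `N` is a Poisson random measure on `[0, ∞) × Z` with intensity `dt ⊗ ς`, relative to the
filtration `𝓕` (adapted to it, and with increments independent of the past). -/
structure IsPoissonRandomMeasure {Z : Type*} [MeasurableSpace Z] (P : Measure Ω)
    (𝓕 : Filtration ℝ≥0 mΩ) (ς : Measure Z) (N : Ω → Measure (ℝ≥0 × Z)) : Prop where
  adapted : ∀ (t : ℝ≥0) (A : Set (ℝ≥0 × Z)), MeasurableSet A → A ⊆ Iic t ×ˢ univ →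
    Measurable[𝓕 t] (fun ω => N ω A)
  law : ∀ A : Set (ℝ≥0 × Z), MeasurableSet A → (leb.prod ς) A < ⊤ →
    P.map (fun ω => N ω A) =
      (poissonMeasure ((leb.prod ς) A).toNNReal).map (fun n : ℕ => (n : ℝ≥0∞))
  indep : ∀ (n : ℕ) (A : Fin n → Set (ℝ≥0 × Z)), (∀ k, MeasurableSet (A k)) →
    Pairwise (fun k l => Disjoint (A k) (A l)) → iIndepFun (fun k ω => N ω (A k)) P
  indep_past : ∀ s : ℝ≥0, Indep (𝓕 s)
    (⨆ (A : Set (ℝ≥0 × Z)) (_ : MeasurableSet A) (_ : A ⊆ Ioi s ×ˢ univ),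
      MeasurableSpace.comap (fun ω => N ω A) inferInstance) P

/-- A portfolio strategy: `h s ω` is the fraction of wealth held in the risky asset. -/
abbrev Strategy (Ω : Type*) := ℝ≥0 → Ω → ℝ

/-- Admissible strategies: predictable, with values in `[-L, L]`, and such that no jump of the
return process can make the wealth nonpositive. -/
structure IsAdmissible (M : Market K) (P : Measure Ω) (𝓕 : Filtration ℝ≥0 mΩ)
    (h : Strategy Ω) : Prop where
  predictable : IsStronglyPredictable 𝓕 h
  bounded : ∀ s ∈ Icc 0 M.T, ∀ ω, h s ω ∈ Icc (-M.L) M.L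
  solvent : ∀ᵐ ω ∂P, ∀ s ∈ Icc 0 M.T, ∀ i,
    M.η s i {z : ℝ | ∃ r ∈ Icc 0 M.T, 1 + h r ω * z ≤ 0} = 0

/-- The path `f` is right-continuous with left limits on `[t, T]`. -/
def IsCadlagOn {E : Type*} [TopologicalSpace E] (f : ℝ≥0 → E) (t T : ℝ≥0) : Prop :=
  (∀ s ∈ Ico t T, ContinuousWithinAt f (Ici s) s) ∧
    ∀ s ∈ Ioc t T, ∃ l, Tendsto f (𝓝[<] s) (𝓝 l)

/-- `Y` is, on `[t, T]`, the controlled Markov chain with generator `Q(h)` started from state `i`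
at time `t`, expressed through the martingale problem: for every function `f` on the states,
`f(Y_u) - ∫ Q(h_r) f (Y_r) dr` is a martingale. -/
structure IsControlledChain (M : Market K) (P : Measure Ω) (𝓕 : Filtration ℝ≥0 mΩ)
    (h : Strategy Ω) (t : ℝ≥0) (i : Fin K) (Y : ℝ≥0 → Ω → Fin K) : Prop where
  adapted : ∀ s ∈ Icc t M.T, Measurable[𝓕 s] (Y s)
  cadlag : ∀ᵐ ω ∂P, IsCadlagOn (fun s => Y s ω) t M.T
  initial : ∀ᵐ ω ∂P, Y t ω = i
  martingale : ∀ (f : Fin K → ℝ) (s u : ℝ≥0), t ≤ s → s ≤ u → u ≤ M.T →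
    P[fun ω => f (Y u ω) - f (Y s ω) - ∫ r in Ioc s u,
        ∑ j ∈ Finset.univ.erase (Y r ω), (f j - f (Y r ω)) * M.q (Y r ω) j (h r ω) ∂leb | 𝓕 s]
      =ᵐ[P] 0

/-- `W` is, on `[t, T]`, the wealth process of the strategy `h` with initial wealth `w` at time
`t`: `dW_s = W_{s-} ((1 - h_s) ρ ds + h_s dR_s)`, where
`dR_s = ∫ G(s, Y_{s-}, ζ) N(ds, dζ)`. -/
structure IsWealth (M : Market K) (P : Measure Ω) (𝓕 : Filtration ℝ≥0 mΩ)
    (N : Ω → Measure (ℝ≥0 × M.Z)) (h : Strategy Ω) (Y : ℝ≥0 → Ω → Fin K)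
    (t : ℝ≥0) (w : ℝ) (W : ℝ≥0 → Ω → ℝ) : Prop where
  adapted : ∀ s ∈ Icc t M.T, Measurable[𝓕 s] (W s)
  cadlag : ∀ᵐ ω ∂P, IsCadlagOn (fun s => W s ω) t M.T
  dynamics : ∀ᵐ ω ∂P, ∀ u ∈ Icc t M.T, W u ω = w
    + ∫ s in Ioc t u, Function.leftLim (fun r => W r ω) s * ((1 - h s ω) * M.ρ) ∂leb
    + ∫ p in Ioc t u ×ˢ (univ : Set M.Z), Function.leftLim (fun r => W r ω) p.1 *
        (h p.1 ω * M.G p.1 (Function.leftLim (fun r => Y r ω) p.1) p.2) ∂(N ω)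

/-- `(Y, W)` is the state process of the strategy `h` started from wealth `w` and market state `i`
at time `t`. That the market chain is not driven by the noise `N` of the price is expressed by the
absence of common jumps. -/
structure IsStateProcess (M : Market K) (P : Measure Ω) (𝓕 : Filtration ℝ≥0 mΩ)
    (N : Ω → Measure (ℝ≥0 × M.Z)) (h : Strategy Ω) (t : ℝ≥0) (w : ℝ) (i : Fin K)
    (Y : ℝ≥0 → Ω → Fin K) (W : ℝ≥0 → Ω → ℝ) : Prop where
  chain : IsControlledChain M P 𝓕 h t i Y
  wealth : IsWealth M P 𝓕 N h Y t w W
  no_common_jumps : ∀ᵐ ω ∂P, ∀ s ∈ Ioc t M.T,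
    Function.leftLim (fun r => Y r ω) s ≠ Y s ω → N ω ({s} ×ˢ univ) = 0

/-- Utility functions on `(0, ∞)`: continuously differentiable, strictly increasing, strictly
concave, satisfying the Inada conditions. -/
structure IsUtility (U : ℝ → ℝ) : Prop where
  strictMono : StrictMonoOn U (Ioi 0)
  strictConcave : StrictConcaveOn ℝ (Ioi 0) U
  differentiable : DifferentiableOn ℝ U (Ioi 0)
  deriv_cont : ContinuousOn (deriv U) (Ioi 0)
  inada_zero : Tendsto (deriv U) (𝓝[>] 0) atTop
  inada_infty : Tendsto (deriv U) atTop (𝓝 0)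

/-- The expectation `E[X⁺] - E[X⁻]` in `[-∞, ∞]` (equal to `-∞` if both terms are infinite). -/
def extExpectation (P : Measure Ω) (X : Ω → ℝ) : EReal :=
  ((∫⁻ ω, ENNReal.ofReal (X ω) ∂P : ℝ≥0∞) : EReal) -
    ((∫⁻ ω, ENNReal.ofReal (-X ω) ∂P : ℝ≥0∞) : EReal)

/-- The value function at the initial condition from which the wealth processes `W h` are started:
the supremum over all admissible strategies of the expected utility of terminal wealth. -/
def value (M : Market K) (P : Measure Ω) (𝓕 : Filtration ℝ≥0 mΩ) (U : ℝ → ℝ)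
    (W : Strategy Ω → ℝ≥0 → Ω → ℝ) : EReal :=
  ⨆ (h : Strategy Ω) (_ : IsAdmissible M P 𝓕 h),
    extExpectation P (fun ω => U (W h M.T ω))

/-- `Υ` is of class `C^{1,1}` on `[0, T] × (0, ∞)`, in each market state; the time derivative is
one-sided at the endpoints. -/
structure IsC11 (M : Market K) (Υ : ℝ → ℝ → Fin K → ℝ) : Prop where
  cont : ∀ i, ContinuousOn (fun p : ℝ × ℝ => Υ p.1 p.2 i) (Icc 0 (M.T : ℝ) ×ˢ Ioi 0)
  diff_time : ∀ i, ∀ t ∈ Icc 0 (M.T : ℝ), ∀ w > 0,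
    DifferentiableWithinAt ℝ (fun s => Υ s w i) (Icc 0 (M.T : ℝ)) t
  cont_time : ∀ i, ContinuousOn
    (fun p : ℝ × ℝ => derivWithin (fun s => Υ s p.2 i) (Icc 0 (M.T : ℝ)) p.1)
    (Icc 0 (M.T : ℝ) ×ˢ Ioi 0)
  diff_wealth : ∀ i, ∀ t ∈ Icc 0 (M.T : ℝ), ∀ w > 0, DifferentiableAt ℝ (fun v => Υ t v i) w
  cont_wealth : ∀ i, ContinuousOn
    (fun p : ℝ × ℝ => deriv (fun v => Υ p.1 v i) p.2) (Icc 0 (M.T : ℝ) ×ˢ Ioi 0)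

/-- The generator `𝓛^a Υ (t, w, e_i)` of (time and) the state process under the constant control
`a`. -/
def gen (M : Market K) (Υ : ℝ → ℝ → Fin K → ℝ) (a : ℝ) (t : ℝ≥0) (w : ℝ) (i : Fin K) : ℝ :=
  derivWithin (fun s => Υ s w i) (Icc 0 (M.T : ℝ)) t
    + deriv (fun v => Υ t v i) w * (w * (1 - a) * M.ρ)
    + ∑ j, (Υ t w j - Υ t w i) * M.q i j a
    + ∫ z, (Υ t (w * (1 + a * z)) i - Υ t w i) ∂(M.η t i)

/-- `Υ` is a classical solution of the HJB equation `0 = sup_{a ∈ [-L, L]} 𝓛^a Υ` with terminal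
value `U`. The field `integrable` says that the integral term of the equation is meaningful. -/
structure IsHJBSolution (M : Market K) (U : ℝ → ℝ) (Υ : ℝ → ℝ → Fin K → ℝ) : Prop where
  smooth : IsC11 M Υ
  integrable : ∀ t ∈ Ico 0 M.T, ∀ w > 0, ∀ i, ∀ a ∈ Icc (-M.L) M.L,
    Integrable (fun z => Υ t (w * (1 + a * z)) i - Υ t w i) (M.η t i)
  hjb : ∀ t ∈ Ico 0 M.T, ∀ w > 0, ∀ i,
    IsLUB ((fun a => gen M Υ a t w i) '' Icc (-M.L) M.L) 0
  terminal : ∀ w > 0, ∀ i, Υ M.T w i = U w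

/-- Integrability of the wealth jumps:
`E ∫_t^T ∫ |Υ(s, W_{s-}(1 + h_s z), Y_{s-}) - Υ(s, W_{s-}, Y_{s-})| η(s, Y_{s-}, dz) ds < ∞`. -/
def JumpIntegrable (M : Market K) (P : Measure Ω) (Υ : ℝ → ℝ → Fin K → ℝ) (h : Strategy Ω)
    (t : ℝ≥0) (Y : ℝ≥0 → Ω → Fin K) (W : ℝ≥0 → Ω → ℝ) : Prop :=
  ∫⁻ ω, ∫⁻ s in Ioc t M.T,
    (let y := Function.leftLim (fun r => Y r ω) s
     let x := Function.leftLim (fun r => W r ω) s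
     ∫⁻ z, ENNReal.ofReal |Υ s (x * (1 + h s ω * z)) y - Υ s x y| ∂(M.η s y)) ∂leb ∂P < ⊤

/-- Integrability of the jumps of the chain:
`E ∫_t^T ∑_j ∑_{k ≠ j} |Υ(s, W_{s-}, e_j) - Υ(s, W_{s-}, Y_{s-})| q^{k,j}(h_s) 1_{Y_{s-} = e_k} ds`
is finite. -/
def ChainIntegrable (M : Market K) (P : Measure Ω) (Υ : ℝ → ℝ → Fin K → ℝ) (h : Strategy Ω)
    (t : ℝ≥0) (Y : ℝ≥0 → Ω → Fin K) (W : ℝ≥0 → Ω → ℝ) : Prop :=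
  ∫⁻ ω, ∫⁻ s in Ioc t M.T,
    (let y := Function.leftLim (fun r => Y r ω) s
     let x := Function.leftLim (fun r => W r ω) s
     ENNReal.ofReal (∑ j, ∑ k ∈ Finset.univ.erase j,
       |Υ s x j - Υ s x y| * M.q k j (h s ω) * (if y = k then 1 else 0))) ∂leb ∂P < ⊤

end LargeInvestor

end

/-!
`Υ` is expanded along the path of `(Y, W)`, the jump terms of the expansion are replaced by their
compensators, and the sign of the remaining term is read off from the HJB equation.

**Itô's formula is pathwise.** Almost every path of the state process has finitely many jumps: the
points of `N` in `(t, T]` form a finite set with distinct times, because `ς` is finite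
(`IsPoissonRandomMeasure.ae_exists_finset`), and a càdlàg path in a finite set jumps finitely often
(`IsCadlagOn.finite_jumps`). Between jumps the wealth is absolutely continuous and solves a linear
equation, hence stays positive; at a jump it is multiplied by `1 + h G`, which is positive by
admissibility (`IsJumpPath.pos`, `IsStateProcess.ae_price_jump_pos`). The fundamental theorem of
calculus along absolutely continuous paths (`IsC11.integral_drift`), applied between jumps,
expresses `Υ(T, W_T, Y_T) - Υ(t, w, e_i)` as a drift integral, a sum over the points of `N`,
and a sum over the jumps of `Y` (`IsJumpPath.ito`, `IsGoodPath.ito`).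

**Compensation.** Two random measures on `(t, T] × X`, of finite expected mass, whose expected
increments after time `s` agree on every event of `𝓕 s`, for all `s`, have the same mean measure on
predictable sets (`map_reorder_eq`), by a π-λ argument. So the expected integral of a predictable
function against one is that against the other, as soon as the absolute integral has finite
expectation (`integral_eq_of_map_reorder_eq`). For `N` and its intensity the hypothesis is the
independence of the increments from the past. For the entries of the chain into a state `j` it is
derived from the martingale problem for the indicator function of `j`: the number of grid intervals
at whose left end the chain is away from `j` and at whose right end it is at `j` has an explicit
expectation; it is bounded by the number of entries and eventually equal to it as the grid is
refined, so that Fatou's lemma for the counts and dominated convergence for the compensators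
identify the limit (`IsControlledChain.setLIntegral_entryTimes`). The integrands are functions of
left limits, which are predictable (`measurable_predictable_leftVersion`).

**Conclusion.** The two integrability assumptions on `Υ` are exactly those of the two compensation
formulas. Hence, with no localization,
`U(W_T) = Υ(t, w, e_i) + ∫ 𝓛^{h_s} Υ(s, W_{s-}, Y_{s-}) ds + X`
with `X` integrable and centred (`IsStateProcess.exists_decomposition`). The integral is nonpositive
because `sup_a 𝓛^a Υ = 0`, so `U(W_T)` is bounded above by an integrable variable of mean
`Υ(t, w, e_i)`; this is the first claim. If `h` maximizes `𝓛^a Υ` along its own path, the integral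
vanishes: the maximum is attained almost surely at each time, hence, by Fubini's theorem, almost
surely at almost every time, and at almost every time the left limits equal the process. So
`U(W_T)` has mean `Υ(t, w, e_i)`, which is the second claim.

`Υ` is arbitrary for nonpositive wealth, and `q` on its diagonal and outside `[-L, L]`.
Measurability therefore requires replacing them by versions that are zero there (`cutoff`,
`Market.rate`), which makes no difference along the state process.
-/

noncomputable section

namespace LargeInvestor

section

/-! ### Lebesgue measure on the half-line -/

lemma measurableEmbedding_coe_nnreal : MeasurableEmbedding ((↑) : ℝ≥0 → ℝ) :=
  MeasurableEmbedding.subtype_coe measurableSet_Ici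

lemma leb_map_coe : leb.map ((↑) : ℝ≥0 → ℝ) = volume.restrict (Ici 0) := by
  rw [leb, measurableEmbedding_coe_nnreal.map_comap, NNReal.range_coe]

lemma coe_preimage_Ioc (a b : ℝ≥0) : ((↑) : ℝ≥0 → ℝ) ⁻¹' Ioc (a : ℝ) b = Ioc a b := by
  ext x; simp

lemma leb_restrict_Ioc_map_coe (a b : ℝ≥0) :
    (leb.restrict (Ioc a b)).map ((↑) : ℝ≥0 → ℝ) = volume.restrict (Ioc (a : ℝ) b) := by
  rw [← coe_preimage_Ioc, ← measurableEmbedding_coe_nnreal.restrict_map, leb_map_coe,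
    Measure.restrict_restrict measurableSet_Ioc, inter_eq_self_of_subset_left]
  exact fun x hx => a.2.trans hx.1.le

lemma leb_Ioc (a b : ℝ≥0) : leb (Ioc a b) = ENNReal.ofReal (b - a) := by
  have h := congrArg (fun μ => μ univ) (leb_restrict_Ioc_map_coe a b)
  simpa [measurableEmbedding_coe_nnreal.map_apply] using h

instance : NullSingletonClass leb where
  measure_singleton x := by
    rw [leb, measurableEmbedding_coe_nnreal.comap_apply]; simp

instance : IsLocallyFiniteMeasure leb where
  finiteAtNhds x := by
    refine ⟨Iio (x + 1), Iio_mem_nhds (by simp), ?_⟩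
    have h : Iio (x + 1) ⊆ {0} ∪ Ioc 0 (x + 1) := by
      intro y hy
      rcases eq_or_ne y 0 with h | h
      · exact Or.inl h
      · exact Or.inr ⟨pos_iff_ne_zero.2 h, (mem_Iio.1 hy).le⟩
    refine (measure_mono h).trans_lt ((measure_union_le _ _).trans_lt ?_)
    rw [measure_singleton, leb_Ioc]
    simp

lemma setIntegral_leb_Ioc {a b : ℝ≥0} (hab : a ≤ b) (f : ℝ≥0 → ℝ) :
    ∫ s in Ioc a b, f s ∂leb = ∫ s in (a : ℝ)..b, f s.toNNReal := by
  rw [intervalIntegral.integral_of_le (by exact_mod_cast hab), ← leb_restrict_Ioc_map_coe,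
    measurableEmbedding_coe_nnreal.integral_map]
  simp

lemma integrableOn_leb_Ioc_iff {a b : ℝ≥0} (hab : a ≤ b) (f : ℝ≥0 → ℝ) :
    IntegrableOn f (Ioc a b) leb ↔
      IntervalIntegrable (fun s : ℝ => f s.toNNReal) volume a b := by
  rw [intervalIntegrable_iff_integrableOn_Ioc_of_le (by exact_mod_cast hab), IntegrableOn,
    IntegrableOn, ← leb_restrict_Ioc_map_coe, measurableEmbedding_coe_nnreal.integrable_map_iff]
  simp [Function.comp_def]

instance (a b : ℝ≥0) : IsFiniteMeasure (leb.restrict (Ioc a b)) where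
  measure_univ_lt_top := by simp [leb_Ioc]

/-! ### Compensation on the predictable σ-algebra -/

/-- A kernel of finite measures is s-finite, even without a uniform bound on the masses. -/
lemma isSFiniteKernel_of_forall_lt_top {α β : Type*} [MeasurableSpace α] [MeasurableSpace β]
    (κ : Kernel α β) (h : ∀ a, κ a univ < ⊤) : IsSFiniteKernel κ := by
  classical
  let A : ℕ → Set α := fun n => {a | (n : ℝ≥0∞) ≤ κ a univ ∧ κ a univ < n + 1}
  have hA : ∀ n, MeasurableSet (A n) := fun n =>
    (measurableSet_le measurable_const (κ.measurable_coe .univ)).inter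
      (measurableSet_lt (κ.measurable_coe .univ) measurable_const)
  have hfin : ∀ n, IsFiniteKernel (Kernel.piecewise (hA n) κ 0) := fun n => by
    refine ⟨n + 1, by finiteness, fun a => ?_⟩
    rw [Kernel.piecewise_apply]
    split_ifs with ha
    · exact ha.2.le
    · simp
  have hsum : κ = Kernel.sum fun n => Kernel.piecewise (hA n) κ 0 := by
    ext a s hs
    rw [Kernel.sum_apply' _ _ hs]
    have hfl : ∃ n : ℕ, a ∈ A n := by
      lift κ a univ to ℝ≥0 using (h a).ne with x hx
      refine ⟨⌊x⌋₊, ?_, ?_⟩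
      · rw [← hx]; exact_mod_cast Nat.floor_le x.2
      · rw [← hx]; exact_mod_cast Nat.lt_floor_add_one x
    obtain ⟨n, hn⟩ := hfl
    rw [tsum_eq_single n]
    · rw [Kernel.piecewise_apply, if_pos hn]
    · intro m hm
      rw [Kernel.piecewise_apply, if_neg]
      · simp
      intro hm'
      apply hm
      have h1 : (n : ℝ≥0∞) < m + 1 := hn.1.trans_lt hm'.2
      have h2 : (m : ℝ≥0∞) < n + 1 := hm'.1.trans_lt hn.2
      norm_cast at h1 h2
      omega
  rw [hsum]
  infer_instance

section Compensation

variable {Ω : Type*} {mΩ : MeasurableSpace Ω} {X : Type*} [mX : MeasurableSpace X]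

lemma predictable_le_prod (𝓕 : Filtration ℝ≥0 mΩ) :
    𝓕.predictable ≤ (inferInstance : MeasurableSpace (ℝ≥0 × Ω)) :=
  measurableSpace_le_predictable_of_measurableSet
    (fun _ hA => (measurableSet_singleton _).prod (𝓕.le _ _ hA))
    (fun _ _ hA => measurableSet_Ioi.prod (𝓕.le _ _ hA))

lemma measurable_fst_predictable (𝓕 : Filtration ℝ≥0 mΩ) :
    Measurable[𝓕.predictable] (Prod.fst : ℝ≥0 × Ω → ℝ≥0) := by
  rw [BorelSpace.measurable_eq (α := ℝ≥0), borel_eq_generateFrom_Ioi]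
  refine @measurable_generateFrom _ _ 𝓕.predictable _ _ ?_
  rintro _ ⟨a, rfl⟩
  have h : Prod.fst ⁻¹' Ioi a = Ioi a ×ˢ (univ : Set Ω) := by ext; simp
  rw [h]
  exact measurableSet_predictable_Ioi_prod .univ

lemma isPiSystem_predictable (𝓕 : Filtration ℝ≥0 mΩ) :
    IsPiSystem ({s : Set (ℝ≥0 × Ω) | ∃ A, MeasurableSet[𝓕 ⊥] A ∧ s = {⊥} ×ˢ A} ∪
      {s | ∃ i A, MeasurableSet[𝓕 i] A ∧ s = Ioi i ×ˢ A}) := by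
  rintro _ (⟨A, hA, rfl⟩ | ⟨i, A, hA, rfl⟩) _ (⟨B, hB, rfl⟩ | ⟨j, B, hB, rfl⟩) hne
  · exact Or.inl ⟨A ∩ B, hA.inter hB, by rw [prod_inter_prod, inter_self]⟩
  · obtain ⟨x, hx⟩ := hne
    simp only [mem_inter_iff, mem_prod, mem_singleton_iff, mem_Ioi] at hx
    exact absurd hx.2.1 (by rw [hx.1.1]; exact not_lt_bot)
  · obtain ⟨x, hx⟩ := hne
    simp only [mem_inter_iff, mem_prod, mem_singleton_iff, mem_Ioi] at hx
    exact absurd hx.1.1 (by rw [hx.2.1]; exact not_lt_bot)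
  · exact Or.inr ⟨i ⊔ j, A ∩ B, (𝓕.mono le_sup_left _ hA).inter (𝓕.mono le_sup_right _ hB),
      by rw [prod_inter_prod, Ioi_inter_Ioi]⟩

/-- Reordering of the coordinates: a scenario and a marked time give a point of the predictable
space together with a mark. -/
def reorder (p : Ω × (ℝ≥0 × X)) : (ℝ≥0 × Ω) × X := ((p.2.1, p.1), p.2.2)

lemma measurable_reorder (𝓕 : Filtration ℝ≥0 mΩ) :
    Measurable[_, 𝓕.predictable.prod mX] (reorder : Ω × (ℝ≥0 × X) → (ℝ≥0 × Ω) × X) := by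
  refine @Measurable.prodMk _ _ _ _ 𝓕.predictable _ _ _ ?_ (by fun_prop)
  have h : Measurable (fun p : Ω × (ℝ≥0 × X) => (p.2.1, p.1)) := by fun_prop
  exact h.mono le_rfl (predictable_le_prod 𝓕)

/-- Two random measures on `(t, T] × X`, of finite expected mass, whose conditional expected
increments after every time agree, have the same mean measure on the predictable sets. -/
theorem map_reorder_eq (P : Measure Ω) [IsProbabilityMeasure P] (𝓕 : Filtration ℝ≥0 mΩ)
    (t T : ℝ≥0) (κ ν : Kernel Ω (ℝ≥0 × X)) [IsSFiniteKernel κ] [IsSFiniteKernel ν]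
    (hκ : ∀ ω, κ ω ((Ioc t T)ᶜ ×ˢ univ) = 0) (hν : ∀ ω, ν ω ((Ioc t T)ᶜ ×ˢ univ) = 0)
    (hfin : ∫⁻ ω, ν ω univ ∂P < ⊤)
    (h : ∀ s, t ≤ s → s ≤ T → ∀ A, MeasurableSet[𝓕 s] A → ∀ C, MeasurableSet C →
      ∫⁻ ω in A, κ ω (Ioi s ×ˢ C) ∂P = ∫⁻ ω in A, ν ω (Ioi s ×ˢ C) ∂P) :
    @Measure.map _ _ _ (𝓕.predictable.prod mX) reorder (P ⊗ₘ κ) =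
      @Measure.map _ _ _ (𝓕.predictable.prod mX) reorder (P ⊗ₘ ν) := by
  have hmap : ∀ (ξ : Kernel Ω (ℝ≥0 × X)) [IsSFiniteKernel ξ] (B : Set ℝ≥0) (A : Set Ω)
      (C : Set X), MeasurableSet B → MeasurableSet A → MeasurableSet C →
      (P ⊗ₘ ξ) (reorder ⁻¹' ((B ×ˢ A) ×ˢ C)) = ∫⁻ ω in A, ξ ω (B ×ˢ C) ∂P := by
    intro ξ _ B A C hB hA hC
    have : (reorder ⁻¹' ((B ×ˢ A) ×ˢ C) : Set (Ω × (ℝ≥0 × X))) = A ×ˢ (B ×ˢ C) := by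
      ext p; simp only [reorder, mem_preimage, mem_prod]; tauto
    rw [this, Measure.compProd_apply_prod hA (hB.prod hC)]
  have hall : ∀ s, ∀ A, MeasurableSet[𝓕 s] A → ∀ C, MeasurableSet C →
      ∫⁻ ω in A, κ ω (Ioi s ×ˢ C) ∂P = ∫⁻ ω in A, ν ω (Ioi s ×ˢ C) ∂P := by
    intro s A hA C hC
    rcases lt_or_ge T s with hs | hs
    · have hz : ∀ ξ : Kernel Ω (ℝ≥0 × X), (∀ ω, ξ ω ((Ioc t T)ᶜ ×ˢ univ) = 0) →
          ∀ ω, ξ ω (Ioi s ×ˢ C) = 0 := fun ξ hξ ω => by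
        refine measure_mono_null ?_ (hξ ω)
        exact prod_mono (fun x hx hx' => absurd (hx'.2.trans_lt hs) (not_lt.2 (le_of_lt hx)))
          (subset_univ _)
      simp [hz κ hκ, hz ν hν]
    rcases le_total t s with hts | hts
    · exact h s hts hs A hA C hC
    by_cases htT : t ≤ T
    · have hz : ∀ ξ : Kernel Ω (ℝ≥0 × X), (∀ ω, ξ ω ((Ioc t T)ᶜ ×ˢ univ) = 0) →
          ∀ ω, ξ ω (Ioi s ×ˢ C) = ξ ω (Ioi t ×ˢ C) := fun ξ hξ ω => by
        refine le_antisymm ?_ (measure_mono (prod_mono (Ioi_subset_Ioi hts) subset_rfl))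
        have : (Ioi s ×ˢ C : Set (ℝ≥0 × X)) ⊆ (Ioi t ×ˢ C) ∪ ((Ioc t T)ᶜ ×ˢ univ) := by
          rintro ⟨x, y⟩ ⟨hx, hy⟩
          by_cases hxt : t < x
          · exact Or.inl ⟨hxt, hy⟩
          · exact Or.inr ⟨fun h => hxt h.1, trivial⟩
        refine (measure_mono this).trans ((measure_union_le _ _).trans ?_)
        rw [hξ, add_zero]
      simp_rw [hz κ hκ, hz ν hν]
      exact h t le_rfl htT A (𝓕.mono hts _ hA) C hC
    · have hz : ∀ ξ : Kernel Ω (ℝ≥0 × X), (∀ ω, ξ ω ((Ioc t T)ᶜ ×ˢ univ) = 0) →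
          ∀ ω, ξ ω (Ioi s ×ˢ C) = 0 := fun ξ hξ ω => by
        refine measure_mono_null ?_ (hξ ω)
        exact prod_mono (fun x _ hx' => htT (hx'.1.le.trans hx'.2)) (subset_univ _)
      simp [hz κ hκ, hz ν hν]
  have hbot : ∀ A, MeasurableSet[𝓕 ⊥] A → ∀ C, MeasurableSet C →
      ∫⁻ ω in A, κ ω ({⊥} ×ˢ C) ∂P = ∫⁻ ω in A, ν ω ({⊥} ×ˢ C) ∂P := by
    intro A hA C hC
    have hz : ∀ ξ : Kernel Ω (ℝ≥0 × X), (∀ ω, ξ ω ((Ioc t T)ᶜ ×ˢ univ) = 0) →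
        ∀ ω, ξ ω ({⊥} ×ˢ C) = 0 := fun ξ hξ ω => by
      refine measure_mono_null (prod_mono ?_ (subset_univ _)) (hξ ω)
      rintro _ rfl h
      exact not_lt_bot h.1
    simp only [hz κ hκ, hz ν hν]
  -- the mean measures of the sets `B × C` with `B` predictable
  have hrect : ∀ C, MeasurableSet C → ∀ B, MeasurableSet[𝓕.predictable] B →
      (P ⊗ₘ κ) (reorder ⁻¹' (B ×ˢ C)) = (P ⊗ₘ ν) (reorder ⁻¹' (B ×ˢ C)) := by
    intro C hC
    have huniv : (P ⊗ₘ κ) (reorder ⁻¹' (univ ×ˢ C)) = (P ⊗ₘ ν) (reorder ⁻¹' (univ ×ˢ C)) := by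
      have hu : (univ : Set (ℝ≥0 × Ω)) = univ ×ˢ univ := by simp
      rw [hu, hmap κ _ _ _ .univ .univ hC, hmap ν _ _ _ .univ .univ hC]
      have hz : ∀ ξ : Kernel Ω (ℝ≥0 × X), (∀ ω, ξ ω ((Ioc t T)ᶜ ×ˢ univ) = 0) →
          ∀ ω, ξ ω (univ ×ˢ C) = ξ ω (Ioi ⊥ ×ˢ C) := fun ξ hξ ω => by
        refine le_antisymm ?_ (measure_mono (prod_mono (subset_univ _) subset_rfl))
        have : (univ ×ˢ C : Set (ℝ≥0 × X)) ⊆ (Ioi ⊥ ×ˢ C) ∪ ((Ioc t T)ᶜ ×ˢ univ) := by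
          rintro ⟨x, y⟩ ⟨hx, hy⟩
          by_cases hxt : ⊥ < x
          · exact Or.inl ⟨hxt, hy⟩
          · exact Or.inr ⟨fun h => hxt (bot_le.trans_lt h.1), trivial⟩
        refine (measure_mono this).trans ((measure_union_le _ _).trans ?_)
        rw [hξ, add_zero]
      simp_rw [hz κ hκ, hz ν hν]
      exact hall ⊥ univ .univ C hC
    have hνfin : (P ⊗ₘ ν) univ < ⊤ := by
      rw [Measure.compProd_apply .univ]; simpa using hfin
    intro B hB
    have hle : ∀ ξ : Kernel Ω (ℝ≥0 × X), ∀ B, MeasurableSet[𝓕.predictable] B →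
        MeasurableSet (reorder ⁻¹' (B ×ˢ C) : Set (Ω × (ℝ≥0 × X))) := fun ξ B hB =>
      measurable_reorder 𝓕 (@MeasurableSet.prod _ _ 𝓕.predictable _ _ _ hB hC)
    induction B, hB using @MeasurableSpace.induction_on_inter _ 𝓕.predictable _ _ rfl
      (isPiSystem_predictable 𝓕) with
    | empty => simp
    | basic B hB =>
      rcases hB with ⟨A, hA, rfl⟩ | ⟨i, A, hA, rfl⟩
      · rw [hmap κ _ _ _ (measurableSet_singleton _) (𝓕.le _ _ hA) hC,
          hmap ν _ _ _ (measurableSet_singleton _) (𝓕.le _ _ hA) hC]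
        exact hbot A hA C hC
      · rw [hmap κ _ _ _ measurableSet_Ioi (𝓕.le _ _ hA) hC,
          hmap ν _ _ _ measurableSet_Ioi (𝓕.le _ _ hA) hC]
        exact hall i A hA C hC
    | compl B hB ih =>
      have hd : (reorder ⁻¹' (Bᶜ ×ˢ C) : Set (Ω × (ℝ≥0 × X))) =
          reorder ⁻¹' (univ ×ˢ C) \ reorder ⁻¹' (B ×ˢ C) := by
        ext p; simp only [mem_preimage, mem_prod, mem_compl_iff, Set.mem_sdiff, mem_univ]; tauto
      have hsub : (reorder ⁻¹' (B ×ˢ C) : Set (Ω × (ℝ≥0 × X))) ⊆ reorder ⁻¹' (univ ×ˢ C) :=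
        preimage_mono (prod_mono (subset_univ _) subset_rfl)
      have hf : (P ⊗ₘ ν) (reorder ⁻¹' (B ×ˢ C)) ≠ ⊤ :=
        ((measure_mono (subset_univ _)).trans_lt hνfin).ne
      rw [hd, measure_sdiff hsub (hle κ B hB).nullMeasurableSet (by rw [ih]; exact hf),
        measure_sdiff hsub (hle ν B hB).nullMeasurableSet hf, ih, huniv]
    | iUnion f hfd hfm ih =>
      have hd : (reorder ⁻¹' ((⋃ n, f n) ×ˢ C) : Set (Ω × (ℝ≥0 × X))) =
          ⋃ n, reorder ⁻¹' (f n ×ˢ C) := by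
        ext p; simp
      have hdis : Pairwise (Function.onFun Disjoint
          fun n => (reorder ⁻¹' (f n ×ˢ C) : Set (Ω × (ℝ≥0 × X)))) := fun m n hmn =>
        Disjoint.preimage _ (Disjoint.set_prod_left (hfd hmn) _ _)
      rw [hd, measure_iUnion hdis fun n => hle κ _ (hfm n),
        measure_iUnion hdis fun n => hle ν _ (hfm n)]
      exact tsum_congr ih
  have hνfin : (P ⊗ₘ ν) univ < ⊤ := by
    rw [Measure.compProd_apply .univ]; simpa using hfin
  let m𝓟 : MeasurableSpace (ℝ≥0 × Ω) := 𝓕.predictable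
  have hm := measurable_reorder (X := X) 𝓕
  have hκν : ∀ B C, MeasurableSet B → MeasurableSet C →
      (P ⊗ₘ κ).map reorder (B ×ˢ C) = (P ⊗ₘ ν).map reorder (B ×ˢ C) := fun B C hB hC => by
    rw [Measure.map_apply hm (hB.prod hC), Measure.map_apply hm (hB.prod hC)]
    exact hrect C hC B hB
  have : IsFiniteMeasure ((P ⊗ₘ κ).map (reorder (X := X))) := by
    refine ⟨?_⟩
    have := hκν univ univ .univ .univ
    rw [univ_prod_univ] at this
    rw [this, Measure.map_apply hm .univ]
    exact hνfin
  refine ext_of_generate_finite _ generateFrom_prod.symm isPiSystem_prod ?_ ?_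
  · rintro _ ⟨B, hB, C, hC, rfl⟩
    exact hκν B C hB hC
  · simpa using hκν univ univ .univ .univ

variable {P : Measure Ω} [IsProbabilityMeasure P] {𝓕 : Filtration ℝ≥0 mΩ}
  {κ ν : Kernel Ω (ℝ≥0 × X)} [IsSFiniteKernel κ]

/-- Compensation for a predictable integrand: under equality of the mean measures on predictable
sets, the integral against `κ` is integrable as soon as the absolute integral against the
compensator `ν` is, and the two integrals have the same expectation. -/
theorem integral_eq_of_map_reorder_eq [IsSFiniteKernel ν]
    (h : @Measure.map _ _ _ (𝓕.predictable.prod mX) reorder (P ⊗ₘ κ) =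
      @Measure.map _ _ _ (𝓕.predictable.prod mX) reorder (P ⊗ₘ ν))
    {H : (ℝ≥0 × Ω) × X → ℝ} (hH : Measurable[𝓕.predictable.prod mX] H)
    (hint : ∫⁻ ω, ∫⁻ p, ‖H (reorder (ω, p))‖ₑ ∂(ν ω) ∂P < ⊤) :
    Integrable (fun ω => ∫ p, H (reorder (ω, p)) ∂(κ ω)) P ∧
      Integrable (fun ω => ∫ p, H (reorder (ω, p)) ∂(ν ω)) P ∧
      ∫ ω, ∫ p, H (reorder (ω, p)) ∂(κ ω) ∂P = ∫ ω, ∫ p, H (reorder (ω, p)) ∂(ν ω) ∂P ∧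
      ∀ᵐ ω ∂P, Integrable (fun p => H (reorder (ω, p))) (ν ω) := by
  have hm := measurable_reorder (X := X) 𝓕
  have hHr : Measurable (fun p : Ω × (ℝ≥0 × X) => H (reorder p)) := hH.comp hm
  have hν : Integrable (fun p : Ω × (ℝ≥0 × X) => H (reorder p)) (P ⊗ₘ ν) := by
    refine ⟨hHr.aestronglyMeasurable, ?_⟩
    rw [HasFiniteIntegral, Measure.lintegral_compProd hHr.enorm]
    exact hint
  have hκ : Integrable (fun p : Ω × (ℝ≥0 × X) => H (reorder p)) (P ⊗ₘ κ) := by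
    let m𝓟 : MeasurableSpace (ℝ≥0 × Ω) := 𝓕.predictable
    exact (integrable_map_measure hH.aestronglyMeasurable hm.aemeasurable).1
      (h ▸ (integrable_map_measure hH.aestronglyMeasurable hm.aemeasurable).2 hν)
  have heq : ∫ p, H (reorder p) ∂(P ⊗ₘ κ) = ∫ p, H (reorder p) ∂(P ⊗ₘ ν) := by
    let m𝓟 : MeasurableSpace (ℝ≥0 × Ω) := 𝓕.predictable
    rw [← integral_map hm.aemeasurable hH.aestronglyMeasurable,
      ← integral_map hm.aemeasurable hH.aestronglyMeasurable, h]
  refine ⟨Integrable.integral_compProd (κ := Kernel.const Unit P) (η := Kernel.prodMkLeft Unit κ)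
      (a := ()) hκ, Integrable.integral_compProd (κ := Kernel.const Unit P)
      (η := Kernel.prodMkLeft Unit ν) (a := ()) hν, ?_, ?_⟩
  · rw [← Measure.integral_compProd hκ, ← Measure.integral_compProd hν, heq]
  · exact ((Measure.integrable_compProd_iff hν.1).1 hν).1

/-- A predictable set that is null for the compensator is null for the random measure. -/
theorem ae_ae_of_map_reorder_eq
    (h : @Measure.map _ _ _ (𝓕.predictable.prod mX) reorder (P ⊗ₘ κ) =
      @Measure.map _ _ _ (𝓕.predictable.prod mX) reorder (P ⊗ₘ ν))
    {p : (ℝ≥0 × Ω) × X → Prop} (hp : MeasurableSet[𝓕.predictable.prod mX] {x | p x})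
    (hν : ∀ᵐ ω ∂P, ∀ᵐ x ∂(ν ω), p (reorder (ω, x))) :
    ∀ᵐ ω ∂P, ∀ᵐ x ∂(κ ω), p (reorder (ω, x)) := by
  have hm := measurable_reorder (X := X) 𝓕
  have h1 : ∀ᵐ x ∂(P ⊗ₘ ν), p (reorder x) := Measure.ae_compProd_of_ae_ae (hm hp) hν
  have h2 : ∀ᵐ x ∂(P ⊗ₘ κ), p (reorder x) := by
    let m𝓟 : MeasurableSpace (ℝ≥0 × Ω) := 𝓕.predictable
    exact (ae_map_iff hm.aemeasurable hp).1 (h ▸ (ae_map_iff hm.aemeasurable hp).2 h1)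
  exact Measure.ae_ae_of_ae_compProd h2

end Compensation

end

section

/-! ### Càdlàg paths -/

section Paths

variable {t T : ℝ≥0}

/-- Compactness of `[t, T]`, in a form suited to one-sided neighbourhoods. -/
lemma Icc_induction_one_sided {p : Set ℝ≥0 → Prop} (he : p ∅)
    (hmono : ∀ ⦃s u⦄, s ⊆ u → p u → p s) (hunion : ∀ ⦃s u⦄, p s → p u → p (s ∪ u))
    (hsingle : ∀ x ∈ Icc t T, p {x}) (hleft : ∀ x ∈ Ioc t T, ∃ u ∈ 𝓝[<] x, p u)
    (hright : ∀ x ∈ Ico t T, ∃ u ∈ 𝓝[>] x, p u) : p (Icc t T) := by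
  refine isCompact_Icc.induction_on he hmono hunion fun x hx => ?_
  have h1 : ∃ u ∈ 𝓝[Icc t T ∩ Iio x] x, p u := by
    rcases hx.1.eq_or_lt with rfl | htx
    · refine ⟨∅, ?_, he⟩
      have : Icc t T ∩ Iio t = ∅ := by ext y; simp; intro h _; exact h
      simp [this]
    · obtain ⟨u, hu, hpu⟩ := hleft x ⟨htx, hx.2⟩
      exact ⟨u, nhdsWithin_mono _ inter_subset_right hu, hpu⟩
  have h2 : ∃ u ∈ 𝓝[Icc t T ∩ Ioi x] x, p u := by
    rcases hx.2.eq_or_lt with rfl | hxT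
    · refine ⟨∅, ?_, he⟩
      have : Icc t x ∩ Ioi x = ∅ := by ext y; simp
      simp [this]
    · obtain ⟨u, hu, hpu⟩ := hright x ⟨hx.1, hxT⟩
      exact ⟨u, nhdsWithin_mono _ inter_subset_right hu, hpu⟩
  obtain ⟨u, hu, hpu⟩ := h1
  obtain ⟨v, hv, hpv⟩ := h2
  refine ⟨u ∪ {x} ∪ v, ?_, hunion (hunion hpu (hsingle x hx)) hpv⟩
  have hsub : Icc t T ⊆ (Icc t T ∩ Iio x) ∪ {x} ∪ (Icc t T ∩ Ioi x) := by
    intro y hy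
    rcases lt_trichotomy y x with h | h | h
    · exact Or.inl (Or.inl ⟨hy, h⟩)
    · exact Or.inl (Or.inr h)
    · exact Or.inr ⟨hy, h⟩
  refine nhdsWithin_mono x hsub ?_
  rw [nhdsWithin_union, nhdsWithin_union, nhdsWithin_singleton]
  refine ⟨⟨mem_of_superset hu fun y hy => Or.inl (Or.inl hy), ?_⟩,
    mem_of_superset hv fun y hy => Or.inr hy⟩
  exact mem_pure.2 (Or.inl (Or.inr rfl))

/-- Splitting an interval at finitely many points: a transitive relation that holds on the
intervals without points of `F` in their interior holds on all intervals. -/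
lemma Icc_induction_finset (F : Finset ℝ≥0) {p : ℝ≥0 → ℝ≥0 → Prop}
    (htrans : ∀ a c b, t ≤ a → a < c → c < b → b ≤ T → p a c → p c b → p a b)
    (hbase : ∀ a b, t ≤ a → a ≤ b → b ≤ T → (∀ c ∈ F, ¬ (a < c ∧ c < b)) → p a b) :
    ∀ a b, t ≤ a → a ≤ b → b ≤ T → p a b := by
  classical
  suffices h : ∀ n : ℕ, ∀ a b, t ≤ a → a ≤ b → b ≤ T →
      (F.filter fun c => a < c ∧ c < b).card ≤ n → p a b from
    fun a b ha hab hb => h _ a b ha hab hb le_rfl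
  intro n
  induction n with
  | zero =>
    intro a b ha hab hb hn
    refine hbase a b ha hab hb fun c hc hacb => ?_
    have := Finset.card_eq_zero.1 (Nat.le_zero.1 hn)
    have hmem : c ∈ F.filter fun c => a < c ∧ c < b := Finset.mem_filter.2 ⟨hc, hacb⟩
    rw [this] at hmem
    simp at hmem
  | succ n ih =>
    intro a b ha hab hb hn
    by_cases hF : ∃ c ∈ F, a < c ∧ c < b
    · obtain ⟨c, hc, hac, hcb⟩ := hF
      have hmem : c ∈ F.filter fun c => a < c ∧ c < b := Finset.mem_filter.2 ⟨hc, hac, hcb⟩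
      have hlt : ∀ a' b', a ≤ a' → b' ≤ b → (c ≤ a' ∨ b' ≤ c) →
          (F.filter fun c => a' < c ∧ c < b').card ≤ n := by
        intro a' b' haa hbb hor
        refine Nat.lt_succ_iff.1 (lt_of_lt_of_le (Finset.card_lt_card ?_) hn)
        refine Finset.ssubset_iff_of_subset ?_ |>.2 ⟨c, hmem, ?_⟩
        · intro x hx
          rw [Finset.mem_filter] at hx ⊢
          exact ⟨hx.1, haa.trans_lt hx.2.1, hx.2.2.trans_le hbb⟩
        · rw [Finset.mem_filter]
          rintro ⟨-, h1, h2⟩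
          rcases hor with h | h
          · exact absurd h1 (not_lt.2 h)
          · exact absurd h2 (not_lt.2 h)
      exact htrans a c b ha hac hcb hb
        (ih a c ha hac.le (hcb.le.trans hb) (hlt a c le_rfl hcb.le (Or.inr le_rfl)))
        (ih c b (ha.trans hac.le) hcb.le hb (hlt c b hac.le le_rfl (Or.inl le_rfl)))
    · push Not at hF
      exact hbase a b ha hab hb fun c hc h => absurd h.2 (not_lt.2 (hF c hc h.1))

lemma nhdsLT_neBot_of_lt {a x : ℝ≥0} (h : a < x) : (𝓝[<] x).NeBot :=
  nhdsLT_neBot_of_exists_lt ⟨a, h⟩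

namespace IsCadlagOn

variable {E : Type*} [TopologicalSpace E] {f : ℝ≥0 → E}

lemma tendsto_leftLim (hf : IsCadlagOn f t T) {s : ℝ≥0} (hs : s ∈ Ioc t T) :
    Tendsto f (𝓝[<] s) (𝓝 (Function.leftLim f s)) :=
  tendsto_leftLim_of_tendsto (hf.2 s hs)

lemma tendsto_right (hf : IsCadlagOn f t T) {s : ℝ≥0} (hs : s ∈ Ico t T) :
    Tendsto f (𝓝[>] s) (𝓝 (f s)) :=
  (hf.1 s hs).tendsto.mono_left (nhdsWithin_mono _ Ioi_subset_Ici_self)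

lemma exists_bound {f : ℝ≥0 → ℝ} (hf : IsCadlagOn f t T) :
    ∃ C, 0 ≤ C ∧ ∀ s ∈ Icc t T, |f s| ≤ C := by
  have h : ∃ C, ∀ s ∈ Icc t T, |f s| ≤ C := by
    refine Icc_induction_one_sided (p := fun u => ∃ C, ∀ s ∈ u, |f s| ≤ C) ⟨0, by simp⟩ ?_ ?_ ?_
      ?_ ?_
    · rintro s u hsu ⟨C, hC⟩
      exact ⟨C, fun x hx => hC x (hsu hx)⟩
    · rintro s u ⟨C, hC⟩ ⟨D, hD⟩
      refine ⟨max C D, ?_⟩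
      rintro x (hx | hx)
      · exact (hC x hx).trans (le_max_left _ _)
      · exact (hD x hx).trans (le_max_right _ _)
    · intro x _
      exact ⟨|f x|, by simp⟩
    · intro x hx
      refine ⟨{s | |f s| ≤ |Function.leftLim f x| + 1}, ?_, _, fun s hs => hs⟩
      exact ((hf.tendsto_leftLim hx).abs.eventually (gt_mem_nhds (lt_add_one _))).mono
        fun s hs => le_of_lt hs
    · intro x hx
      refine ⟨{s | |f s| ≤ |f x| + 1}, ?_, _, fun s hs => hs⟩
      exact ((hf.tendsto_right hx).abs.eventually (gt_mem_nhds (lt_add_one _))).mono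
        fun s hs => le_of_lt hs
  obtain ⟨C, hC⟩ := h
  exact ⟨max C 0, le_max_right _ _, fun s hs => (hC s hs).trans (le_max_left _ _)⟩

lemma abs_leftLim_le {f : ℝ≥0 → ℝ} (hf : IsCadlagOn f t T) {C : ℝ}
    (hC : ∀ s ∈ Icc t T, |f s| ≤ C) {s : ℝ≥0} (hs : s ∈ Ioc t T) :
    |Function.leftLim f s| ≤ C := by
  have := nhdsLT_neBot_of_lt hs.1
  refine le_of_tendsto (hf.tendsto_leftLim hs).abs ?_
  filter_upwards [Ioo_mem_nhdsLT hs.1] with r hr using hC r ⟨hr.1.le, hr.2.le.trans hs.2⟩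

lemma _root_.LargeInvestor.leftLim_eq_of_forall_Ioo [T2Space E] {a b : ℝ≥0} (hab : a < b) {c : E}
    (h : ∀ r ∈ Ioo a b, f r = c) : Function.leftLim f b = c := by
  have := nhdsLT_neBot_of_lt hab
  refine leftLim_eq_of_tendsto (tendsto_const_nhds.congr' ?_)
  filter_upwards [Ioo_mem_nhdsLT hab] with r hr using (h r hr).symm

variable [DiscreteTopology E]

/-- A càdlàg path in a discrete space has finitely many jumps. -/
lemma finite_jumps (hf : IsCadlagOn f t T) :
    {s | s ∈ Ioc t T ∧ Function.leftLim f s ≠ f s}.Finite := by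
  set J := {s | s ∈ Ioc t T ∧ Function.leftLim f s ≠ f s} with hJ
  have h : (Icc t T ∩ J).Finite := by
    refine Icc_induction_one_sided (p := fun u => (u ∩ J).Finite) (by simp)
      (fun s u hsu hu => hu.subset (inter_subset_inter_left _ hsu))
      (fun s u hs hu => by rw [union_inter_distrib_right]; exact hs.union hu)
      (fun x _ => (finite_singleton x).subset inter_subset_left) ?_ ?_
    · intro x hx
      have h1 := (hf.tendsto_leftLim hx).eventually
        (show {Function.leftLim f x} ∈ 𝓝 (Function.leftLim f x) by simp)
      obtain ⟨a, ha, hsub⟩ := (mem_nhdsLT_iff_exists_Ioo_subset' hx.1).1 h1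
      refine ⟨Ioo a x, Ioo_mem_nhdsLT ha, ?_⟩
      convert! finite_empty
      rw [eq_empty_iff_forall_notMem]
      rintro r ⟨hr, -, hne⟩
      refine hne ?_
      rw [show f r = _ from hsub hr]
      exact leftLim_eq_of_forall_Ioo hr.1 fun y hy => hsub ⟨hy.1, hy.2.trans hr.2⟩
    · intro x hx
      have h1 := (hf.tendsto_right hx).eventually (show {f x} ∈ 𝓝 (f x) by simp)
      obtain ⟨a, ha, hsub⟩ := (mem_nhdsGT_iff_exists_Ioo_subset' hx.2).1 h1
      refine ⟨Ioo x a, Ioo_mem_nhdsGT ha, ?_⟩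
      convert! finite_empty
      rw [eq_empty_iff_forall_notMem]
      rintro r ⟨hr, -, hne⟩
      refine hne ?_
      rw [show f r = _ from hsub hr]
      exact leftLim_eq_of_forall_Ioo hr.1 fun y hy => hsub ⟨hy.1, hy.2.trans hr.2⟩
  exact h.subset fun s hs => ⟨⟨hs.1.1.le, hs.1.2⟩, hs⟩

lemma eq_of_no_jump (hf : IsCadlagOn f t T) {a b : ℝ≥0} (ha : t ≤ a) (hb : b ≤ T)
    (h : ∀ s ∈ Ioo a b, Function.leftLim f s = f s) {s : ℝ≥0} (hs : s ∈ Ico a b) :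
    f s = f a := by
  have hc : ContinuousOn f (Ico a b) := by
    intro r hr
    have hright : ContinuousWithinAt f (Ici r) r := hf.1 r ⟨ha.trans hr.1, hr.2.trans_le hb⟩
    rcases hr.1.eq_or_lt with rfl | har
    · exact hright.mono fun y hy => hy.1
    · have hl := hf.tendsto_leftLim (s := r) ⟨ha.trans_lt har, hr.2.le.trans hb⟩
      rw [h r ⟨har, hr.2⟩] at hl
      have : ContinuousAt f r := continuousAt_iff_continuous_left'_right'.2
        ⟨hl, hright.mono Ioi_subset_Ici_self⟩
      exact this.continuousWithinAt
  exact isPreconnected_Ico.constant hc hs ⟨le_rfl, hs.1.trans_lt hs.2⟩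

lemma leftLim_eq_of_no_jump (hf : IsCadlagOn f t T) {a b : ℝ≥0} (ha : t ≤ a)
    (hb : b ≤ T) (h : ∀ s ∈ Ioo a b, Function.leftLim f s = f s) {s : ℝ≥0} (hs : s ∈ Ioc a b) :
    Function.leftLim f s = f a :=
  leftLim_eq_of_forall_Ioo hs.1 fun _ hr =>
    hf.eq_of_no_jump ha hb h ⟨hr.1.le, hr.2.trans_le hs.2⟩

/-- A path that is away from `j` at time `a` and at `j` at time `b` enters `j` in between. -/
lemma exists_entry (hf : IsCadlagOn f t T) {j : E} {a b : ℝ≥0} (ha : t ≤ a) (hab : a ≤ b)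
    (hb : b ≤ T) (hfa : f a ≠ j) (hfb : f b = j) :
    ∃ r ∈ Ioc a b, Function.leftLim f r ≠ j ∧ f r = j := by
  have hfin := hf.finite_jumps
  refine Icc_induction_finset (t := t) (T := T) hfin.toFinset
    (p := fun a b => f a ≠ j → f b = j → ∃ r ∈ Ioc a b, Function.leftLim f r ≠ j ∧ f r = j)
    ?_ ?_ a b ha hab hb hfa hfb
  · intro a c b _ hac hcb _ h1 h2 hfa hfb
    by_cases hc : f c = j
    · obtain ⟨r, hr, h⟩ := h1 hfa hc
      exact ⟨r, ⟨hr.1, hr.2.trans hcb.le⟩, h⟩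
    · obtain ⟨r, hr, h⟩ := h2 hc hfb
      exact ⟨r, ⟨hac.trans hr.1, hr.2⟩, h⟩
  · intro a b ha hab hb hF hfa hfb
    have hlt : a < b := hab.lt_of_ne (by rintro rfl; exact hfa hfb)
    refine ⟨b, ⟨hlt, le_rfl⟩, ?_, hfb⟩
    rw [hf.leftLim_eq_of_no_jump ha hb _ ⟨hlt, le_rfl⟩]
    · exact hfa
    · intro s hs
      by_contra hne
      exact hF s (hfin.mem_toFinset.2 ⟨⟨ha.trans_lt hs.1, hs.2.le.trans hb⟩, hne⟩) hs

end IsCadlagOn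

end Paths

/-! ### Predictability of left limits -/

/-- The point of the grid `ℕ / (n + 1)` strictly below `s`, but not below `t`. -/
def gridBelow (t : ℝ≥0) (n : ℕ) (s : ℝ≥0) : ℝ≥0 :=
  max t (((⌈(n + 1) * s⌉₊ - 1 : ℕ) : ℝ≥0) / (n + 1))

lemma gridBelow_lt {t s : ℝ≥0} (n : ℕ) (hs : t < s) : gridBelow t n s < s := by
  refine max_lt hs ?_
  have hpos : 0 < ((n : ℝ≥0) + 1) * s := by
    have : 0 < s := pos_of_gt hs
    positivity
  rw [div_lt_iff₀ (by positivity), mul_comm s]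
  have h1 : 0 < ⌈((n : ℝ≥0) + 1) * s⌉₊ := Nat.ceil_pos.2 hpos
  exact Nat.lt_ceil.1 (Nat.sub_lt h1 Nat.one_pos)

lemma le_gridBelow_add {t s : ℝ≥0} (n : ℕ) : s ≤ gridBelow t n s + 1 / (n + 1) := by
  have h : s ≤ ((⌈((n : ℝ≥0) + 1) * s⌉₊ - 1 : ℕ) : ℝ≥0) / (n + 1) + 1 / (n + 1) := by
    rw [← add_div, le_div_iff₀ (by positivity), mul_comm]
    refine (Nat.le_ceil _).trans ?_
    exact_mod_cast (by omega : ⌈((n : ℝ≥0) + 1) * s⌉₊ ≤ ⌈((n : ℝ≥0) + 1) * s⌉₊ - 1 + 1)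
  exact h.trans (add_le_add_left (le_max_right _ _) _)

lemma tendsto_one_div_add_one_nnreal :
    Tendsto (fun n : ℕ => (1 : ℝ≥0) / (n + 1)) atTop (𝓝 0) := by
  exact tendsto_one_div_add_atTop_nhds_zero_nat

lemma tendsto_gridBelow {t s : ℝ≥0} (hs : t < s) :
    Tendsto (fun n => gridBelow t n s) atTop (𝓝[<] s) := by
  refine tendsto_nhdsWithin_iff.2 ⟨?_, Eventually.of_forall fun n => gridBelow_lt n hs⟩
  have h1 : Tendsto (fun n : ℕ => s - 1 / (n + 1)) atTop (𝓝 s) := by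
    simpa using tendsto_const_nhds.sub tendsto_one_div_add_one_nnreal
  refine tendsto_of_tendsto_of_tendsto_of_le_of_le h1 tendsto_const_nhds (fun n => ?_)
    fun n => (gridBelow_lt n hs).le
  exact tsub_le_iff_right.2 (le_gridBelow_add n)

/-- The point of the grid `ℕ / (n + 1)` strictly above `s`, but not above `T`. -/
def gridAbove (T : ℝ≥0) (n : ℕ) (s : ℝ≥0) : ℝ≥0 :=
  min T (((⌊(n + 1) * s⌋₊ : ℝ≥0) + 1) / (n + 1))

lemma lt_gridAbove {T s : ℝ≥0} (n : ℕ) (hs : s < T) : s < gridAbove T n s := by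
  refine lt_min hs ?_
  rw [lt_div_iff₀ (by positivity), mul_comm]
  exact Nat.lt_floor_add_one _

lemma gridAbove_le_add {T s : ℝ≥0} (n : ℕ) : gridAbove T n s ≤ s + 1 / (n + 1) := by
  refine (min_le_right _ _).trans ?_
  rw [add_div]
  refine add_le_add_left ?_ _
  rw [div_le_iff₀ (by positivity), mul_comm]
  exact Nat.floor_le (by positivity)

lemma tendsto_gridAbove {T s : ℝ≥0} (hs : s < T) :
    Tendsto (fun n => gridAbove T n s) atTop (𝓝[>] s) := by
  refine tendsto_nhdsWithin_iff.2 ⟨?_, Eventually.of_forall fun n => lt_gridAbove n hs⟩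
  have h1 : Tendsto (fun n : ℕ => s + 1 / (n + 1)) atTop (𝓝 s) := by
    simpa using tendsto_const_nhds.add tendsto_one_div_add_one_nnreal
  exact tendsto_of_tendsto_of_tendsto_of_le_of_le tendsto_const_nhds h1
    (fun n => (lt_gridAbove n hs).le) fun n => gridAbove_le_add n

section Measurability

variable {Ω : Type*} {mΩ : MeasurableSpace Ω} {𝓕 : Filtration ℝ≥0 mΩ} {t T : ℝ≥0}
  {E : Type*} [TopologicalSpace E]

open Classical in
/-- The process of left limits of `X` on `(t, T] × A`, set to `c` elsewhere. -/
def leftVersion (X : ℝ≥0 → Ω → E) (A : Set Ω) (t T : ℝ≥0) (c : E) (p : ℝ≥0 × Ω) : E :=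
  if p.1 ∈ Ioc t T ∧ p.2 ∈ A then Function.leftLim (fun r => X r p.2) p.1 else c

open Classical in
/-- The process `X` on `[t, T) × A`, set to `c` elsewhere. -/
def rightVersion {E : Type*} (X : ℝ≥0 → Ω → E) (A : Set Ω) (t T : ℝ≥0) (c : E) (p : ℝ≥0 × Ω) : E :=
  if p.1 ∈ Ico t T ∧ p.2 ∈ A then X p.1 p.2 else c

lemma leftVersion_of_mem {X : ℝ≥0 → Ω → E} {A : Set Ω} {c : E} {s : ℝ≥0} {ω : Ω}
    (hs : s ∈ Ioc t T) (hω : ω ∈ A) :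
    leftVersion X A t T c (s, ω) = Function.leftLim (fun r => X r ω) s := if_pos ⟨hs, hω⟩

lemma rightVersion_of_mem {E : Type*} {X : ℝ≥0 → Ω → E} {A : Set Ω} {c : E} {s : ℝ≥0} {ω : Ω}
    (hs : s ∈ Ico t T) (hω : ω ∈ A) :
    rightVersion X A t T c (s, ω) = X s ω := if_pos ⟨hs, hω⟩

lemma measurableSet_predictable_Ioc_univ_prod {A : Set Ω} (hA : MeasurableSet[𝓕 0] A) :
    MeasurableSet[𝓕.predictable] (Ioc t T ×ˢ A) :=
  measurableSet_predictable_Ioc_prod _ _ (𝓕.mono bot_le _ hA)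

/-- The left limits of an adapted càdlàg process are predictable: they are the pointwise limits of
the values of the process at the preceding grid points. -/
lemma measurable_predictable_leftVersion [TopologicalSpace.PseudoMetrizableSpace E]
    [MeasurableSpace E] [BorelSpace E] {X : ℝ≥0 → Ω → E}
    (hX : ∀ s ∈ Icc t T, Measurable[𝓕 s] (X s)) {A : Set Ω} (hA : MeasurableSet[𝓕 0] A)
    (hcad : ∀ ω ∈ A, IsCadlagOn (fun s => X s ω) t T) (c : E) :
    Measurable[𝓕.predictable] (leftVersion X A t T c) := by
  classical
  let m𝓟 : MeasurableSpace (ℝ≥0 × Ω) := 𝓕.predictable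
  let f : ℕ → ℝ≥0 × Ω → E := fun n p =>
    if p.1 ∈ Ioc t T ∧ p.2 ∈ A then X (gridBelow t n p.1) p.2 else c
  have hlim : Tendsto f atTop (𝓝 (leftVersion X A t T c)) := by
    rw [tendsto_pi_nhds]
    rintro ⟨s, ω⟩
    by_cases h : s ∈ Ioc t T ∧ ω ∈ A
    · simp only [f, leftVersion, if_pos h]
      exact ((hcad ω h.2).tendsto_leftLim h.1).comp (tendsto_gridBelow h.1.1)
    · simp only [f, leftVersion, if_neg h]
      exact tendsto_const_nhds
  refine measurable_of_tendsto_metrizable (fun n => ?_) hlim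
  intro B hB
  -- on each grid interval the approximation is constant in time, hence predictable
  have hset : f n ⁻¹' B = (⋃ k : ℕ, Ioc (max t (k / (n + 1))) (min T ((k + 1) / (n + 1))) ×ˢ
      (X (max t (k / (n + 1))) ⁻¹' B ∩ A)) ∪ ((Ioc t T ×ˢ A)ᶜ ∩ {_p | c ∈ B}) := by
    ext ⟨s, ω⟩
    by_cases h : s ∈ Ioc t T ∧ ω ∈ A
    · have hs0 : 0 < s := pos_of_gt h.1.1
      simp only [mem_preimage, f, mem_union, mem_iUnion, mem_prod, mem_Ioc, max_lt_iff,
        le_min_iff, mem_inter_iff, mem_compl_iff, mem_ofPred_eq, h.1.1, h.1.2, h.2, true_and,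
        and_true, not_true_eq_false, false_and, or_false]
      have hn1 : 0 < ((n : ℝ≥0) + 1) := by positivity
      have hkey : ∀ k : ℕ, ((k : ℝ≥0) / (n + 1) < s ∧ s ≤ (k + 1) / (n + 1)) ↔
          k = ⌈((n : ℝ≥0) + 1) * s⌉₊ - 1 := by
        intro k
        rw [div_lt_iff₀ hn1, le_div_iff₀ hn1, mul_comm s]
        have hpos : 0 < ⌈((n : ℝ≥0) + 1) * s⌉₊ := Nat.ceil_pos.2 (by positivity)
        have e1 : (k : ℝ≥0) < (n + 1) * s ↔ k < ⌈((n : ℝ≥0) + 1) * s⌉₊ := Nat.lt_ceil.symm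
        have e2 : ((n : ℝ≥0) + 1) * s ≤ k + 1 ↔ ⌈((n : ℝ≥0) + 1) * s⌉₊ ≤ k + 1 := by
          rw [Nat.ceil_le]; push_cast; rfl
        rw [e1, e2]
        omega
      constructor
      · intro hb
        exact ⟨_, (hkey _).2 rfl, hb⟩
      · rintro ⟨k, hk, hb⟩
        rw [(hkey k).1 hk] at hb
        exact hb
    · simp only [mem_preimage, f, if_neg h, mem_union, mem_iUnion, mem_inter_iff, mem_compl_iff,
        mem_ofPred_eq]
      constructor
      · intro hc
        exact Or.inr ⟨h, hc⟩
      · rintro (⟨k, hk⟩ | hk)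
        · exfalso
          exact h ⟨⟨(le_max_left _ _).trans_lt hk.1.1, hk.1.2.trans (min_le_left _ _)⟩, hk.2.2⟩
        · exact hk.2
  rw [hset]
  refine MeasurableSet.union (MeasurableSet.iUnion fun k => ?_) ?_
  · rcases le_or_gt (max t ((k : ℝ≥0) / (n + 1))) T with hk | hk
    · exact measurableSet_predictable_Ioc_prod _ _
        ((hX _ ⟨le_max_left _ _, hk⟩ hB).inter (𝓕.mono bot_le _ hA))
    · rw [Ioc_eq_empty (not_lt.2 ((min_le_left _ _).trans hk.le)), empty_prod]
      exact MeasurableSet.empty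
  · exact (measurableSet_predictable_Ioc_univ_prod hA).compl.inter (MeasurableSet.const _)

/-- A càdlàg process is jointly measurable: it is the pointwise limit of its values at the
following grid points. -/
lemma measurable_rightVersion [TopologicalSpace.PseudoMetrizableSpace E] [MeasurableSpace E]
    [BorelSpace E] {X : ℝ≥0 → Ω → E}
    (hX : ∀ s ∈ Icc t T, Measurable (X s)) {A : Set Ω} (hA : MeasurableSet A)
    (hcad : ∀ ω ∈ A, IsCadlagOn (fun s => X s ω) t T) (c : E) :
    Measurable (rightVersion X A t T c) := by
  classical
  rcases lt_or_ge T t with htT | htT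
  · have : rightVersion X A t T c = fun _ => c := by
      ext p
      exact if_neg fun h => absurd (h.1.1.trans h.1.2.le) (not_le.2 htT)
    rw [this]; exact measurable_const
  obtain ⟨g, hgdef⟩ : ∃ g : ℕ → ℕ → ℝ≥0, ∀ n k,
      g n k = max t (min T (((k : ℝ≥0) + 1) / ((n : ℝ≥0) + 1))) := ⟨_, fun _ _ => rfl⟩
  have hg : ∀ n k, g n k ∈ Icc t T := fun n k => by
    rw [hgdef]; exact ⟨le_max_left _ _, max_le htT (min_le_left _ _)⟩
  let f : ℕ → ℝ≥0 × Ω → E := fun n p =>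
    if p.1 ∈ Ico t T ∧ p.2 ∈ A then X (g n ⌊((n : ℝ≥0) + 1) * p.1⌋₊) p.2 else c
  have hlim : Tendsto f atTop (𝓝 (rightVersion X A t T c)) := by
    rw [tendsto_pi_nhds]
    rintro ⟨s, ω⟩
    by_cases h : s ∈ Ico t T ∧ ω ∈ A
    · simp only [f, rightVersion, if_pos h]
      refine (((hcad ω h.2).tendsto_right h.1).comp (tendsto_gridAbove h.1.2)).congr fun n => ?_
      have : t ≤ gridAbove T n s := h.1.1.trans (lt_gridAbove n h.1.2).le
      rw [hgdef]
      change X (gridAbove T n s) ω = X (max t (gridAbove T n s)) ω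
      rw [max_eq_right this]
    · simp only [f, rightVersion, if_neg h]
      exact tendsto_const_nhds
  refine measurable_of_tendsto_metrizable (fun n => ?_) hlim
  refine Measurable.ite ((measurable_fst measurableSet_Ico).inter (measurable_snd hA)) ?_
    measurable_const
  have h1 : Measurable (fun p : ℕ × Ω => X (g n p.1) p.2) :=
    measurable_from_prod_countable_right fun k => hX _ (hg n k)
  have h2 : Measurable (fun p : ℝ≥0 × Ω => (⌊((n : ℝ≥0) + 1) * p.1⌋₊, p.2)) :=
    (Nat.measurable_floor.comp (measurable_fst.const_mul _)).prodMk measurable_snd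
  exact h1.comp h2

end Measurability

end

section

/-! ### Simple point measures -/

section PointMeasure

variable {Z : Type*} [MeasurableSpace Z]

/-- A probability measure that takes only the values `0` and `1` on a generating algebra does so
on all measurable sets. -/
lemma isZeroOneMeasure_of_generateFrom {μ : Measure Z} [IsProbabilityMeasure μ]
    {𝒜 : Set (Set Z)} (h𝒜 : IsPiSystem 𝒜)
    (hgen : ‹MeasurableSpace Z› = MeasurableSpace.generateFrom 𝒜)
    (h : ∀ C ∈ 𝒜, μ C = 0 ∨ μ C = 1) : IsZeroOneMeasure μ where
  zero_one₀ C hC := by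
    induction C, hC using MeasurableSpace.induction_on_inter hgen h𝒜 with
    | empty => simp
    | basic C hC => exact h C hC
    | compl C hC ih =>
      rw [prob_compl_eq_zero_iff hC, prob_compl_eq_one_iff hC]
      exact ih.symm
    | iUnion f hfd hfm ih =>
      by_cases h1 : ∃ n, μ (f n) = 1
      · obtain ⟨n, hn⟩ := h1
        exact Or.inr (le_antisymm prob_le_one (hn ▸ measure_mono (subset_iUnion f n)))
      · push Not at h1
        exact Or.inl (measure_iUnion_null fun n => (ih n).resolve_right (h1 n))

/-- A measure that takes integer values on the intervals with endpoints in a dense set, and has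
small mass on an interval, does not charge it. -/
lemma measure_Ioo_eq_zero_of_lt_one {ν : Measure ℝ≥0} {D : Set ℝ≥0} (hD : Dense D)
    (hDc : D.Countable) (hint : ∀ a ∈ D, ∀ b ∈ D, ∃ n : ℕ, ν (Ioc a b) = n) {x y : ℝ≥0}
    (h : ν (Ioo x y) < 1) : ν (Ioo x y) = 0 := by
  have hsub : Ioo x y ⊆ ⋃ a ∈ D, ⋃ b ∈ D, ⋃ (_ : x < a ∧ b < y), Ioc a b := by
    intro s hs
    obtain ⟨a, ha, hxa, has⟩ := hD.exists_between hs.1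
    obtain ⟨b, hb, hsb, hby⟩ := hD.exists_between hs.2
    simp only [mem_iUnion]
    exact ⟨a, ha, b, hb, ⟨hxa, hby⟩, has, hsb.le⟩
  refine measure_mono_null hsub ?_
  rw [measure_biUnion_null_iff hDc]
  intro a ha
  rw [measure_biUnion_null_iff hDc]
  intro b hb
  rw [measure_iUnion_null_iff]
  intro hab
  obtain ⟨n, hn⟩ := hint a ha b hb
  have hlt : ν (Ioc a b) < 1 :=
    (measure_mono fun s (hs : s ∈ Ioc a b) =>
      (⟨hab.1.trans hs.1, hs.2.trans_lt hab.2⟩ : s ∈ Ioo x y)).trans_lt h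
  rw [hn] at hlt ⊢
  have : n < 1 := by exact_mod_cast hlt
  simp [Nat.lt_one_iff.1 this]

lemma exists_right_measure_lt_one (ν : Measure ℝ≥0) [IsFiniteMeasure ν] (x : ℝ≥0) :
    ∃ y, x < y ∧ ν (Ioo x y) < 1 := by
  have h := tendsto_measure_iInter_atTop (μ := ν) (s := fun n : ℕ => Ioo x (x + 1 / (n + 1)))
    (fun n => measurableSet_Ioo.nullMeasurableSet)
    (fun m n hmn => Ioo_subset_Ioo_right (by gcongr)) ⟨0, measure_ne_top _ _⟩
  have he : ⋂ n : ℕ, Ioo x (x + 1 / ((n : ℝ≥0) + 1)) = ∅ := by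
    rw [eq_empty_iff_forall_notMem]
    intro s hs
    rw [mem_iInter] at hs
    have h1 : Tendsto (fun n : ℕ => x + 1 / ((n : ℝ≥0) + 1)) atTop (𝓝 x) := by
      simpa using tendsto_const_nhds.add tendsto_one_div_add_one_nnreal
    exact absurd (ge_of_tendsto' h1 fun n => (hs n).2.le) (not_le.2 (hs 0).1)
  rw [he, measure_empty] at h
  obtain ⟨n, hn⟩ := (h.eventually (gt_mem_nhds zero_lt_one)).exists
  exact ⟨_, lt_add_of_pos_right _ (by positivity), hn⟩

lemma exists_left_measure_lt_one (ν : Measure ℝ≥0) [IsFiniteMeasure ν] {x : ℝ≥0} (hx : 0 < x) :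
    ∃ y, y < x ∧ ν (Ioo y x) < 1 := by
  have h := tendsto_measure_iInter_atTop (μ := ν) (s := fun n : ℕ => Ioo (x - 1 / (n + 1)) x)
    (fun n => measurableSet_Ioo.nullMeasurableSet)
    (fun m n hmn => Ioo_subset_Ioo_left (tsub_le_tsub_left (by gcongr) _))
    ⟨0, measure_ne_top _ _⟩
  have he : ⋂ n : ℕ, Ioo (x - 1 / ((n : ℝ≥0) + 1)) x = ∅ := by
    rw [eq_empty_iff_forall_notMem]
    intro s hs
    rw [mem_iInter] at hs
    have h1 : Tendsto (fun n : ℕ => x - 1 / ((n : ℝ≥0) + 1)) atTop (𝓝 x) := by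
      simpa using tendsto_const_nhds.sub tendsto_one_div_add_one_nnreal
    exact absurd (le_of_tendsto' h1 fun n => (hs n).1.le) (not_le.2 (hs 0).2)
  rw [he, measure_empty] at h
  obtain ⟨n, hn⟩ := (h.eventually (gt_mem_nhds zero_lt_one)).exists
  exact ⟨_, tsub_lt_self hx (by positivity), hn⟩

/-- A finite measure on `(t, T] × Z` that takes integer values on sufficiently many rectangles,
and has mass at most one at each time, is a finite sum of Dirac masses at distinct times. -/
theorem exists_finset_eq_sum_dirac [StandardBorelSpace Z] {μ : Measure (ℝ≥0 × Z)}
    [IsFiniteMeasure μ] {t T : ℝ≥0} (hsupp : μ ((Ioc t T)ᶜ ×ˢ univ) = 0) {D : Set ℝ≥0}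
    (hD : Dense D) (hDc : D.Countable) {𝒜 : Set (Set Z)} (h𝒜 : IsSetAlgebra 𝒜)
    (hgen : ‹MeasurableSpace Z› = MeasurableSpace.generateFrom 𝒜)
    (hint : ∀ a ∈ D, ∀ b ∈ D, ∀ C ∈ 𝒜, ∃ n : ℕ, μ (Ioc a b ×ˢ C) = n)
    (hsimple : ∀ x ∈ Ioc t T, μ ({x} ×ˢ univ) ≤ 1) :
    ∃ S : Finset (ℝ≥0 × Z), (∀ p ∈ S, p.1 ∈ Ioc t T) ∧ InjOn Prod.fst (S : Set (ℝ≥0 × Z)) ∧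
      μ = ∑ p ∈ S, Measure.dirac p := by
  classical
  set ν : Measure ℝ≥0 := μ.map Prod.fst with hν
  have hνapp : ∀ B, MeasurableSet B → ν B = μ (B ×ˢ univ) := fun B hB => by
    rw [hν, Measure.map_apply measurable_fst hB, prod_univ]
  have hνint : ∀ a ∈ D, ∀ b ∈ D, ∃ n : ℕ, ν (Ioc a b) = n := fun a ha b hb => by
    rw [hνapp _ measurableSet_Ioc]; exact hint a ha b hb univ h𝒜.univ_mem
  have hright : ∀ x, ∃ y, x < y ∧ ν (Ioo x y) = 0 := fun x => by
    obtain ⟨y, hxy, hy⟩ := exists_right_measure_lt_one ν x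
    exact ⟨y, hxy, measure_Ioo_eq_zero_of_lt_one hD hDc hνint hy⟩
  have hleft : ∀ x, 0 < x → ∃ y, y < x ∧ ν (Ioo y x) = 0 := fun x hx => by
    obtain ⟨y, hxy, hy⟩ := exists_left_measure_lt_one ν hx
    exact ⟨y, hxy, measure_Ioo_eq_zero_of_lt_one hD hDc hνint hy⟩
  have hmeas𝒜 : ∀ C ∈ 𝒜, MeasurableSet C := fun C hC => by
    rw [hgen]; exact MeasurableSpace.measurableSet_generateFrom hC
  -- the mass at a single time is zero, or a Dirac mass
  have hdirac : ∀ x ∈ Ioc t T, μ ({x} ×ˢ univ) ≠ 0 →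
      ∃ z, μ.restrict ({x} ×ˢ univ) = Measure.dirac (x, z) := by
    intro x hx hne
    obtain ⟨y₁, hy₁, hν₁⟩ := hleft x (pos_of_gt hx.1)
    obtain ⟨y₂, hy₂, hν₂⟩ := hright x
    obtain ⟨a, haD, hya, hax⟩ := hD.exists_between hy₁
    obtain ⟨b, hbD, hxb, hby⟩ := hD.exists_between hy₂
    have hval : ∀ C ∈ 𝒜, μ ({x} ×ˢ C) = μ (Ioc a b ×ˢ C) := by
      intro C hC
      refine le_antisymm (measure_mono (prod_mono ?_ subset_rfl)) ?_
      · rintro _ rfl; exact ⟨hax, hxb.le⟩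
      · have hsub : Ioc a b ×ˢ C ⊆ ({x} ×ˢ C) ∪ (Ioo y₁ x ×ˢ univ ∪ Ioo x y₂ ×ˢ univ) := by
          rintro ⟨s, z⟩ ⟨hs, hz⟩
          rcases lt_trichotomy s x with h | h | h
          · exact Or.inr (Or.inl ⟨⟨hya.trans hs.1, h⟩, trivial⟩)
          · exact Or.inl ⟨h, hz⟩
          · exact Or.inr (Or.inr ⟨⟨h, lt_of_le_of_lt hs.2 hby⟩, trivial⟩)
        refine (measure_mono hsub).trans ((measure_union_le _ _).trans ?_)
        rw [measure_union_null, add_zero]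
        · rw [← hνapp _ measurableSet_Ioo, hν₁]
        · rw [← hνapp _ measurableSet_Ioo, hν₂]
    have h01 : ∀ C ∈ 𝒜, μ ({x} ×ˢ C) = 0 ∨ μ ({x} ×ˢ C) = 1 := by
      intro C hC
      obtain ⟨n, hn⟩ := hint a haD b hbD C hC
      have hle : μ ({x} ×ˢ C) ≤ 1 :=
        (measure_mono (prod_mono subset_rfl (subset_univ _))).trans (hsimple x hx)
      rw [hval C hC, hn] at hle ⊢
      have : n ≤ 1 := by exact_mod_cast hle
      interval_cases n <;> simp
    set m : Measure Z := (μ.restrict ({x} ×ˢ univ)).map Prod.snd with hm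
    have hmapp : ∀ C, MeasurableSet C → m C = μ ({x} ×ˢ C) := fun C hC => by
      rw [hm, Measure.map_apply measurable_snd hC, Measure.restrict_apply (measurable_snd hC)]
      congr 1
      ext p; simp [and_comm]
    have : IsProbabilityMeasure m :=
      ⟨by rw [hmapp _ .univ]; exact (h01 univ h𝒜.univ_mem).resolve_left hne⟩
    have := isZeroOneMeasure_of_generateFrom (μ := m) (𝒜 := 𝒜)
      (fun s hs u hu _ => h𝒜.inter_mem hs hu) hgen fun C hC => by
        rw [hmapp C (hmeas𝒜 C hC)]; exact h01 C hC
    have : NeZero m := ⟨IsProbabilityMeasure.ne_zero m⟩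
    obtain ⟨z, hz⟩ := IsZeroOneMeasure.exists_eq_dirac (μ := m)
    refine ⟨z, ?_⟩
    ext B hB
    have hBx : MeasurableSet (Prod.mk x ⁻¹' B) := measurable_prodMk_left hB
    have h1 : μ.restrict ({x} ×ˢ univ) B = m (Prod.mk x ⁻¹' B) := by
      rw [hmapp _ hBx, Measure.restrict_apply hB]
      congr 1
      ext ⟨s, z⟩
      simp only [mem_inter_iff, mem_prod, mem_singleton_iff, mem_univ, and_true, mem_preimage]
      constructor
      · rintro ⟨h, rfl⟩; exact ⟨rfl, h⟩
      · rintro ⟨rfl, h⟩; exact ⟨h, rfl⟩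
    rw [h1, hz, Measure.dirac_apply' _ hBx, Measure.dirac_apply' _ hB]
    rfl
  -- finitely many times carry the whole mass
  have hcover : ∃ F : Finset ℝ≥0, ν (Icc t T \ F) = 0 := by
    refine Icc_induction_one_sided (p := fun u => ∃ F : Finset ℝ≥0, ν (u \ F) = 0)
      ⟨∅, by simp⟩ ?_ ?_ ?_ ?_ ?_
    · rintro s u hsu ⟨F, hF⟩
      exact ⟨F, measure_mono_null (sdiff_subset_sdiff_left hsu) hF⟩
    · rintro s u ⟨F, hF⟩ ⟨G, hG⟩
      refine ⟨F ∪ G, measure_mono_null ?_ (measure_union_null hF hG)⟩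
      rw [Finset.coe_union]
      rintro y ⟨hy | hy, hn⟩
      · exact Or.inl ⟨hy, fun h => hn (Or.inl h)⟩
      · exact Or.inr ⟨hy, fun h => hn (Or.inr h)⟩
    · intro x _
      exact ⟨{x}, by simp⟩
    · intro x hx
      obtain ⟨y, hy, h⟩ := hleft x (pos_of_gt hx.1)
      exact ⟨Ioo y x, Ioo_mem_nhdsLT hy, ∅, by simpa using h⟩
    · intro x _
      obtain ⟨y, hy, h⟩ := hright x
      exact ⟨Ioo x y, Ioo_mem_nhdsGT hy, ∅, by simpa using h⟩
  obtain ⟨F, hF⟩ := hcover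
  set G : Finset ℝ≥0 := F.filter fun x => x ∈ Ioc t T ∧ μ ({x} ×ˢ univ) ≠ 0 with hG
  have hGmem : ∀ x ∈ G, x ∈ Ioc t T ∧ μ ({x} ×ˢ univ) ≠ 0 := fun x hx =>
    (Finset.mem_filter.1 hx).2
  choose z hz using fun (x : G) => hdirac x.1 (hGmem x.1 x.2).1 (hGmem x.1 x.2).2
  have hinj : Function.Injective fun x : G => ((x : ℝ≥0), z x) := fun x y hxy =>
    Subtype.ext (Prod.ext_iff.1 hxy).1
  refine ⟨G.attach.map ⟨_, hinj⟩, ?_, ?_, ?_⟩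
  · intro p hp
    obtain ⟨x, -, rfl⟩ := Finset.mem_map.1 hp
    exact (hGmem x.1 x.2).1
  · intro p hp q hq hpq
    obtain ⟨x, -, rfl⟩ := Finset.mem_map.1 (Finset.mem_coe.1 hp)
    obtain ⟨y, -, rfl⟩ := Finset.mem_map.1 (Finset.mem_coe.1 hq)
    have : x = y := Subtype.ext hpq
    rw [this]
  · rw [Finset.sum_map]
    have hnull : μ ((G : Set ℝ≥0)ᶜ ×ˢ univ) = 0 := by
      have h1 : ((G : Set ℝ≥0)ᶜ ×ˢ univ : Set (ℝ≥0 × Z)) ⊆ ((Ioc t T)ᶜ ×ˢ univ) ∪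
          (((Icc t T \ F) ×ˢ univ) ∪
            ⋃ x ∈ F.filter fun x => μ ({x} ×ˢ univ) = 0, {x} ×ˢ univ) := by
        rintro ⟨s, y⟩ ⟨hs, -⟩
        by_cases h1 : s ∈ Ioc t T
        · by_cases h2 : s ∈ F
          · refine Or.inr (Or.inr ?_)
            simp only [mem_iUnion]
            refine ⟨s, Finset.mem_filter.2 ⟨h2, ?_⟩, rfl, trivial⟩
            by_contra h3
            exact hs (Finset.mem_coe.2 (Finset.mem_filter.2 ⟨h2, h1, h3⟩))
          · exact Or.inr (Or.inl ⟨⟨⟨h1.1.le, h1.2⟩, h2⟩, trivial⟩)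
        · exact Or.inl ⟨h1, trivial⟩
      refine measure_mono_null h1 (measure_union_null hsupp (measure_union_null ?_ ?_))
      · rw [← hνapp _ (measurableSet_Icc.diff F.measurableSet)]; exact hF
      · exact (measure_biUnion_null_iff (Finset.countable_toSet _)).2 fun x hx =>
          (Finset.mem_filter.1 hx).2
    ext B hB
    have h2 : μ B = ∑ x ∈ G, μ.restrict ({x} ×ˢ univ) B := by
      have h3 : μ B = μ (⋃ x ∈ G, B ∩ ({x} ×ˢ univ)) := by
        refine le_antisymm ?_ (measure_mono (iUnion₂_subset fun x _ => inter_subset_left))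
        have h4 : B ⊆ (⋃ x ∈ G, B ∩ ({x} ×ˢ univ)) ∪ ((G : Set ℝ≥0)ᶜ ×ˢ univ) := by
          rintro ⟨s, y⟩ hsy
          by_cases hs : s ∈ G
          · refine Or.inl ?_
            simp only [mem_iUnion]
            exact ⟨s, hs, hsy, rfl, trivial⟩
          · exact Or.inr ⟨hs, trivial⟩
        refine (measure_mono h4).trans ((measure_union_le _ _).trans ?_)
        rw [hnull, add_zero]
      rw [h3, measure_biUnion_finset]
      · exact Finset.sum_congr rfl fun x _ => (Measure.restrict_apply hB).symm
      · intro x _ y _ hxy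
        rw [Function.onFun, disjoint_left]
        rintro p ⟨-, hp, -⟩ ⟨-, hp', -⟩
        exact hxy (hp.symm.trans hp')
      · exact fun x _ => hB.inter ((measurableSet_singleton x).prod .univ)
    rw [h2, Measure.finsetSum_apply, ← Finset.sum_attach]
    exact Finset.sum_congr rfl fun x _ => by rw [hz x]; rfl

end PointMeasure

/-! ### Poisson random measures -/

lemma lintegral_cast_poissonMeasure (r : ℝ≥0) :
    ∫⁻ n, (n : ℝ≥0∞) ∂(poissonMeasure r) = r := by
  rw [poissonMeasure, lintegral_sum_measure]
  simp_rw [lintegral_smul_measure, lintegral_dirac]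
  rw [tsum_eq_zero_add' ENNReal.summable]
  have h : ∀ n : ℕ, ENNReal.ofReal (Real.exp (-r) * r ^ (n + 1) / (n + 1).factorial) •
      ((n + 1 : ℕ) : ℝ≥0∞) = r * ENNReal.ofReal (Real.exp (-r) * r ^ n / n.factorial) := by
    intro n
    have hr : (r : ℝ≥0∞) = ENNReal.ofReal r := by simp
    rw [smul_eq_mul, hr, ← ENNReal.ofReal_natCast, ← ENNReal.ofReal_mul (by positivity),
      ← ENNReal.ofReal_mul (by positivity)]
    congr 1
    rw [Nat.factorial_succ]
    push_cast
    field_simp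
    ring
  simp_rw [h]
  rw [ENNReal.tsum_mul_left,
    ← ENNReal.ofReal_tsum_of_nonneg (fun n => by positivity) (hasSum_one_poissonMeasure r).summable,
    (hasSum_one_poissonMeasure r).tsum_eq]
  simp

/-- Two or more points are improbable: the mass `1 - exp (-r) (1 + r)` is at most `r ^ 2`. -/
lemma poissonMeasure_one_lt_le (r : ℝ≥0) : poissonMeasure r {n | 1 < n} ≤ (r : ℝ≥0∞) ^ 2 := by
  have hc : {n : ℕ | 1 < n} = ({0} ∪ {1})ᶜ := by
    ext n; simp; omega
  rw [hc, prob_compl_eq_one_sub (by measurability), measure_union (by simp) (by simp),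
    poissonMeasure_singleton, poissonMeasure_singleton,
    ← ENNReal.ofReal_add (by positivity) (by positivity), tsub_le_iff_right]
  have hr : (r : ℝ≥0∞) = ENNReal.ofReal r := by simp
  rw [hr, ← ENNReal.ofReal_pow (NNReal.coe_nonneg r),
    ← ENNReal.ofReal_add (by positivity) (by positivity), ← ENNReal.ofReal_one]
  refine ENNReal.ofReal_le_ofReal ?_
  have h1 := Real.add_one_le_exp (-(r : ℝ))
  have h2 : (0 : ℝ) ≤ r := r.2
  simp only [pow_zero, Nat.factorial, pow_one, Nat.cast_one, mul_one, div_one, Nat.succ_eq_add_one,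
    zero_add]
  nlinarith [mul_le_mul_of_nonneg_right h1 h2]

namespace IsPoissonRandomMeasure

variable {Ω : Type*} {mΩ : MeasurableSpace Ω} {Z : Type*} [MeasurableSpace Z] {P : Measure Ω}
  {𝓕 : Filtration ℝ≥0 mΩ} {ς : Measure Z} {N : Ω → Measure (ℝ≥0 × Z)}

lemma measurable (hN : IsPoissonRandomMeasure P 𝓕 ς N) {T : ℝ≥0} {A : Set (ℝ≥0 × Z)}
    (hA : MeasurableSet A) (hAT : A ⊆ Iic T ×ˢ univ) : Measurable fun ω => N ω A :=
  (hN.adapted T A hA hAT).mono (𝓕.le T) le_rfl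

lemma lintegral (hN : IsPoissonRandomMeasure P 𝓕 ς N) {T : ℝ≥0} {A : Set (ℝ≥0 × Z)}
    (hA : MeasurableSet A) (hAT : A ⊆ Iic T ×ˢ univ) (hfin : (leb.prod ς) A < ⊤) :
    ∫⁻ ω, N ω A ∂P = (leb.prod ς) A := by
  have h1 : ∫⁻ ω, N ω A ∂P = ∫⁻ x, x ∂(P.map fun ω => N ω A) := by
    rw [lintegral_map (f := fun x => x) measurable_id (hN.measurable hA hAT)]
  rw [h1, hN.law A hA hfin, lintegral_map (f := fun x => x) measurable_id .of_discrete]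
  exact (lintegral_cast_poissonMeasure _).trans (ENNReal.coe_toNNReal hfin.ne)

lemma ae_exists_nat (hN : IsPoissonRandomMeasure P 𝓕 ς N) {T : ℝ≥0} {A : Set (ℝ≥0 × Z)}
    (hA : MeasurableSet A) (hAT : A ⊆ Iic T ×ˢ univ) (hfin : (leb.prod ς) A < ⊤) :
    ∀ᵐ ω ∂P, ∃ n : ℕ, N ω A = n := by
  have hms : MeasurableSet {x : ℝ≥0∞ | ∃ n : ℕ, x = n} := by
    have : {x : ℝ≥0∞ | ∃ n : ℕ, x = n} = range ((↑) : ℕ → ℝ≥0∞) := by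
      ext x; simp [eq_comm]
    rw [this]
    exact (countable_range _).measurableSet
  have h1 : ∀ᵐ x ∂(P.map fun ω => N ω A), ∃ n : ℕ, (x : ℝ≥0∞) = n := by
    rw [hN.law A hA hfin]
    exact (ae_map_iff Measurable.of_discrete.aemeasurable hms).2
      (Eventually.of_forall fun n => ⟨n, rfl⟩)
  exact (ae_map_iff (hN.measurable hA hAT).aemeasurable hms).1 h1

lemma measure_one_lt_le (hN : IsPoissonRandomMeasure P 𝓕 ς N) {T : ℝ≥0} {A : Set (ℝ≥0 × Z)}
    (hA : MeasurableSet A) (hAT : A ⊆ Iic T ×ˢ univ) (hfin : (leb.prod ς) A < ⊤) :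
    P {ω | 1 < N ω A} ≤ ((leb.prod ς) A) ^ 2 := by
  have h1 : P {ω | 1 < N ω A} = (P.map fun ω => N ω A) (Ioi 1) := by
    rw [Measure.map_apply (hN.measurable hA hAT) measurableSet_Ioi]; rfl
  rw [h1, hN.law A hA hfin, Measure.map_apply .of_discrete measurableSet_Ioi]
  have h2 : (fun n : ℕ => (n : ℝ≥0∞)) ⁻¹' Ioi 1 = {n | 1 < n} := by
    ext n; simp
  rw [h2]
  refine (poissonMeasure_one_lt_le _).trans ?_
  rw [ENNReal.coe_toNNReal hfin.ne]

variable [IsFiniteMeasure ς]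

lemma prod_Ioc_lt_top (a b : ℝ≥0) (C : Set Z) : (leb.prod ς) (Ioc a b ×ˢ C) < ⊤ := by
  rw [Measure.prod_prod, leb_Ioc]
  exact ENNReal.mul_lt_top ENNReal.ofReal_lt_top (measure_lt_top _ _)

/-- Almost surely, a Poisson random measure has no two points at the same time: some interval of a
partition into `n` intervals carries two points with probability at most `n * O(1 / n²)`. -/
theorem ae_simple (hN : IsPoissonRandomMeasure P 𝓕 ς N) (t T : ℝ≥0) :
    ∀ᵐ ω ∂P, ∀ x ∈ Ioc t T, N ω ({x} ×ˢ univ) ≤ 1 := by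
  rw [ae_iff]
  set B := {ω | ¬ ∀ x ∈ Ioc t T, N ω ({x} ×ˢ univ) ≤ 1} with hB
  rcases le_or_gt T t with hTt | htT
  · have : B = ∅ := by
      rw [eq_empty_iff_forall_notMem]
      intro ω hω
      apply hω
      rw [Ioc_eq_empty (not_lt.2 hTt)]
      simp
    rw [this, measure_empty]
  set c : ℝ≥0 := (T - t) * (ς univ).toNNReal with hc
  have hmain : ∀ n : ℕ, P B ≤ ((c ^ 2 * (1 / (n + 1)) : ℝ≥0) : ℝ≥0∞) := by
    intro n
    have hn1 : (0 : ℝ≥0) < n + 1 := by positivity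
    set d : ℝ≥0 := (T - t) / (n + 1) with hd
    have hd0 : 0 < d := div_pos (tsub_pos_of_lt htT) hn1
    have hdn : (n + 1) * d = T - t := by rw [hd]; field_simp
    set I : ℕ → Set (ℝ≥0 × Z) := fun k => Ioc (t + k * d) (t + (k + 1) * d) ×ˢ univ with hI
    have hIsub : ∀ k < n + 1, I k ⊆ Iic T ×ˢ univ := by
      intro k hk
      refine prod_mono (fun s hs => hs.2.trans ?_) subset_rfl
      calc t + ((k : ℝ≥0) + 1) * d ≤ t + (n + 1) * d := by
            gcongr; exact_mod_cast Nat.lt_succ_iff.1 hk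
        _ = T := by rw [hdn]; exact add_tsub_cancel_of_le htT.le
    have hIm : ∀ k, (leb.prod ς) (I k) = ((d * (ς univ).toNNReal : ℝ≥0) : ℝ≥0∞) := by
      intro k
      rw [hI, Measure.prod_prod, leb_Ioc, ENNReal.coe_mul,
        ENNReal.coe_toNNReal (measure_ne_top _ _)]
      congr 1
      push_cast
      rw [show (t : ℝ) + (k + 1) * d - (t + k * d) = d by ring]
      simp
    have hsub : B ⊆ ⋃ k ∈ Finset.range (n + 1), {ω | 1 < N ω (I k)} := by
      intro ω hω
      simp only [hB, mem_ofPred_eq] at hω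
      push Not at hω
      obtain ⟨x, hx, h1⟩ := hω
      simp only [mem_iUnion, Finset.mem_range]
      have hxt : 0 < (x - t) / d := div_pos (tsub_pos_of_lt hx.1) hd0
      have hce : 0 < ⌈(x - t) / d⌉₊ := Nat.ceil_pos.2 hxt
      refine ⟨⌈(x - t) / d⌉₊ - 1, ?_, ?_⟩
      · have : ⌈(x - t) / d⌉₊ ≤ n + 1 := by
          rw [Nat.ceil_le, div_le_iff₀ hd0]
          push_cast
          rw [hdn]
          exact tsub_le_tsub_right hx.2 _
        omega
      · refine h1.trans_le (measure_mono (prod_mono ?_ subset_rfl))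
        intro s hs
        rw [mem_singleton_iff.1 hs]
        constructor
        · rw [← lt_tsub_iff_left, ← lt_div_iff₀ hd0]
          exact Nat.lt_ceil.1 (Nat.sub_lt hce Nat.one_pos)
        · rw [← tsub_le_iff_left, ← div_le_iff₀ hd0]
          refine (Nat.le_ceil _).trans ?_
          have h3 : ⌈(x - t) / d⌉₊ ≤ ⌈(x - t) / d⌉₊ - 1 + 1 := by omega
          exact_mod_cast h3
    refine (measure_mono hsub).trans ((measure_biUnion_finset_le _ _).trans ?_)
    have hle : ∀ k ∈ Finset.range (n + 1), P {ω | 1 < N ω (I k)} ≤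
        (((d * (ς univ).toNNReal) ^ 2 : ℝ≥0) : ℝ≥0∞) := by
      intro k hk
      refine (hN.measure_one_lt_le (measurableSet_Ioc.prod .univ)
        (hIsub k (Finset.mem_range.1 hk)) ?_).trans ?_
      · rw [hIm]; exact ENNReal.coe_lt_top
      · rw [hIm, ENNReal.coe_pow]
    refine (Finset.sum_le_sum hle).trans ?_
    rw [Finset.sum_const, Finset.card_range, nsmul_eq_mul]
    have : ((n + 1 : ℕ) : ℝ≥0∞) = (((n + 1 : ℕ) : ℝ≥0) : ℝ≥0∞) := by push_cast; rfl
    rw [this, ← ENNReal.coe_mul, ENNReal.coe_le_coe, hd, hc]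
    refine le_of_eq ?_
    push_cast
    field_simp
  have hlim : Tendsto (fun n : ℕ => ((c ^ 2 * (1 / (n + 1)) : ℝ≥0) : ℝ≥0∞)) atTop (𝓝 0) := by
    rw [← ENNReal.coe_zero, ENNReal.tendsto_coe]
    simpa using tendsto_one_div_add_one_nnreal.const_mul (c ^ 2)
  exact le_antisymm (ge_of_tendsto' hlim hmain) zero_le

/-- Almost surely, the points of a Poisson random measure in `(t, T]` form a finite set, with
distinct times. -/
theorem ae_exists_finset [StandardBorelSpace Z] (hN : IsPoissonRandomMeasure P 𝓕 ς N)
    (t T : ℝ≥0) :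
    ∀ᵐ ω ∂P, ∃ S : Finset (ℝ≥0 × Z), (∀ p ∈ S, p.1 ∈ Ioc t T) ∧
      InjOn Prod.fst (S : Set (ℝ≥0 × Z)) ∧
      (N ω).restrict (Ioc t T ×ˢ univ) = ∑ p ∈ S, Measure.dirac p := by
  obtain ⟨D, hDc, hD⟩ := TopologicalSpace.exists_countable_dense ℝ≥0
  set 𝒜 := generateSetAlgebra (MeasurableSpace.countableGeneratingSet Z) with h𝒜
  have h𝒜c : 𝒜.Countable :=
    countable_generateSetAlgebra MeasurableSpace.countable_countableGeneratingSet
  have hgen : ‹MeasurableSpace Z› = MeasurableSpace.generateFrom 𝒜 := by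
    rw [h𝒜, generateFrom_generateSetAlgebra_eq]
    exact MeasurableSpace.generateFrom_countableGeneratingSet.symm
  have halg : IsSetAlgebra 𝒜 := isSetAlgebra_generateSetAlgebra
  have hmeas𝒜 : ∀ C ∈ 𝒜, MeasurableSet C := fun C hC => by
    rw [hgen]; exact MeasurableSpace.measurableSet_generateFrom hC
  have hsub : ∀ (a b : ℝ≥0) (C : Set Z),
      ((Ioc a b ∩ Ioc t T) ×ˢ C : Set (ℝ≥0 × Z)) ⊆ Iic T ×ˢ univ := fun a b C =>
    prod_mono (fun s hs => hs.2.2) (subset_univ _)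
  have hfin : ∀ (a b : ℝ≥0) (C : Set Z), (leb.prod ς) ((Ioc a b ∩ Ioc t T) ×ˢ C) < ⊤ :=
    fun a b C => (measure_mono (prod_mono inter_subset_right subset_rfl)).trans_lt
      (prod_Ioc_lt_top t T C)
  have hint : ∀ᵐ ω ∂P, ∀ a ∈ D, ∀ b ∈ D, ∀ C ∈ 𝒜,
      ∃ n : ℕ, N ω ((Ioc a b ∩ Ioc t T) ×ˢ C) = n := by
    rw [ae_ball_iff hDc]
    intro a _
    rw [ae_ball_iff hDc]
    intro b _
    rw [ae_ball_iff h𝒜c]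
    intro C hC
    exact hN.ae_exists_nat ((measurableSet_Ioc.inter measurableSet_Ioc).prod (hmeas𝒜 C hC))
      (hsub a b C) (hfin a b C)
  have htot := hN.ae_exists_nat (T := T) (A := Ioc t T ×ˢ univ) (measurableSet_Ioc.prod .univ)
    (prod_mono (fun s hs => hs.2) subset_rfl) (prod_Ioc_lt_top t T univ)
  filter_upwards [hint, htot, hN.ae_simple t T] with ω h1 h2 h3
  have hI : MeasurableSet (Ioc t T ×ˢ (univ : Set Z)) := measurableSet_Ioc.prod .univ
  have : IsFiniteMeasure ((N ω).restrict (Ioc t T ×ˢ univ)) := by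
    refine ⟨?_⟩
    rw [Measure.restrict_apply_univ]
    obtain ⟨n, hn⟩ := h2
    rw [hn]
    exact ENNReal.natCast_lt_top n
  refine exists_finset_eq_sum_dirac ?_ hD hDc halg hgen ?_ ?_
  · rw [Measure.restrict_apply' hI, prod_inter_prod, compl_inter_self, empty_prod, measure_empty]
  · intro a ha b hb C hC
    rw [Measure.restrict_apply' hI, prod_inter_prod, inter_univ]
    exact h1 a ha b hb C hC
  · intro x hx
    exact (Measure.restrict_apply_le _ _).trans (h3 x hx)

/-- The expected number of points after time `s`, on an event of `𝓕 s`, is given by the intensity,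
by independence of the increments from the past. -/
lemma setLIntegral_eq (hN : IsPoissonRandomMeasure P 𝓕 ς N) {s T : ℝ≥0}
    {A : Set Ω} (hA : MeasurableSet[𝓕 s] A) {C : Set Z} (hC : MeasurableSet C) :
    ∫⁻ ω in A, N ω (Ioc s T ×ˢ C) ∂P = ∫⁻ _ω in A, (leb.prod ς) (Ioc s T ×ˢ C) ∂P := by
  have hm : MeasurableSet (Ioc s T ×ˢ C) := measurableSet_Ioc.prod hC
  have hsub : (Ioc s T ×ˢ C : Set (ℝ≥0 × Z)) ⊆ Iic T ×ˢ univ :=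
    prod_mono (fun s hs => hs.2) (subset_univ _)
  have hA' : MeasurableSet A := 𝓕.le s _ hA
  have hmle := (hN.measurable hm hsub).comap_le
  have hind : Indep (𝓕 s)
      (MeasurableSpace.comap (fun ω => N ω (Ioc s T ×ˢ C)) inferInstance) P := by
    refine indep_of_indep_of_le_right (hN.indep_past s) ?_
    exact le_iSup_of_le (Ioc s T ×ˢ C) (le_iSup_of_le hm (le_iSup_of_le
      (prod_mono (fun r hr => hr.1) (subset_univ _)) le_rfl))
  have hA1 : Measurable[𝓕 s] (A.indicator (1 : Ω → ℝ≥0∞)) := by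
    let m : MeasurableSpace Ω := 𝓕 s
    exact measurable_one.indicator hA
  have h := lintegral_mul_eq_lintegral_mul_lintegral_of_independent_measurableSpace (𝓕.le s) hmle
    hind (f := A.indicator 1) (g := fun ω => N ω (Ioc s T ×ˢ C))
    hA1 (comap_measurable _)
  rw [hN.lintegral hm hsub (prod_Ioc_lt_top s T C), lintegral_indicator_one hA'] at h
  rw [setLIntegral_const, mul_comm, ← h, ← lintegral_indicator hA']
  refine lintegral_congr fun ω => ?_
  by_cases hω : ω ∈ A <;> simp [hω]

end IsPoissonRandomMeasure

end

section

/-! ### Counting the jumps of a path with values in a discrete space -/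

section Counting

variable {E : Type*} [TopologicalSpace E] {f : ℝ≥0 → E} {t T : ℝ≥0}

/-- The jump times of `f` in `(t, T]`. -/
def jumpTimes (f : ℝ≥0 → E) (t T : ℝ≥0) : Set ℝ≥0 :=
  {s | s ∈ Ioc t T ∧ Function.leftLim f s ≠ f s}

open Classical in
/-- The finite set of times in `(s, T]` at which `f` jumps to `j` (empty if `f` has infinitely many
jumps). -/
def entryTimes (f : ℝ≥0 → E) (t T s : ℝ≥0) (j : E) : Finset ℝ≥0 :=
  if h : (jumpTimes f t T).Finite then h.toFinset.filter fun r => s < r ∧ f r = j else ∅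

open Classical in
/-- The number of intervals of the partition of `(s, T]` into `n + 1` equal pieces at whose left
end `f` is away from `j` while it is at `j` at the right end. -/
def gridEntries (f : ℝ≥0 → E) (T s : ℝ≥0) (j : E) (n : ℕ) : ℕ :=
  ((Finset.range (n + 1)).filter fun k : ℕ =>
    f (s + k * ((T - s) / (n + 1))) ≠ j ∧ f (s + (k + 1) * ((T - s) / (n + 1))) = j).card

/-- The grid interval of step `d` that contains `r` is determined by `r`. -/
lemma mem_Ioc_grid_iff {s d r : ℝ≥0} (hd : 0 < d) (hr : s < r) (k : ℕ) :
    r ∈ Ioc (s + k * d) (s + (k + 1) * d) ↔ k = ⌈(r - s) / d⌉₊ - 1 := by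
  have hce : 0 < ⌈(r - s) / d⌉₊ := Nat.ceil_pos.2 (div_pos (tsub_pos_of_lt hr) hd)
  have h1 : s + k * d < r ↔ k < ⌈(r - s) / d⌉₊ := by
    rw [← lt_tsub_iff_left, ← lt_div_iff₀ hd, Nat.lt_ceil]
  have h2 : r ≤ s + (k + 1) * d ↔ ⌈(r - s) / d⌉₊ ≤ k + 1 := by
    rw [← tsub_le_iff_left, ← div_le_iff₀ hd, Nat.ceil_le]; push_cast; rfl
  rw [mem_Ioc, h1, h2]
  omega

lemma grid_le {s T : ℝ≥0} (hs : s ≤ T) {n k : ℕ} (hk : k ≤ n + 1) :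
    s + (k : ℝ≥0) * ((T - s) / (n + 1)) ≤ T := by
  have hn1 : (0 : ℝ≥0) < n + 1 := by positivity
  calc s + (k : ℝ≥0) * ((T - s) / (n + 1)) ≤ s + (n + 1) * ((T - s) / (n + 1)) := by
        gcongr; exact_mod_cast hk
    _ = T := by rw [mul_div_cancel₀ _ hn1.ne']; exact add_tsub_cancel_of_le hs

lemma grid_le' {s T : ℝ≥0} (hs : s ≤ T) {n k : ℕ} (hk : k < n + 1) :
    s + ((k : ℝ≥0) + 1) * ((T - s) / (n + 1)) ≤ T := by
  have := grid_le hs (n := n) (k := k + 1) hk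
  push_cast at this
  exact this

lemma grid_mono {s d : ℝ≥0} (k : ℕ) : s + (k : ℝ≥0) * d ≤ s + (k + 1) * d := by
  gcongr; simp

/-- The index of the grid interval that contains `r`. -/
def gridIndex (T s r : ℝ≥0) (n : ℕ) : ℕ := ⌈(r - s) / ((T - s) / (n + 1))⌉₊ - 1

lemma grid_step_pos {s r T : ℝ≥0} (hr : r ∈ Ioc s T) (n : ℕ) : 0 < (T - s) / ((n : ℝ≥0) + 1) :=
  div_pos (tsub_pos_of_lt (hr.1.trans_le hr.2)) (by positivity)

lemma mem_gridIndex {s r T : ℝ≥0} (hr : r ∈ Ioc s T) (n : ℕ) :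
    r ∈ Ioc (s + gridIndex T s r n * ((T - s) / (n + 1)))
      (s + (gridIndex T s r n + 1) * ((T - s) / (n + 1))) :=
  (mem_Ioc_grid_iff (grid_step_pos hr n) hr.1 _).2 rfl

lemma gridIndex_lt {s r T : ℝ≥0} (hr : r ∈ Ioc s T) (n : ℕ) : gridIndex T s r n < n + 1 := by
  have h := (mem_gridIndex hr n).1.trans_le hr.2
  by_contra hge
  have h1 : ((n : ℝ≥0) + 1) ≤ gridIndex T s r n := by exact_mod_cast not_lt.1 hge
  have h2 : s + ((n : ℝ≥0) + 1) * ((T - s) / (n + 1)) < T :=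
    lt_of_le_of_lt (by gcongr) h
  rw [mul_div_cancel₀ _ (by positivity), add_tsub_cancel_of_le (hr.1.le.trans hr.2)] at h2
  exact lt_irrefl _ h2

lemma tendsto_gridIndex_left {s r T : ℝ≥0} (hr : r ∈ Ioc s T) :
    Tendsto (fun n : ℕ => s + gridIndex T s r n * ((T - s) / (n + 1))) atTop (𝓝[<] r) := by
  refine tendsto_nhdsWithin_iff.2 ⟨?_, Eventually.of_forall fun n => (mem_gridIndex hr n).1⟩
  have h1 : Tendsto (fun n : ℕ => r - (T - s) / ((n : ℝ≥0) + 1)) atTop (𝓝 r) := by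
    have h2 : Tendsto (fun n : ℕ => (T - s) / ((n : ℝ≥0) + 1)) atTop (𝓝 0) := by
      simpa [div_eq_mul_inv] using tendsto_one_div_add_one_nnreal.const_mul (T - s)
    simpa using tendsto_const_nhds.sub h2
  refine tendsto_of_tendsto_of_tendsto_of_le_of_le h1 tendsto_const_nhds (fun n => ?_)
    fun n => (mem_gridIndex hr n).1.le
  refine tsub_le_iff_right.2 ((mem_gridIndex hr n).2.trans (le_of_eq ?_))
  ring

lemma tendsto_gridIndex_right {s r T : ℝ≥0} (hr : r ∈ Ioc s T) :
    Tendsto (fun n : ℕ => s + (gridIndex T s r n + 1) * ((T - s) / (n + 1))) atTop (𝓝[≥] r) := by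
  refine tendsto_nhdsWithin_iff.2 ⟨?_, Eventually.of_forall fun n => (mem_gridIndex hr n).2⟩
  have h1 : Tendsto (fun n : ℕ => r + (T - s) / ((n : ℝ≥0) + 1)) atTop (𝓝 r) := by
    have h2 : Tendsto (fun n : ℕ => (T - s) / ((n : ℝ≥0) + 1)) atTop (𝓝 0) := by
      simpa [div_eq_mul_inv] using tendsto_one_div_add_one_nnreal.const_mul (T - s)
    simpa using tendsto_const_nhds.add h2
  refine tendsto_of_tendsto_of_tendsto_of_le_of_le tendsto_const_nhds h1
    (fun n => (mem_gridIndex hr n).2) fun n => ?_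
  have := (mem_gridIndex hr n).1.le
  calc s + ((gridIndex T s r n : ℝ≥0) + 1) * ((T - s) / (n + 1))
      = s + gridIndex T s r n * ((T - s) / (n + 1)) + (T - s) / (n + 1) := by ring
    _ ≤ _ := by gcongr

variable [DiscreteTopology E]

lemma IsCadlagOn.mem_entryTimes (hf : IsCadlagOn f t T) {s r : ℝ≥0} {j : E} :
    r ∈ entryTimes f t T s j ↔
      r ∈ Ioc t T ∧ s < r ∧ Function.leftLim f r ≠ j ∧ f r = j := by
  classical
  have h : (jumpTimes f t T).Finite := hf.finite_jumps
  rw [entryTimes, dif_pos h, Finset.mem_filter, h.mem_toFinset, jumpTimes, mem_ofPred_eq]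
  constructor
  · rintro ⟨⟨h1, h2⟩, h3, rfl⟩; exact ⟨h1, h3, h2, rfl⟩
  · rintro ⟨h1, h2, h3, rfl⟩; exact ⟨⟨h1, h3⟩, h2, rfl⟩

/-- The grid never counts more entries than the path has, since each counted interval contains an
entry time. -/
lemma IsCadlagOn.gridEntries_le (hf : IsCadlagOn f t T) {s : ℝ≥0} (hts : t ≤ s) (hsT : s ≤ T)
    (j : E) (n : ℕ) : gridEntries f T s j n ≤ (entryTimes f t T s j).card := by
  classical
  have hex : ∀ k ∈ (Finset.range (n + 1)).filter fun k : ℕ =>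
      f (s + k * ((T - s) / (n + 1))) ≠ j ∧ f (s + (k + 1) * ((T - s) / (n + 1))) = j,
      ∃ r ∈ Ioc (s + k * ((T - s) / (n + 1))) (s + (k + 1) * ((T - s) / (n + 1))),
        Function.leftLim f r ≠ j ∧ f r = j := by
    intro k hk
    rw [Finset.mem_filter, Finset.mem_range] at hk
    exact hf.exists_entry (hts.trans le_self_add) (grid_mono k) (grid_le' hsT hk.1) hk.2.1 hk.2.2
  choose! r hr hr' using hex
  refine Finset.card_le_card_of_injOn r (fun k hk => ?_) fun k hk l hl hkl => ?_
  · have hk' := Finset.mem_range.1 (Finset.mem_filter.1 hk).1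
    have h1 : s < r k := le_self_add.trans_lt (hr k hk).1
    exact hf.mem_entryTimes.2
      ⟨⟨hts.trans_lt h1, (hr k hk).2.trans (grid_le' hsT hk')⟩, h1, hr' k hk⟩
  · have h1 : s < r k := le_self_add.trans_lt (hr k hk).1
    have hk' := Finset.mem_range.1 (Finset.mem_filter.1 hk).1
    have h2 : 0 < (T - s) / ((n : ℝ≥0) + 1) :=
      grid_step_pos (r := r k) ⟨h1, (hr k hk).2.trans (grid_le' hsT hk')⟩ n
    rw [(mem_Ioc_grid_iff h2 h1 k).1 (hr k hk),
      (mem_Ioc_grid_iff h2 h1 l).1 (by rw [hkl]; exact hr l hl)]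

/-- A sufficiently fine grid counts every entry: it separates the entry times, and sees the path at
its left limit and at its value there. -/
lemma IsCadlagOn.eventually_le_gridEntries (hf : IsCadlagOn f t T) (s : ℝ≥0) (j : E) :
    ∀ᶠ n in atTop, (entryTimes f t T s j).card ≤ gridEntries f T s j n := by
  classical
  have hmem : ∀ r ∈ entryTimes f t T s j, r ∈ Ioc s T := fun r hr =>
    ⟨(hf.mem_entryTimes.1 hr).2.1, (hf.mem_entryTimes.1 hr).1.2⟩
  have h1 : ∀ᶠ n in atTop, ∀ r ∈ entryTimes f t T s j,
      f (s + gridIndex T s r n * ((T - s) / (n + 1))) ≠ j ∧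
        f (s + (gridIndex T s r n + 1) * ((T - s) / (n + 1))) = j := by
    rw [Filter.eventually_all_finset]
    intro r hr
    obtain ⟨hr1, hr2, hr3, hr4⟩ := hf.mem_entryTimes.1 hr
    have hl := ((hf.tendsto_leftLim hr1).comp (tendsto_gridIndex_left (hmem r hr))).eventually
      (show {Function.leftLim f r} ∈ 𝓝 (Function.leftLim f r) by simp)
    have hR : ∀ᶠ n : ℕ in atTop,
        f (s + (gridIndex T s r n + 1) * ((T - s) / (n + 1))) = f r := by
      rcases hr1.2.eq_or_lt with rfl | hrT
      · refine Eventually.of_forall fun n => ?_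
        congr 1
        exact le_antisymm (grid_le' (hmem r hr).1.le (gridIndex_lt (hmem r hr) n))
          (mem_gridIndex (hmem r hr) n).2
      · have hc : Tendsto f (𝓝[≥] r) (𝓝 (f r)) := hf.1 r ⟨hr1.1.le, hrT⟩
        exact (hc.comp (tendsto_gridIndex_right (hmem r hr))).eventually
          (show {f r} ∈ 𝓝 (f r) by simp)
    filter_upwards [hl, hR] with n h1 h2
    exact ⟨by rw [show f _ = _ from h1]; exact hr3, by rw [h2, hr4]⟩
  have h2 : ∀ᶠ n in atTop, ∀ r ∈ entryTimes f t T s j, ∀ r' ∈ entryTimes f t T s j,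
      gridIndex T s r n = gridIndex T s r' n → r = r' := by
    rw [Filter.eventually_all_finset]
    intro r hr
    rw [Filter.eventually_all_finset]
    intro r' hr'
    by_cases hrr : r = r'
    · exact Eventually.of_forall fun _ _ => hrr
    have ht1 := (tendsto_gridIndex_left (hmem r hr)).mono_right nhdsWithin_le_nhds
    have ht2 := (tendsto_gridIndex_left (hmem r' hr')).mono_right nhdsWithin_le_nhds
    filter_upwards [(ht1.prodMk_nhds ht2).eventually
      (isClosed_diagonal.isOpen_compl.mem_nhds (show (r, r') ∈ (diagonal ℝ≥0)ᶜ from hrr))]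
      with n hn heq
    rw [heq] at hn
    exact absurd (mem_diagonal _) hn
  filter_upwards [h1, h2] with n hn1 hn2
  refine Finset.card_le_card_of_injOn (fun r => gridIndex T s r n) (fun r hr => ?_)
    fun r hr r' hr' h => hn2 r hr r' hr' h
  exact Finset.mem_filter.2 ⟨Finset.mem_range.2 (gridIndex_lt (hmem r hr) n), hn1 r hr⟩

/-- The number of entries along the grid is eventually the number of entries of the path. -/
lemma IsCadlagOn.eventually_gridEntries_eq (hf : IsCadlagOn f t T) {s : ℝ≥0} (hts : t ≤ s)
    (hsT : s ≤ T) (j : E) :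
    ∀ᶠ n in atTop, gridEntries f T s j n = (entryTimes f t T s j).card := by
  filter_upwards [hf.eventually_le_gridEntries s j] with n hn
  exact le_antisymm (hf.gridEntries_le hts hsT j n) hn

end Counting

end

section

/-! ### The compensator of the jumps of the market chain -/

variable {K : ℕ}

open Classical in
/-- The transition rates, set to zero where the data of the market are irrelevant: on the diagonal
and outside `[-L, L]`. -/
def Market.rate (M : Market K) (k j : Fin K) (a : ℝ) : ℝ :=
  if k ≠ j ∧ a ∈ Icc (-M.L) M.L then M.q k j a else 0

lemma Market.rate_nonneg (M : Market K) (k j : Fin K) (a : ℝ) : 0 ≤ M.rate k j a := by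
  classical
  rw [Market.rate]
  split_ifs with h
  · exact M.q_nonneg k j h.1 a h.2
  · exact le_rfl

lemma Market.rate_self (M : Market K) (k : Fin K) (a : ℝ) : M.rate k k a = 0 := by
  classical
  rw [Market.rate, if_neg fun h => h.1 rfl]

lemma Market.rate_eq (M : Market K) {k j : Fin K} (hkj : k ≠ j) {a : ℝ}
    (ha : a ∈ Icc (-M.L) M.L) : M.rate k j a = M.q k j a := by
  classical
  rw [Market.rate, if_pos ⟨hkj, ha⟩]

lemma Market.measurable_rate (M : Market K) (k j : Fin K) : Measurable (M.rate k j) := by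
  classical
  by_cases hkj : k = j
  · subst hkj
    have : M.rate k k = fun _ => 0 := funext fun a => M.rate_self k a
    rw [this]; exact measurable_const
  · have : M.rate k j = (Icc (-M.L) M.L).piecewise (M.q k j) fun _ => 0 := by
      ext a
      simp [Market.rate, hkj, Set.piecewise]
    rw [this]
    exact (M.q_cont k j hkj).measurable_piecewise continuousOn_const measurableSet_Icc

lemma Market.exists_rate_le (M : Market K) : ∃ C, 0 ≤ C ∧ ∀ k j a, M.rate k j a ≤ C := by
  classical
  have h : ∀ k j, ∃ C, 0 ≤ C ∧ ∀ a, M.rate k j a ≤ C := by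
    intro k j
    by_cases hkj : k = j
    · subst hkj
      exact ⟨0, le_rfl, fun a => by rw [M.rate_self]⟩
    · obtain ⟨C, hC⟩ := isCompact_Icc.exists_bound_of_continuousOn (M.q_cont k j hkj)
      refine ⟨max C 0, le_max_right _ _, fun a => ?_⟩
      rw [Market.rate]
      split_ifs with h
      · exact (le_abs_self _).trans ((hC a h.2).trans (le_max_left _ _))
      · exact le_max_right _ _
  choose C hC0 hC using h
  refine ⟨∑ k, ∑ j, C k j, Finset.sum_nonneg fun k _ => Finset.sum_nonneg fun j _ => hC0 k j,
    fun k j a => (hC k j a).trans ?_⟩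
  refine (Finset.single_le_sum (fun j _ => hC0 k j) (Finset.mem_univ j)).trans ?_
  exact Finset.single_le_sum (f := fun k => ∑ j, C k j)
    (fun k _ => Finset.sum_nonneg fun j _ => hC0 k j) (Finset.mem_univ k)

/-- The generator of the chain applied to the indicator function of the state `j`. -/
def Market.entryGen (M : Market K) (j y : Fin K) (a : ℝ) : ℝ :=
  ∑ l ∈ Finset.univ.erase y, ((if l = j then 1 else 0) - (if y = j then 1 else 0)) * M.rate y l a

lemma Market.entryGen_of_ne (M : Market K) {j y : Fin K} (hy : y ≠ j) (a : ℝ) :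
    M.entryGen j y a = M.rate y j a := by
  simp [Market.entryGen, hy, Ne.symm hy]

lemma Market.exists_abs_entryGen_le (M : Market K) : ∃ C, 0 ≤ C ∧ ∀ j y a,
    |M.entryGen j y a| ≤ C := by
  obtain ⟨C, hC0, hC⟩ := M.exists_rate_le
  refine ⟨K * C, by positivity, fun j y a => ?_⟩
  refine (Finset.abs_sum_le_sum_abs _ _).trans ?_
  have h : ∀ l ∈ Finset.univ.erase y,
      |((if l = j then 1 else 0) - (if y = j then 1 else 0)) * M.rate y l a| ≤ C := by
    intro l _
    rw [abs_mul, abs_of_nonneg (M.rate_nonneg y l a)]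
    refine (mul_le_of_le_one_left (M.rate_nonneg y l a) ?_).trans (hC y l a)
    split_ifs <;> simp
  refine (Finset.sum_le_card_nsmul _ _ _ h).trans ?_
  rw [nsmul_eq_mul]
  gcongr
  exact (Finset.card_le_univ _).trans (by simp)

section MeasurableComp

variable {α : Type*} [MeasurableSpace α]

lemma measurable_of_fin_param {g : Fin K → ℝ → ℝ} (hg : ∀ k, Measurable (g k)) {y : α → Fin K}
    (hy : Measurable y) {a : α → ℝ} (ha : Measurable a) : Measurable fun x => g (y x) (a x) := by
  have h : Measurable fun p : Fin K × ℝ => g p.1 p.2 :=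
    measurable_from_prod_countable_right hg
  exact h.comp (hy.prodMk ha)

lemma Market.measurable_rate_comp (M : Market K) (j : Fin K) {y : α → Fin K}
    (hy : Measurable y) {a : α → ℝ} (ha : Measurable a) :
    Measurable fun x => M.rate (y x) j (a x) :=
  measurable_of_fin_param (fun k => M.measurable_rate k j) hy ha

lemma Market.measurable_entryGen_comp (M : Market K) (j : Fin K) {y : α → Fin K}
    (hy : Measurable y) {a : α → ℝ} (ha : Measurable a) :
    Measurable fun x => M.entryGen j (y x) (a x) :=
  measurable_of_fin_param (g := M.entryGen j) (fun k => by
    unfold Market.entryGen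
    exact Finset.measurable_sum _ fun l _ => (M.measurable_rate k l).const_mul _) hy ha

end MeasurableComp

namespace IsControlledChain

variable {M : Market K} {Ω : Type*} {mΩ : MeasurableSpace Ω} {P : Measure Ω}
  {𝓕 : Filtration ℝ≥0 mΩ} {h : Strategy Ω} {t : ℝ≥0} {i : Fin K}
  {Y : ℝ≥0 → Ω → Fin K} {A0 : Set Ω}

lemma measurable_leftVersion (hY : IsControlledChain M P 𝓕 h t i Y)
    (hA0 : MeasurableSet[𝓕 0] A0) (hcad : ∀ ω ∈ A0, IsCadlagOn (fun s => Y s ω) t M.T) :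
    Measurable[𝓕.predictable] (leftVersion Y A0 t M.T i) :=
  measurable_predictable_leftVersion hY.adapted hA0 hcad i

/-- The left limits of the chain differ from the chain only at finitely many times. -/
lemma ae_leftVersion_eq (hcad : ∀ ω ∈ A0, IsCadlagOn (fun s => Y s ω) t M.T) {ω : Ω}
    (hω : ω ∈ A0) : ∀ᵐ r ∂leb, r ∈ Ioc t M.T → leftVersion Y A0 t M.T i (r, ω) = Y r ω := by
  have hnull : leb (jumpTimes (fun s => Y s ω) t M.T) = 0 :=
    ((hcad ω hω).finite_jumps.countable).measure_zero leb
  filter_upwards [measure_eq_zero_iff_ae_notMem.1 hnull] with r hr hmem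
  rw [leftVersion_of_mem hmem hω]
  by_contra hne
  exact hr ⟨hmem, hne⟩

lemma measurable_entryGen (hY : IsControlledChain M P 𝓕 h t i Y) (hh : IsAdmissible M P 𝓕 h)
    (hA0 : MeasurableSet[𝓕 0] A0) (hcad : ∀ ω ∈ A0, IsCadlagOn (fun s => Y s ω) t M.T)
    (j : Fin K) : Measurable fun p : ℝ≥0 × Ω =>
      M.entryGen j (leftVersion Y A0 t M.T i p) (h p.1 p.2) :=
  M.measurable_entryGen_comp j
    ((hY.measurable_leftVersion hA0 hcad).mono (predictable_le_prod 𝓕) le_rfl)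
    (hh.predictable.measurable.mono (predictable_le_prod 𝓕) le_rfl)

lemma measurable_rate (hY : IsControlledChain M P 𝓕 h t i Y) (hh : IsAdmissible M P 𝓕 h)
    (hA0 : MeasurableSet[𝓕 0] A0) (hcad : ∀ ω ∈ A0, IsCadlagOn (fun s => Y s ω) t M.T)
    (j : Fin K) : Measurable fun p : ℝ≥0 × Ω =>
      M.rate (leftVersion Y A0 t M.T i p) j (h p.1 p.2) :=
  M.measurable_rate_comp j
    ((hY.measurable_leftVersion hA0 hcad).mono (predictable_le_prod 𝓕) le_rfl)
    (hh.predictable.measurable.mono (predictable_le_prod 𝓕) le_rfl)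

/-- The martingale problem for the indicator function of the state `j`, integrated over an event
of the past. -/
lemma setIntegral_increment [IsProbabilityMeasure P] (hY : IsControlledChain M P 𝓕 h t i Y)
    (hh : IsAdmissible M P 𝓕 h) (hA0 : MeasurableSet[𝓕 0] A0) (hPA0 : ∀ᵐ ω ∂P, ω ∈ A0)
    (hcad : ∀ ω ∈ A0, IsCadlagOn (fun s => Y s ω) t M.T) (j : Fin K) {s u : ℝ≥0}
    (hts : t ≤ s) (hsu : s ≤ u) (huT : u ≤ M.T) {B : Set Ω} (hB : MeasurableSet[𝓕 s] B) :
    ∫ ω in B, ((if Y u ω = j then (1 : ℝ) else 0) - (if Y s ω = j then 1 else 0)) ∂P =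
      ∫ ω in B, ∫ r in Ioc s u,
        M.entryGen j (leftVersion Y A0 t M.T i (r, ω)) (h r ω) ∂leb ∂P := by
  obtain ⟨C, hC0, hC⟩ := M.exists_abs_entryGen_le
  set G : Ω → ℝ := fun ω => ∫ r in Ioc s u,
    M.entryGen j (leftVersion Y A0 t M.T i (r, ω)) (h r ω) ∂leb with hG
  set D : Ω → ℝ := fun ω => (if Y u ω = j then (1 : ℝ) else 0) - (if Y s ω = j then 1 else 0)
    with hD
  have hGm : StronglyMeasurable G :=
    (hY.measurable_entryGen hh hA0 hcad j).stronglyMeasurable.integral_prod_left'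
  have hGint : Integrable G P := by
    refine Integrable.of_bound hGm.aestronglyMeasurable (C * (leb.restrict (Ioc s u)).real univ)
      (Eventually.of_forall fun ω => ?_)
    exact norm_integral_le_of_norm_le_const (Eventually.of_forall fun r => hC _ _ _)
  have hYm : ∀ r, t ≤ r → r ≤ M.T → Measurable fun ω => if Y r ω = j then (1 : ℝ) else 0 :=
    fun r h1 h2 => Measurable.ite ((hY.adapted r ⟨h1, h2⟩).mono (𝓕.le r) le_rfl
      (measurableSet_singleton j)) measurable_const measurable_const
  have hDint : Integrable D P := by
    refine Integrable.of_bound ((hYm u (hts.trans hsu) huT).sub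
      (hYm s hts (hsu.trans huT))).aestronglyMeasurable 1 (Eventually.of_forall fun ω => ?_)
    simp only [hD, Real.norm_eq_abs]
    split_ifs <;> simp
  set X : Ω → ℝ := fun ω => (if Y u ω = j then (1 : ℝ) else 0) - (if Y s ω = j then 1 else 0) -
    ∫ r in Ioc s u, ∑ l ∈ Finset.univ.erase (Y r ω), ((if l = j then (1 : ℝ) else 0) -
      (if Y r ω = j then 1 else 0)) * M.q (Y r ω) l (h r ω) ∂leb with hX
  have hXD : X =ᵐ[P] fun ω => D ω - G ω := by
    filter_upwards [hPA0] with ω hω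
    simp only [hX, hD, hG]
    congr 1
    refine setIntegral_congr_ae measurableSet_Ioc ?_
    filter_upwards [ae_leftVersion_eq (i := i) hcad hω] with r hr hmem
    have hr1 : r ∈ Ioc t M.T := ⟨hts.trans_lt hmem.1, hmem.2.trans huT⟩
    rw [hr hr1, Market.entryGen]
    refine Finset.sum_congr rfl fun l hl => ?_
    rw [M.rate_eq (Finset.ne_of_mem_erase hl).symm (hh.bounded r ⟨bot_le, hr1.2⟩ ω)]
  have hXint : Integrable X P := (hDint.sub hGint).congr hXD.symm
  have hmart := hY.martingale (fun l => if l = j then (1 : ℝ) else 0) s u hts hsu huT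
  have h0 : ∫ ω in B, X ω ∂P = 0 := by
    rw [← setIntegral_condExp (𝓕.le s) hXint hB]
    refine (setIntegral_congr_ae (𝓕.le s _ hB) (g := fun _ => (0 : ℝ)) ?_).trans (by simp)
    filter_upwards [hmart] with ω hω _ using hω
  have h1 : ∫ ω in B, X ω ∂P = ∫ ω in B, D ω ∂P - ∫ ω in B, G ω ∂P := by
    rw [← integral_sub hDint.integrableOn hGint.integrableOn]
    exact integral_congr_ae (ae_restrict_of_ae hXD)
  linarith

/-- The approximate compensator of the entries into `j` along a grid: the generator applied to the
indicator function of `j`, integrated over the grid intervals at whose left end the chain is away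
from `j`. -/
def gridCompensator (M : Market K) (Y : ℝ≥0 → Ω → Fin K) (A0 : Set Ω) (h : Strategy Ω)
    (t : ℝ≥0) (i : Fin K) (s : ℝ≥0) (j : Fin K) (n : ℕ) (ω : Ω) : ℝ :=
  ∑ k ∈ Finset.range (n + 1), (if Y (s + k * ((M.T - s) / (n + 1))) ω ≠ j then (1 : ℝ) else 0) *
    ∫ r in Ioc (s + k * ((M.T - s) / (n + 1))) (s + (k + 1) * ((M.T - s) / (n + 1))),
      M.entryGen j (leftVersion Y A0 t M.T i (r, ω)) (h r ω) ∂leb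

lemma measurable_gridPoint (hY : IsControlledChain M P 𝓕 h t i Y) {s : ℝ≥0} (hts : t ≤ s)
    (hsT : s ≤ M.T) {n k : ℕ} (hk : k ≤ n + 1) :
    Measurable (Y (s + k * ((M.T - s) / (n + 1)))) :=
  (hY.adapted _ ⟨hts.trans le_self_add, grid_le hsT hk⟩).mono (𝓕.le _) le_rfl

lemma measurable_gridPoint_succ (hY : IsControlledChain M P 𝓕 h t i Y) {s : ℝ≥0} (hts : t ≤ s)
    (hsT : s ≤ M.T) {n k : ℕ} (hk : k < n + 1) :
    Measurable (Y (s + (k + 1) * ((M.T - s) / (n + 1)))) := by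
  have := hY.measurable_gridPoint hts hsT (n := n) (k := k + 1) hk
  push_cast at this
  exact this

lemma measurable_gridEntries (hY : IsControlledChain M P 𝓕 h t i Y) {s : ℝ≥0} (hts : t ≤ s)
    (hsT : s ≤ M.T) (j : Fin K) (n : ℕ) :
    Measurable fun ω => (gridEntries (fun r => Y r ω) M.T s j n : ℝ≥0∞) := by
  classical
  have h1 : (fun ω => (gridEntries (fun r => Y r ω) M.T s j n : ℝ≥0∞)) = fun ω =>
      ∑ k ∈ Finset.range (n + 1), if Y (s + k * ((M.T - s) / (n + 1))) ω ≠ j ∧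
        Y (s + (k + 1) * ((M.T - s) / (n + 1))) ω = j then (1 : ℝ≥0∞) else 0 := by
    ext ω
    rw [gridEntries, Finset.card_filter]
    push_cast
    rfl
  rw [h1]
  refine Finset.measurable_sum _ fun k hk => ?_
  have hk' := Finset.mem_range.1 hk
  exact Measurable.ite (((hY.measurable_gridPoint hts hsT hk'.le)
    (measurableSet_singleton j).compl).inter ((hY.measurable_gridPoint_succ hts hsT hk')
    (measurableSet_singleton j))) measurable_const measurable_const

lemma measurable_gridCompensator (hY : IsControlledChain M P 𝓕 h t i Y)
    (hh : IsAdmissible M P 𝓕 h) (hA0 : MeasurableSet[𝓕 0] A0)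
    (hcad : ∀ ω ∈ A0, IsCadlagOn (fun s => Y s ω) t M.T) {s : ℝ≥0} (hts : t ≤ s)
    (hsT : s ≤ M.T) (j : Fin K) (n : ℕ) :
    Measurable (gridCompensator M Y A0 h t i s j n) := by
  refine Finset.measurable_sum _ fun k hk => ?_
  have hk' := Finset.mem_range.1 hk
  refine Measurable.mul ?_ ?_
  · exact Measurable.ite ((hY.measurable_gridPoint hts hsT hk'.le)
      (measurableSet_singleton j).compl) measurable_const measurable_const
  · exact (hY.measurable_entryGen hh hA0
      hcad j).stronglyMeasurable.integral_prod_left'.measurable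

/-- The expected number of entries along a grid. An interval is counted exactly when the indicator
function of `j` increases over it, given that the chain is away from `j` at its left end. -/
lemma setLIntegral_gridEntries [IsProbabilityMeasure P] (hY : IsControlledChain M P 𝓕 h t i Y)
    (hh : IsAdmissible M P 𝓕 h) (hA0 : MeasurableSet[𝓕 0] A0) (hPA0 : ∀ᵐ ω ∂P, ω ∈ A0)
    (hcad : ∀ ω ∈ A0, IsCadlagOn (fun s => Y s ω) t M.T) {s : ℝ≥0} (hts : t ≤ s)
    (hsT : s ≤ M.T) (j : Fin K) (n : ℕ) {A : Set Ω} (hA : MeasurableSet[𝓕 s] A) :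
    ∫⁻ ω in A, (gridEntries (fun r => Y r ω) M.T s j n : ℝ≥0∞) ∂P =
      ENNReal.ofReal (∫ ω in A, gridCompensator M Y A0 h t i s j n ω ∂P) := by
  classical
  obtain ⟨C, hC0, hC⟩ := M.exists_abs_entryGen_le
  have hA' : MeasurableSet A := 𝓕.le s _ hA
  set a : ℕ → ℝ≥0 := fun k => s + k * ((M.T - s) / (n + 1)) with ha
  set b : ℕ → ℝ≥0 := fun k => s + (k + 1) * ((M.T - s) / (n + 1)) with hb
  set e : ℕ → Ω → ℝ := fun k ω => if Y (a k) ω ≠ j ∧ Y (b k) ω = j then (1 : ℝ) else 0 with he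
  have hem : ∀ k < n + 1, Measurable (e k) := fun k hk =>
    Measurable.ite (((hY.measurable_gridPoint hts hsT hk.le)
      (measurableSet_singleton j).compl).inter ((hY.measurable_gridPoint_succ hts hsT hk)
      (measurableSet_singleton j))) measurable_const measurable_const
  have heint : ∀ k < n + 1, Integrable (e k) P := fun k hk => by
    refine Integrable.of_bound (hem k hk).aestronglyMeasurable 1 (Eventually.of_forall fun ω => ?_)
    simp only [he]
    split_ifs <;> simp
  have hcard : ∀ ω, (gridEntries (fun r => Y r ω) M.T s j n : ℝ) =
      ∑ k ∈ Finset.range (n + 1), e k ω := by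
    intro ω
    rw [gridEntries, Finset.card_filter]
    push_cast
    rfl
  have hreal : ∫ ω in A, (gridEntries (fun r => Y r ω) M.T s j n : ℝ) ∂P =
      ∫ ω in A, gridCompensator M Y A0 h t i s j n ω ∂P := by
    simp_rw [hcard, gridCompensator]
    rw [integral_finsetSum _ fun k hk => (heint k (Finset.mem_range.1 hk)).integrableOn,
      integral_finsetSum]
    · refine Finset.sum_congr rfl fun k hk => ?_
      have hk' := Finset.mem_range.1 hk
      set B : Set Ω := A ∩ {ω | Y (a k) ω ≠ j} with hB
      have hBm : MeasurableSet[𝓕 (a k)] B :=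
        (𝓕.mono le_self_add _ hA).inter ((hY.adapted (a k) ⟨hts.trans le_self_add,
          grid_le hsT hk'.le⟩) (measurableSet_singleton j).compl)
      have hset : MeasurableSet {ω | Y (a k) ω ≠ j} :=
        (hY.measurable_gridPoint hts hsT hk'.le) (measurableSet_singleton j).compl
      have hincr := hY.setIntegral_increment hh hA0 hPA0 hcad j (s := a k) (u := b k)
        (hts.trans le_self_add) (grid_mono k) (grid_le' hsT hk') hBm
      have h1 : ∫ ω in A, e k ω ∂P = ∫ ω in B, ((if Y (b k) ω = j then (1 : ℝ) else 0) -
          (if Y (a k) ω = j then 1 else 0)) ∂P := by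
        rw [hB, ← setIntegral_indicator hset]
        refine setIntegral_congr_fun hA' fun ω _ => ?_
        by_cases hne : Y (a k) ω = j
        · simp [he, hne]
        · simp [he, hne]
      rw [h1, hincr, hB, ← setIntegral_indicator hset]
      refine setIntegral_congr_fun hA' fun ω _ => ?_
      rw [Set.indicator_apply]
      change (if Y (a k) ω ≠ j then _ else _) = (if Y (a k) ω ≠ j then 1 else 0) * _
      split_ifs <;> simp [ha, hb]
    · intro k hk
      have hk' := Finset.mem_range.1 hk
      refine Integrable.integrableOn (Integrable.of_bound
        (C := 1 * (C * (leb.restrict (Ioc (a k) (b k))).real univ)) ?_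
        (Eventually.of_forall fun ω => ?_))
      · refine (Measurable.mul ?_ ?_).aestronglyMeasurable
        · exact Measurable.ite ((hY.measurable_gridPoint hts hsT hk'.le)
            (measurableSet_singleton j).compl) measurable_const measurable_const
        · exact (hY.measurable_entryGen hh hA0
            hcad j).stronglyMeasurable.integral_prod_left'.measurable
      · rw [norm_mul]
        refine mul_le_mul ?_ ?_ (norm_nonneg _) zero_le_one
        · split_ifs <;> simp
        · exact norm_integral_le_of_norm_le_const (Eventually.of_forall fun r => hC _ _ _)
  rw [← hreal, ofReal_integral_eq_lintegral_ofReal]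
  · refine lintegral_congr fun ω => ?_
    rw [ENNReal.ofReal_natCast]
  · simp_rw [hcard]
    exact (integrable_finsetSum _ fun k hk => heint k (Finset.mem_range.1 hk)).integrableOn
  · exact Eventually.of_forall fun ω => Nat.cast_nonneg _

end IsControlledChain

end

section

variable {K : ℕ}

namespace IsControlledChain

variable {M : Market K} {Ω : Type*} {mΩ : MeasurableSpace Ω} {P : Measure Ω}
  {𝓕 : Filtration ℝ≥0 mΩ} {h : Strategy Ω} {t : ℝ≥0} {i : Fin K}
  {Y : ℝ≥0 → Ω → Fin K} {A0 : Set Ω}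

lemma measurable_entryGen_section (hY : IsControlledChain M P 𝓕 h t i Y)
    (hh : IsAdmissible M P 𝓕 h) (hA0 : MeasurableSet[𝓕 0] A0)
    (hcad : ∀ ω ∈ A0, IsCadlagOn (fun s => Y s ω) t M.T) (j : Fin K) (ω : Ω) :
    Measurable fun r : ℝ≥0 => M.entryGen j (leftVersion Y A0 t M.T i (r, ω)) (h r ω) :=
  (hY.measurable_entryGen hh hA0 hcad j).comp (measurable_id.prodMk measurable_const)

/-- The approximate compensator as a single integral over `(s, T]`, in which the chain is evaluated
at the grid point preceding the current time. -/
lemma gridCompensator_eq_integral (hY : IsControlledChain M P 𝓕 h t i Y)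
    (hh : IsAdmissible M P 𝓕 h) (hA0 : MeasurableSet[𝓕 0] A0)
    (hcad : ∀ ω ∈ A0, IsCadlagOn (fun s => Y s ω) t M.T) {s : ℝ≥0} (hsT : s < M.T) (j : Fin K)
    (n : ℕ) (ω : Ω) :
    gridCompensator M Y A0 h t i s j n ω = ∫ r in Ioc s M.T,
      (if Y (s + gridIndex M.T s r n * ((M.T - s) / (n + 1))) ω ≠ j then (1 : ℝ) else 0) *
        M.entryGen j (leftVersion Y A0 t M.T i (r, ω)) (h r ω) ∂leb := by
  obtain ⟨C, hC0, hC⟩ := M.exists_abs_entryGen_le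
  set d : ℝ≥0 := (M.T - s) / (n + 1) with hd
  have hdpos : 0 < d := grid_step_pos (r := M.T) ⟨hsT, le_rfl⟩ n
  have hunion : Ioc s M.T = ⋃ k ∈ Finset.range (n + 1),
      Ioc (s + (k : ℝ≥0) * d) (s + ((k : ℝ≥0) + 1) * d) := by
    ext r
    simp only [mem_iUnion, Finset.mem_range, exists_prop]
    refine ⟨fun hr => ⟨_, gridIndex_lt hr n, mem_gridIndex hr n⟩, ?_⟩
    rintro ⟨k, hk, hr⟩
    exact ⟨lt_of_le_of_lt le_self_add hr.1, hr.2.trans (grid_le' hsT.le hk)⟩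
  have hindex : ∀ (k : ℕ), ∀ r ∈ Ioc (s + (k : ℝ≥0) * d) (s + ((k : ℝ≥0) + 1) * d),
      gridIndex M.T s r n = k := fun k r hr =>
    ((mem_Ioc_grid_iff hdpos (lt_of_le_of_lt le_self_add hr.1) k).1 hr).symm
  have hmeas := hY.measurable_entryGen_section hh hA0 hcad j ω
  rw [hunion, integral_biUnion_finset]
  · refine Finset.sum_congr rfl fun k _ => ?_
    rw [← integral_const_mul]
    refine setIntegral_congr_fun measurableSet_Ioc fun r hr => ?_
    simp only [hindex k r hr]
    rfl
  · exact fun k _ => measurableSet_Ioc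
  · intro k _ l _ hkl
    refine Set.disjoint_left.2 fun r hr hr' => hkl ?_
    rw [← hindex k r hr, hindex l r hr']
  · intro k _
    have hint : IntegrableOn (fun r : ℝ≥0 =>
        (if Y (s + (k : ℝ≥0) * d) ω ≠ j then (1 : ℝ) else 0) *
          M.entryGen j (leftVersion Y A0 t M.T i (r, ω)) (h r ω))
        (Ioc (s + (k : ℝ≥0) * d) (s + ((k : ℝ≥0) + 1) * d)) leb :=
      (Integrable.of_bound hmeas.aestronglyMeasurable C
        (Eventually.of_forall fun r => hC _ _ _)).const_mul _
    refine hint.congr_fun (fun r hr => ?_) measurableSet_Ioc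
    simp only [hindex k r hr]

/-- Along finer and finer grids, the approximate compensators converge to the integrated
intensity of the entries into `j`. -/
lemma tendsto_gridCompensator (hY : IsControlledChain M P 𝓕 h t i Y)
    (hh : IsAdmissible M P 𝓕 h) (hA0 : MeasurableSet[𝓕 0] A0)
    (hcad : ∀ ω ∈ A0, IsCadlagOn (fun s => Y s ω) t M.T) {s : ℝ≥0} (hts : t ≤ s)
    (hsT : s < M.T) (j : Fin K) {ω : Ω} (hω : ω ∈ A0) :
    Tendsto (fun n => gridCompensator M Y A0 h t i s j n ω) atTop
      (𝓝 (∫ r in Ioc s M.T, M.rate (leftVersion Y A0 t M.T i (r, ω)) j (h r ω) ∂leb)) := by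
  obtain ⟨C, hC0, hC⟩ := M.exists_abs_entryGen_le
  simp_rw [hY.gridCompensator_eq_integral hh hA0 hcad hsT j]
  refine tendsto_integral_of_dominated_convergence (fun _ => C) (fun n => ?_)
    (integrable_const C) (fun n => Eventually.of_forall fun r => ?_) ?_
  · refine Measurable.aestronglyMeasurable (Measurable.mul ?_
      (hY.measurable_entryGen_section hh hA0 hcad j ω))
    have h1 : Measurable fun r : ℝ≥0 => gridIndex M.T s r n :=
      ((measurable_from_top (f := fun k : ℕ => k - 1)).comp (Nat.measurable_ceil.comp
        ((measurable_id.sub measurable_const).div_const _)))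
    exact (measurable_from_top (f := fun k : ℕ =>
      if Y (s + k * ((M.T - s) / (n + 1))) ω ≠ j then (1 : ℝ) else 0)).comp h1
  · rw [norm_mul]
    refine (mul_le_of_le_one_left (norm_nonneg _) ?_).trans (hC j _ _)
    split_ifs <;> simp
  · refine (ae_restrict_iff' measurableSet_Ioc).2 (Eventually.of_forall fun r hr => ?_)
    have hr' : r ∈ Ioc t M.T := ⟨hts.trans_lt hr.1, hr.2⟩
    have hl := (((hcad ω hω).tendsto_leftLim hr').comp (tendsto_gridIndex_left hr)).eventually
      (show {Function.leftLim (fun s => Y s ω) r} ∈ 𝓝 (Function.leftLim (fun s => Y s ω) r)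
        by simp)
    rw [leftVersion_of_mem hr' hω]
    refine tendsto_const_nhds.congr' ?_
    filter_upwards [hl] with n hn
    have hn' : Y (s + gridIndex M.T s r n * ((M.T - s) / (n + 1))) ω =
      Function.leftLim (fun s => Y s ω) r := hn
    rw [hn']
    by_cases hj : Function.leftLim (fun s => Y s ω) r = j
    · simp [hj, M.rate_self]
    · simp [hj, M.entryGen_of_ne hj]

lemma exists_norm_gridCompensator_le (hY : IsControlledChain M P 𝓕 h t i Y)
    (hh : IsAdmissible M P 𝓕 h) (hA0 : MeasurableSet[𝓕 0] A0)
    (hcad : ∀ ω ∈ A0, IsCadlagOn (fun s => Y s ω) t M.T) {s : ℝ≥0} (hsT : s < M.T) (j : Fin K) :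
    ∃ C, ∀ n ω, ‖gridCompensator M Y A0 h t i s j n ω‖ ≤ C := by
  obtain ⟨C, hC0, hC⟩ := M.exists_abs_entryGen_le
  refine ⟨C * (leb.restrict (Ioc s M.T)).real univ, fun n ω => ?_⟩
  rw [hY.gridCompensator_eq_integral hh hA0 hcad hsT j]
  refine norm_integral_le_of_norm_le_const (Eventually.of_forall fun r => ?_)
  rw [norm_mul]
  refine (mul_le_of_le_one_left (norm_nonneg _) ?_).trans (hC j _ _)
  split_ifs <;> simp

/-- The expected number of entries into the state `j` is the expected integrated intensity, over
every event of the past. -/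
lemma setLIntegral_entryTimes [IsProbabilityMeasure P] (hY : IsControlledChain M P 𝓕 h t i Y)
    (hh : IsAdmissible M P 𝓕 h) (hA0 : MeasurableSet[𝓕 0] A0) (hPA0 : ∀ᵐ ω ∂P, ω ∈ A0)
    (hcad : ∀ ω ∈ A0, IsCadlagOn (fun s => Y s ω) t M.T) {s : ℝ≥0} (hts : t ≤ s)
    (hsT : s ≤ M.T) (j : Fin K) {A : Set Ω} (hA : MeasurableSet[𝓕 s] A) :
    ∫⁻ ω in A, ((entryTimes (fun r => Y r ω) t M.T s j).card : ℝ≥0∞) ∂P =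
      ∫⁻ ω in A, ∫⁻ r in Ioc s M.T,
        ENNReal.ofReal (M.rate (leftVersion Y A0 t M.T i (r, ω)) j (h r ω)) ∂leb ∂P := by
  obtain ⟨C, hC0, hC⟩ := M.exists_rate_le
  have hrate := hY.measurable_rate hh hA0 hcad j
  rcases hsT.eq_or_lt with rfl | hlt
  · have h0 : ∀ᵐ ω ∂P, (((entryTimes (fun r => Y r ω) t M.T M.T j).card : ℕ) : ℝ≥0∞) = 0 := by
      filter_upwards [hPA0] with ω hω
      have : entryTimes (fun r => Y r ω) t M.T M.T j = ∅ := Finset.eq_empty_of_forall_notMem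
        fun r hr => by
          have := (hcad ω hω).mem_entryTimes.1 hr
          exact absurd this.1.2 (not_le.2 this.2.1)
      simp [this]
    rw [lintegral_congr_ae (ae_restrict_of_ae h0)]
    simp
  -- the grid counts are eventually equal to the number of entries
  have hlim : ∀ᵐ ω ∂P, Tendsto
      (fun n => (gridEntries (fun r => Y r ω) M.T s j n : ℝ≥0∞)) atTop
      (𝓝 ((entryTimes (fun r => Y r ω) t M.T s j).card : ℝ≥0∞)) := by
    filter_upwards [hPA0] with ω hω
    refine tendsto_const_nhds.congr' ?_
    filter_upwards [(hcad ω hω).eventually_gridEntries_eq hts hsT j] with n hn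
    rw [hn]
  have hint : ∀ ω, ENNReal.ofReal
      (∫ r in Ioc s M.T, M.rate (leftVersion Y A0 t M.T i (r, ω)) j (h r ω) ∂leb) =
      ∫⁻ r in Ioc s M.T,
        ENNReal.ofReal (M.rate (leftVersion Y A0 t M.T i (r, ω)) j (h r ω)) ∂leb := by
    intro ω
    refine ofReal_integral_eq_lintegral_ofReal (Integrable.of_bound (hrate.comp
      (measurable_id.prodMk measurable_const)).aestronglyMeasurable C
      (Eventually.of_forall fun r => ?_)) (Eventually.of_forall fun r => M.rate_nonneg _ _ _)
    rw [Real.norm_of_nonneg (M.rate_nonneg _ _ _)]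
    exact hC _ _ _
  have hval : Tendsto (fun n => ∫⁻ ω in A, (gridEntries (fun r => Y r ω) M.T s j n : ℝ≥0∞) ∂P)
      atTop (𝓝 (∫⁻ ω in A, ∫⁻ r in Ioc s M.T,
        ENNReal.ofReal (M.rate (leftVersion Y A0 t M.T i (r, ω)) j (h r ω)) ∂leb ∂P)) := by
    simp_rw [hY.setLIntegral_gridEntries hh hA0 hPA0 hcad hts hsT j _ hA, ← hint]
    obtain ⟨C', hC'⟩ := hY.exists_norm_gridCompensator_le hh hA0 hcad hlt j
    rw [← ofReal_integral_eq_lintegral_ofReal]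
    · refine (ENNReal.continuous_ofReal.tendsto _).comp ?_
      refine tendsto_integral_of_dominated_convergence (fun _ => C') (fun n => ?_)
        (integrable_const C') (fun n => Eventually.of_forall fun ω => hC' n ω) ?_
      · exact (hY.measurable_gridCompensator hh hA0 hcad hts hsT j n).aestronglyMeasurable
      · filter_upwards [ae_restrict_of_ae hPA0] with ω hω
        exact hY.tendsto_gridCompensator hh hA0 hcad hts hlt j hω
    · refine Integrable.of_bound
        hrate.stronglyMeasurable.integral_prod_left'.aestronglyMeasurable
        (C * (leb.restrict (Ioc s M.T)).real univ) (Eventually.of_forall fun ω => ?_)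
      refine norm_integral_le_of_norm_le_const (Eventually.of_forall fun r => ?_)
      rw [Real.norm_of_nonneg (M.rate_nonneg _ _ _)]
      exact hC _ _ _
    · exact Eventually.of_forall fun ω => integral_nonneg fun r => M.rate_nonneg _ _ _
  -- the upper bound is Fatou's lemma; the lower bound holds because the grid never overcounts
  refine le_antisymm ?_ (le_of_tendsto hval (Eventually.of_forall fun n => ?_))
  · calc ∫⁻ ω in A, ((entryTimes (fun r => Y r ω) t M.T s j).card : ℝ≥0∞) ∂P
        = ∫⁻ ω in A, liminf
            (fun n => (gridEntries (fun r => Y r ω) M.T s j n : ℝ≥0∞)) atTop ∂P := by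
          refine lintegral_congr_ae (ae_restrict_of_ae ?_)
          filter_upwards [hlim] with ω hω using hω.liminf_eq.symm
      _ ≤ liminf (fun n => ∫⁻ ω in A,
            (gridEntries (fun r => Y r ω) M.T s j n : ℝ≥0∞) ∂P) atTop :=
          lintegral_liminf_le fun n => hY.measurable_gridEntries hts hsT j n
      _ = _ := hval.liminf_eq
  · refine lintegral_mono_ae (ae_restrict_of_ae ?_)
    filter_upwards [hPA0] with ω hω
    exact_mod_cast (hcad ω hω).gridEntries_le hts hsT j n

end IsControlledChain

end

section

variable {K : ℕ}

namespace IsControlledChain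

variable {M : Market K} {Ω : Type*} {mΩ : MeasurableSpace Ω} {P : Measure Ω}
  {𝓕 : Filtration ℝ≥0 mΩ} {h : Strategy Ω} {t : ℝ≥0} {i : Fin K}
  {Y : ℝ≥0 → Ω → Fin K} {A0 : Set Ω}

lemma measurable_card_entryTimes (hY : IsControlledChain M P 𝓕 h t i Y)
    (hA0 : MeasurableSet[𝓕 0] A0) (hcad : ∀ ω ∈ A0, IsCadlagOn (fun s => Y s ω) t M.T)
    {s : ℝ≥0} (hts : t ≤ s) (hsT : s ≤ M.T) (j : Fin K) :
    Measurable (A0.indicator fun ω =>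
      ((entryTimes (fun r => Y r ω) t M.T s j).card : ℝ≥0∞)) := by
  refine measurable_of_tendsto_metrizable (f := fun n => A0.indicator fun ω =>
    (gridEntries (fun r => Y r ω) M.T s j n : ℝ≥0∞))
    (fun n => (hY.measurable_gridEntries hts hsT j n).indicator (𝓕.le _ _ hA0)) ?_
  rw [tendsto_pi_nhds]
  intro ω
  by_cases hω : ω ∈ A0
  · simp only [indicator_of_mem hω]
    refine tendsto_const_nhds.congr' ?_
    filter_upwards [(hcad ω hω).eventually_gridEntries_eq hts hsT j] with n hn
    rw [hn]
  · simp only [indicator_of_notMem hω]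
    exact tendsto_const_nhds

open Classical in
/-- The counting measure of the times in `(t, T]` at which the chain enters the state `j`, on the
event `A0` of good paths. -/
def entryMeasure (M : Market K) (Y : ℝ≥0 → Ω → Fin K) (A0 : Set Ω) (t : ℝ≥0) (j : Fin K)
    (ω : Ω) : Measure ℝ≥0 :=
  if ω ∈ A0 then ∑ r ∈ entryTimes (fun r => Y r ω) t M.T t j, Measure.dirac r else 0

lemma entryMeasure_apply_Ioi (hcad : ∀ ω ∈ A0, IsCadlagOn (fun s => Y s ω) t M.T) (j : Fin K)
    (s : ℝ≥0) (ω : Ω) : entryMeasure M Y A0 t j ω (Ioi s) =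
      A0.indicator (fun ω => ((entryTimes (fun r => Y r ω) t M.T (max s t) j).card : ℝ≥0∞)) ω := by
  classical
  by_cases hω : ω ∈ A0
  · rw [entryMeasure, if_pos hω, indicator_of_mem hω, Measure.finsetSum_apply]
    have hset : entryTimes (fun r => Y r ω) t M.T (max s t) j =
        (entryTimes (fun r => Y r ω) t M.T t j).filter fun r => s < r := by
      ext r
      rw [Finset.mem_filter, (hcad ω hω).mem_entryTimes, (hcad ω hω).mem_entryTimes, max_lt_iff]
      tauto
    rw [hset, Finset.card_filter]
    push_cast
    refine Finset.sum_congr rfl fun r _ => ?_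
    rw [Measure.dirac_apply' _ measurableSet_Ioi]
    rfl
  · rw [entryMeasure, if_neg hω, indicator_of_notMem hω]
    rfl

instance (j : Fin K) (ω : Ω) : IsFiniteMeasure (entryMeasure M Y A0 t j ω) := by
  rw [entryMeasure]
  split_ifs <;> infer_instance

lemma measurable_entryMeasure (hY : IsControlledChain M P 𝓕 h t i Y)
    (hA0 : MeasurableSet[𝓕 0] A0) (hcad : ∀ ω ∈ A0, IsCadlagOn (fun s => Y s ω) t M.T)
    (htT : t ≤ M.T) (j : Fin K) : Measurable (entryMeasure M Y A0 t j) := by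
  have hs : ∀ s : ℝ≥0, Measurable fun ω => entryMeasure M Y A0 t j ω (Ioi s) := by
    intro s
    simp_rw [entryMeasure_apply_Ioi hcad]
    rcases le_or_gt s M.T with hsT | hsT
    · exact hY.measurable_card_entryTimes hA0 hcad (le_max_right _ _) (max_le hsT htT) j
    · have : (fun ω => A0.indicator (fun ω =>
          ((entryTimes (fun r => Y r ω) t M.T (max s t) j).card : ℝ≥0∞)) ω) = fun _ => 0 := by
        ext ω
        by_cases hω : ω ∈ A0
        · rw [indicator_of_mem hω, Finset.eq_empty_of_forall_notMem
            (s := entryTimes (fun r => Y r ω) t M.T (max s t) j) fun r hr => ?_]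
          · simp
          · have := (hcad ω hω).mem_entryTimes.1 hr
            exact absurd this.1.2 (not_le.2 (hsT.trans ((le_max_left _ _).trans_lt this.2.1)))
        · exact indicator_of_notMem hω _
      rw [this]
      exact measurable_const
  refine Measurable.measure_of_isPiSystem (S := range Ioi)
    ((BorelSpace.measurable_eq (α := ℝ≥0)).trans (borel_eq_generateFrom_Ioi ℝ≥0))
    isPiSystem_Ioi ?_ ?_
  · rintro _ ⟨s, rfl⟩
    exact hs s
  · -- the time `0` is no jump time
    have : (fun ω => entryMeasure M Y A0 t j ω univ) =
        fun ω => entryMeasure M Y A0 t j ω (Ioi 0) := by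
      classical
      ext ω
      by_cases hω : ω ∈ A0
      · simp only [entryMeasure, if_pos hω, Measure.finsetSum_apply]
        refine Finset.sum_congr rfl fun r hr => ?_
        have h0 : r ∈ Ioi (0 : ℝ≥0) :=
          (zero_le (a := t)).trans_lt ((hcad ω hω).mem_entryTimes.1 hr).1.1
        rw [Measure.dirac_apply_of_mem h0, Measure.dirac_apply_of_mem (mem_univ r)]
      · simp [entryMeasure, hω]
    rw [this]
    exact hs 0

lemma integral_entryMeasure {ω : Ω} (hω : ω ∈ A0) (j : Fin K) (f : ℝ≥0 → ℝ) :
    ∫ r, f r ∂(entryMeasure M Y A0 t j ω) =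
      ∑ r ∈ entryTimes (fun r => Y r ω) t M.T t j, f r := by
  rw [entryMeasure, if_pos hω, integral_finsetSum_measure]
  · simp
  · exact fun r _ => integrable_dirac (by simp)

/-- Compensation formula for the jumps of the chain into the state `j`: the entries and their
intensity are regarded as random measures on `(t, T]` with a trivial mark. -/
theorem integral_sum_entryTimes [IsProbabilityMeasure P] (hY : IsControlledChain M P 𝓕 h t i Y)
    (hh : IsAdmissible M P 𝓕 h) (hA0 : MeasurableSet[𝓕 0] A0) (hPA0 : ∀ᵐ ω ∂P, ω ∈ A0)
    (hcad : ∀ ω ∈ A0, IsCadlagOn (fun s => Y s ω) t M.T) (htT : t ≤ M.T) (j : Fin K)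
    {H : ℝ≥0 × Ω → ℝ} (hH : Measurable[𝓕.predictable] H)
    (hint : ∫⁻ ω, ∫⁻ r in Ioc t M.T, ‖H (r, ω)‖ₑ * ENNReal.ofReal
      (M.rate (leftVersion Y A0 t M.T i (r, ω)) j (h r ω)) ∂leb ∂P < ⊤) :
    Integrable (fun ω => ∑ r ∈ entryTimes (fun r => Y r ω) t M.T t j, H (r, ω)) P ∧
    Integrable (fun ω => ∫ r in Ioc t M.T,
      H (r, ω) * M.rate (leftVersion Y A0 t M.T i (r, ω)) j (h r ω) ∂leb) P ∧
    ∫ ω, ∑ r ∈ entryTimes (fun r => Y r ω) t M.T t j, H (r, ω) ∂P =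
      ∫ ω, ∫ r in Ioc t M.T,
        H (r, ω) * M.rate (leftVersion Y A0 t M.T i (r, ω)) j (h r ω) ∂leb ∂P ∧
    ∀ᵐ ω ∂P, IntegrableOn (fun r =>
      H (r, ω) * M.rate (leftVersion Y A0 t M.T i (r, ω)) j (h r ω)) (Ioc t M.T) leb := by
  obtain ⟨C, hC0, hC⟩ := M.exists_rate_le
  have hrate := hY.measurable_rate hh hA0 hcad j
  have hpair : Measurable fun r : ℝ≥0 => (r, ()) := measurable_id.prodMk measurable_const
  set κ₀ : Kernel Ω ℝ≥0 := ⟨entryMeasure M Y A0 t j, hY.measurable_entryMeasure hA0 hcad htT j⟩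
    with hκ₀
  have hκ₀f : IsSFiniteKernel κ₀ :=
    isSFiniteKernel_of_forall_lt_top _ fun ω => measure_lt_top (entryMeasure M Y A0 t j ω) _
  set g : Ω → ℝ≥0 → ℝ≥0∞ := fun ω r =>
    ENNReal.ofReal (M.rate (leftVersion Y A0 t M.T i (r, ω)) j (h r ω)) with hg
  have hgm : Measurable (Function.uncurry g) :=
    (hrate.comp measurable_swap).ennreal_ofReal
  have hgωm : ∀ ω, Measurable (g ω) := fun ω => hgm.comp (measurable_const.prodMk measurable_id)
  set ν₀ : Kernel Ω ℝ≥0 := Kernel.withDensity (Kernel.const Ω (leb.restrict (Ioc t M.T))) g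
    with hν₀
  have hν₀a : ∀ ω, ν₀ ω = (leb.restrict (Ioc t M.T)).withDensity (g ω) := fun ω => by
    rw [hν₀, Kernel.withDensity_apply _ hgm, Kernel.const_apply]
  have hν₀f : IsSFiniteKernel ν₀ :=
    Kernel.IsSFiniteKernel.withDensity _ fun _ _ => ENNReal.ofReal_ne_top
  set κ := κ₀.map fun r => (r, ()) with hκ
  set ν := ν₀.map fun r => (r, ()) with hν
  have hκa : ∀ ω (B : Set ℝ≥0), MeasurableSet B → ∀ D : Set Unit, MeasurableSet D →
      κ ω (B ×ˢ D) = entryMeasure M Y A0 t j ω ({r | r ∈ B ∧ () ∈ D}) := by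
    intro ω B hB D hD
    rw [hκ, Kernel.map_apply' _ hpair _ (hB.prod hD)]
    rfl
  have hνa : ∀ ω (B : Set ℝ≥0), MeasurableSet B → ∀ D : Set Unit, MeasurableSet D →
      ν ω (B ×ˢ D) = ν₀ ω ({r | r ∈ B ∧ () ∈ D}) := by
    intro ω B hB D hD
    rw [hν, Kernel.map_apply' _ hpair _ (hB.prod hD)]
    rfl
  have hmap := map_reorder_eq P 𝓕 t M.T κ ν (fun ω => ?_) (fun ω => ?_) ?_ ?_
  · have hH' : Measurable[𝓕.predictable.prod ⊤]
        fun p : (ℝ≥0 × Ω) × Unit => H p.1 := by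
      let m𝓟 : MeasurableSpace (ℝ≥0 × Ω) := 𝓕.predictable
      exact hH.comp measurable_fst
    have hHr : ∀ ω, Measurable fun p : ℝ≥0 × Unit => H (p.1, ω) := fun ω =>
      (hH.mono (predictable_le_prod 𝓕) le_rfl).comp (measurable_fst.prodMk measurable_const)
    have hνint : ∀ ω (f : ℝ≥0 × Unit → ℝ), Measurable f → ∫ p, f p ∂(ν ω) =
        ∫ r in Ioc t M.T, f (r, ()) *
          M.rate (leftVersion Y A0 t M.T i (r, ω)) j (h r ω) ∂leb := by
      intro ω f hf
      rw [hν, Kernel.map_apply _ hpair, integral_map hpair.aemeasurable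
        hf.aestronglyMeasurable, hν₀a, integral_withDensity_eq_integral_toReal_smul (hgωm ω)
        (Eventually.of_forall fun r => ENNReal.ofReal_lt_top)]
      refine integral_congr_ae (Eventually.of_forall fun r => ?_)
      simp only [hg, ENNReal.toReal_ofReal (M.rate_nonneg _ _ _), smul_eq_mul]
      ring
    have hκint : ∀ ω ∈ A0, ∀ (f : ℝ≥0 × Unit → ℝ), Measurable f → ∫ p, f p ∂(κ ω) =
        ∑ r ∈ entryTimes (fun r => Y r ω) t M.T t j, f (r, ()) := by
      intro ω hω f hf
      rw [hκ, Kernel.map_apply _ hpair, integral_map hpair.aemeasurable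
        hf.aestronglyMeasurable]
      exact integral_entryMeasure hω j fun r => f (r, ())
    obtain ⟨h1, h2, h3, h4⟩ := integral_eq_of_map_reorder_eq hmap hH' (by
      refine lt_of_le_of_lt (le_of_eq (lintegral_congr fun ω => ?_)) hint
      change ∫⁻ p : ℝ≥0 × Unit, ‖H (p.1, ω)‖ₑ ∂(ν ω) = _
      rw [hν, Kernel.map_apply _ hpair, lintegral_map (hHr ω).enorm hpair, hν₀a]
      change ∫⁻ r, ‖H (r, ω)‖ₑ ∂_ = _
      rw [lintegral_withDensity_eq_lintegral_mul _ (hgωm ω)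
        (g := fun r => ‖H (r, ω)‖ₑ) ((hHr ω).enorm.comp hpair)]
      refine lintegral_congr fun r => ?_
      simp only [Pi.mul_apply]
      rw [mul_comm])
    have hκe : (fun ω => ∫ p, H (reorder (ω, p)).1 ∂(κ ω)) =ᵐ[P]
        fun ω => ∑ r ∈ entryTimes (fun r => Y r ω) t M.T t j, H (r, ω) := by
      filter_upwards [hPA0] with ω hω
      exact hκint ω hω (fun p => H (p.1, ω)) (hHr ω)
    have hνe : (fun ω => ∫ p, H (reorder (ω, p)).1 ∂(ν ω)) = fun ω => ∫ r in Ioc t M.T,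
        H (r, ω) * M.rate (leftVersion Y A0 t M.T i (r, ω)) j (h r ω) ∂leb :=
      funext fun ω => hνint ω (fun p => H (p.1, ω)) (hHr ω)
    refine ⟨h1.congr hκe, hνe ▸ h2, ?_, ?_⟩
    · rw [← integral_congr_ae hκe, h3, ← hνe]
    · filter_upwards [h4] with ω hω
      change Integrable (fun p : ℝ≥0 × Unit => H (p.1, ω)) (ν ω) at hω
      rw [hν, Kernel.map_apply _ hpair, integrable_map_measure
        (hHr ω).aestronglyMeasurable hpair.aemeasurable, hν₀a,
        integrable_withDensity_iff (hgωm ω)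
          (Eventually.of_forall fun r => ENNReal.ofReal_lt_top)] at hω
      refine hω.congr (Eventually.of_forall fun r => ?_)
      simp only [hg, ENNReal.toReal_ofReal (M.rate_nonneg _ _ _)]
      rfl
  · rw [hκa ω _ measurableSet_Ioc.compl _ .univ, entryMeasure]
    split_ifs with hω
    · rw [Measure.finsetSum_apply]
      refine Finset.sum_eq_zero fun r hr => ?_
      have hr1 := ((hcad ω hω).mem_entryTimes.1 hr).1
      rw [Measure.dirac_apply]
      refine indicator_of_notMem (fun hmem => hmem.1 hr1) _
    · rfl
  · rw [hνa ω _ measurableSet_Ioc.compl _ .univ, hν₀a]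
    refine withDensity_absolutelyContinuous _ _ ?_
    have : {r : ℝ≥0 | r ∈ (Ioc t M.T)ᶜ ∧ () ∈ (univ : Set Unit)} = (Ioc t M.T)ᶜ := by
      ext r; simp
    rw [this, Measure.restrict_apply measurableSet_Ioc.compl]
    simp
  · have hb : ∀ ω, ν ω univ ≤ ENNReal.ofReal C * leb (Ioc t M.T) := by
      intro ω
      rw [hν, Kernel.map_apply' _ hpair _ .univ, preimage_univ, hν₀a,
        withDensity_apply _ .univ, Measure.restrict_univ]
      calc ∫⁻ r in Ioc t M.T, g ω r ∂leb ≤ ∫⁻ r in Ioc t M.T, ENNReal.ofReal C ∂leb :=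
            lintegral_mono fun r => ENNReal.ofReal_le_ofReal (hC _ _ _)
        _ = _ := by rw [setLIntegral_const]
    refine (lintegral_mono hb).trans_lt ?_
    rw [lintegral_const, measure_univ, mul_one]
    exact ENNReal.mul_lt_top ENNReal.ofReal_lt_top measure_Ioc_lt_top
  · intro s hts hsT A hA D hD
    simp_rw [hκa _ _ measurableSet_Ioi _ hD, hνa _ _ measurableSet_Ioi _ hD]
    by_cases hu : () ∈ D
    · simp only [hu, and_true, ofPred_mem_eq]
      have h1 : ∫⁻ ω in A, entryMeasure M Y A0 t j ω (Ioi s) ∂P =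
          ∫⁻ ω in A, ((entryTimes (fun r => Y r ω) t M.T s j).card : ℝ≥0∞) ∂P := by
        refine lintegral_congr_ae (ae_restrict_of_ae ?_)
        filter_upwards [hPA0] with ω hω
        rw [entryMeasure_apply_Ioi hcad, indicator_of_mem hω, max_eq_left hts]
      rw [h1, hY.setLIntegral_entryTimes hh hA0 hPA0 hcad hts hsT j hA]
      refine lintegral_congr fun ω => ?_
      rw [hν₀a, withDensity_apply _ measurableSet_Ioi, Measure.restrict_restrict measurableSet_Ioi]
      congr 2
      ext r
      simp only [mem_Ioc, mem_inter_iff, mem_Ioi]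
      exact ⟨fun h => ⟨h.1, hts.trans_lt h.1, h.2⟩, fun h => ⟨h.1, h.2.2⟩⟩
    · simp [hu]

end IsControlledChain

end

section

/-! ### The compensation formula for Poisson random measures -/

namespace IsPoissonRandomMeasure

variable {Z : Type*} {mZ : MeasurableSpace Z} {Ω : Type*} {mΩ : MeasurableSpace Ω} {P : Measure Ω}
  {𝓕 : Filtration ℝ≥0 mΩ} {ς : Measure Z} {N : Ω → Measure (ℝ≥0 × Z)} {A0 : Set Ω} {t T : ℝ≥0}

open Classical in
/-- The points of the Poisson random measure in `(t, T]`, on the event `A0`. -/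
def pointKernel (hN : IsPoissonRandomMeasure P 𝓕 ς N) (hA0 : MeasurableSet A0) (t T : ℝ≥0) :
    Kernel Ω (ℝ≥0 × Z) :=
  Kernel.piecewise hA0 ⟨fun ω => (N ω).restrict (Ioc t T ×ˢ univ),
    Measure.measurable_of_measurable_coe _ fun B hB => by
      simp_rw [Measure.restrict_apply hB]
      exact hN.measurable (hB.inter (measurableSet_Ioc.prod .univ))
        fun p hp => ⟨hp.2.1.2, mem_univ _⟩⟩ 0

lemma pointKernel_of_mem (hN : IsPoissonRandomMeasure P 𝓕 ς N) (hA0 : MeasurableSet A0) {ω : Ω}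
    (hω : ω ∈ A0) : hN.pointKernel hA0 t T ω = (N ω).restrict (Ioc t T ×ˢ univ) := by
  classical
  rw [pointKernel, Kernel.piecewise_apply, if_pos hω]
  rfl

lemma pointKernel_of_notMem (hN : IsPoissonRandomMeasure P 𝓕 ς N) (hA0 : MeasurableSet A0)
    {ω : Ω} (hω : ω ∉ A0) : hN.pointKernel hA0 t T ω = 0 := by
  classical
  rw [pointKernel, Kernel.piecewise_apply, if_neg hω]
  rfl

lemma isSFiniteKernel_pointKernel (hN : IsPoissonRandomMeasure P 𝓕 ς N)
    (hA0 : MeasurableSet A0) (hfin : ∀ ω ∈ A0, N ω (Ioc t T ×ˢ univ) < ⊤) :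
    IsSFiniteKernel (hN.pointKernel hA0 t T) := by
  refine isSFiniteKernel_of_forall_lt_top _ fun ω => ?_
  by_cases hω : ω ∈ A0
  · rw [hN.pointKernel_of_mem hA0 hω, Measure.restrict_apply_univ]
    exact hfin ω hω
  · simp [hN.pointKernel_of_notMem hA0 hω]

/-- On predictable sets, the points of the Poisson random measure have the same mean measure as
the intensity. -/
lemma map_reorder_pointKernel [IsProbabilityMeasure P] [IsFiniteMeasure ς]
    (hN : IsPoissonRandomMeasure P 𝓕 ς N) (hA0 : MeasurableSet A0) (hPA0 : ∀ᵐ ω ∂P, ω ∈ A0)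
    (hfin : ∀ ω ∈ A0, N ω (Ioc t T ×ˢ univ) < ⊤) :
    @Measure.map _ _ _ (𝓕.predictable.prod mZ) reorder (P ⊗ₘ hN.pointKernel hA0 t T) =
      @Measure.map _ _ _ (𝓕.predictable.prod mZ) reorder
        (P ⊗ₘ Kernel.const Ω ((leb.restrict (Ioc t T)).prod ς)) := by
  have := hN.isSFiniteKernel_pointKernel hA0 hfin
  refine map_reorder_eq P 𝓕 t T _ _ (fun ω => ?_) (fun ω => ?_) ?_ ?_
  · by_cases hω : ω ∈ A0
    · rw [hN.pointKernel_of_mem hA0 hω, Measure.restrict_apply (measurableSet_Ioc.compl.prod .univ),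
        Set.prod_inter_prod, compl_inter_self]
      simp
    · simp [hN.pointKernel_of_notMem hA0 hω]
  · rw [Kernel.const_apply, Measure.prod_prod, Measure.restrict_apply measurableSet_Ioc.compl]
    simp
  · simp only [Kernel.const_apply]
    rw [lintegral_const, measure_univ (μ := P), mul_one]
    exact measure_lt_top _ _
  · intro s hts hsT A hA C hC
    have h1 : ∫⁻ ω in A, hN.pointKernel hA0 t T ω (Ioi s ×ˢ C) ∂P =
        ∫⁻ ω in A, N ω (Ioc s T ×ˢ C) ∂P := by
      refine lintegral_congr_ae (ae_restrict_of_ae ?_)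
      filter_upwards [hPA0] with ω hω
      rw [hN.pointKernel_of_mem hA0 hω, Measure.restrict_apply (measurableSet_Ioi.prod hC),
        Set.prod_inter_prod, inter_univ]
      congr 2
      ext r
      simp only [mem_Ioc, mem_inter_iff, mem_Ioi]
      exact ⟨fun h => ⟨h.1, h.2.2⟩, fun h => ⟨h.1, hts.trans_lt h.1, h.2⟩⟩
    rw [h1, hN.setLIntegral_eq hA hC]
    refine lintegral_congr fun ω => ?_
    rw [Kernel.const_apply, Measure.prod_prod, Measure.prod_prod,
      Measure.restrict_apply measurableSet_Ioi]
    congr 2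
    ext r
    simp only [mem_Ioc, mem_inter_iff, mem_Ioi]
    exact ⟨fun h => ⟨h.1, hts.trans_lt h.1, h.2⟩, fun h => ⟨h.1, h.2.2⟩⟩

/-- Compensation formula for a Poisson random measure. -/
theorem integral_compensation [IsProbabilityMeasure P] [IsFiniteMeasure ς]
    (hN : IsPoissonRandomMeasure P 𝓕 ς N) (hA0 : MeasurableSet A0) (hPA0 : ∀ᵐ ω ∂P, ω ∈ A0)
    (hfin : ∀ ω ∈ A0, N ω (Ioc t T ×ˢ univ) < ⊤)
    {H : (ℝ≥0 × Ω) × Z → ℝ} (hH : Measurable[𝓕.predictable.prod mZ] H)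
    (hint : ∫⁻ ω, ∫⁻ r in Ioc t T, ∫⁻ z, ‖H ((r, ω), z)‖ₑ ∂ς ∂leb ∂P < ⊤) :
    Integrable (fun ω => ∫ p in Ioc t T ×ˢ univ, H ((p.1, ω), p.2) ∂(N ω)) P ∧
    Integrable (fun ω => ∫ r in Ioc t T, ∫ z, H ((r, ω), z) ∂ς ∂leb) P ∧
    ∫ ω, ∫ p in Ioc t T ×ˢ univ, H ((p.1, ω), p.2) ∂(N ω) ∂P =
      ∫ ω, ∫ r in Ioc t T, ∫ z, H ((r, ω), z) ∂ς ∂leb ∂P ∧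
    ∀ᵐ ω ∂P, IntegrableOn (fun r => ∫ z, H ((r, ω), z) ∂ς) (Ioc t T) leb := by
  have := hN.isSFiniteKernel_pointKernel hA0 hfin
  have hHm : Measurable H := by
    refine Measurable.mono hH ?_ le_rfl
    exact sup_le_sup (MeasurableSpace.comap_mono (predictable_le_prod 𝓕)) le_rfl
  have hHω : ∀ ω, Measurable fun p : ℝ≥0 × Z => H ((p.1, ω), p.2) := fun ω =>
    hHm.comp ((measurable_fst.prodMk measurable_const).prodMk measurable_snd)
  obtain ⟨h1, h2, h3, h4⟩ := integral_eq_of_map_reorder_eq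
    (hN.map_reorder_pointKernel hA0 hPA0 hfin) hH (by
      refine lt_of_le_of_lt (le_of_eq (lintegral_congr fun ω => ?_)) hint
      rw [Kernel.const_apply]
      exact lintegral_prod _ (hHω ω).enorm.aemeasurable)
  have hκe : (fun ω => ∫ p, H (reorder (ω, p)) ∂(hN.pointKernel hA0 t T ω)) =ᵐ[P]
      fun ω => ∫ p in Ioc t T ×ˢ univ, H ((p.1, ω), p.2) ∂(N ω) := by
    filter_upwards [hPA0] with ω hω
    rw [hN.pointKernel_of_mem hA0 hω]
    rfl
  have h4' : ∀ᵐ ω ∂P, Integrable (fun p : ℝ≥0 × Z => H ((p.1, ω), p.2))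
      ((leb.restrict (Ioc t T)).prod ς) := h4
  have hνe : (fun ω => ∫ p, H (reorder (ω, p))
      ∂(Kernel.const Ω ((leb.restrict (Ioc t T)).prod ς) ω)) =ᵐ[P]
      fun ω => ∫ r in Ioc t T, ∫ z, H ((r, ω), z) ∂ς ∂leb := by
    filter_upwards [h4'] with ω hω
    exact integral_prod _ hω
  refine ⟨h1.congr hκe, h2.congr hνe, ?_, ?_⟩
  · rw [← integral_congr_ae hκe, h3, integral_congr_ae hνe]
  · filter_upwards [h4'] with ω hω using hω.integral_prod_left

/-- A predictable property which holds almost everywhere for the intensity holds at the points of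
the Poisson random measure. -/
theorem ae_of_ae_intensity [IsProbabilityMeasure P] [IsFiniteMeasure ς]
    (hN : IsPoissonRandomMeasure P 𝓕 ς N) (hA0 : MeasurableSet A0) (hPA0 : ∀ᵐ ω ∂P, ω ∈ A0)
    (hfin : ∀ ω ∈ A0, N ω (Ioc t T ×ˢ univ) < ⊤)
    {p : (ℝ≥0 × Ω) × Z → Prop} (hp : MeasurableSet[𝓕.predictable.prod mZ] {x | p x})
    (h : ∀ᵐ ω ∂P, ∀ᵐ x ∂((leb.restrict (Ioc t T)).prod ς), p ((x.1, ω), x.2)) :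
    ∀ᵐ ω ∂P, ∀ᵐ x ∂((N ω).restrict (Ioc t T ×ˢ univ)), p ((x.1, ω), x.2) := by
  have := hN.isSFiniteKernel_pointKernel hA0 hfin
  filter_upwards [ae_ae_of_map_reorder_eq (hN.map_reorder_pointKernel hA0 hPA0 hfin) hp h,
    hPA0] with ω hω hω'
  rw [hN.pointKernel_of_mem hA0 hω'] at hω
  exact hω

end IsPoissonRandomMeasure

end

section

/-! ### The chain rule along absolutely continuous paths -/

lemma absolutelyContinuousOnInterval_of_dist_le {f g : ℝ → ℝ} {a b C D : ℝ}
    (hg : AbsolutelyContinuousOnInterval g a b)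
    (h : ∀ x ∈ uIcc a b, ∀ y ∈ uIcc a b,
      dist (f x) (f y) ≤ C * dist x y + D * dist (g x) (g y)) :
    AbsolutelyContinuousOnInterval f a b := by
  have hid : AbsolutelyContinuousOnInterval (fun x : ℝ => x) a b :=
    (LipschitzWith.id.lipschitzOnWith (s := uIcc a b)).absolutelyContinuousOnInterval
  have hlim := (Tendsto.const_mul C hid).add (Tendsto.const_mul D hg)
  rw [mul_zero, mul_zero, add_zero] at hlim
  refine squeeze_zero' (Eventually.of_forall fun E => Finset.sum_nonneg fun _ _ => dist_nonneg) ?_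
    hlim
  filter_upwards [mem_inf_of_right (mem_principal_self
    (AbsolutelyContinuousOnInterval.disjWithin a b))] with E hE
  rw [Finset.mul_sum, Finset.mul_sum, ← Finset.sum_add_distrib]
  exact Finset.sum_le_sum fun i hi => h _ (hE.1 i hi).1 _ (hE.1 i hi).2

lemma absolutelyContinuousOnInterval_const_add_integral {φ : ℝ → ℝ} {a b : ℝ} (x₀ : ℝ)
    (hφ : IntervalIntegrable φ volume a b) :
    AbsolutelyContinuousOnInterval (fun s => x₀ + ∫ r in a..s, φ r) a b := by
  refine absolutelyContinuousOnInterval_of_dist_le (C := 0) (D := 1)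
    (hφ.absolutelyContinuousOnInterval_intervalIntegral (c := a) left_mem_uIcc)
    fun x _ y _ => ?_
  rw [dist_add_left, zero_mul, zero_add, one_mul]

variable {K : ℕ} {M : Market K} {Υ : ℝ → ℝ → Fin K → ℝ}

/-- The chain rule; continuity of the partial derivatives gives joint differentiability. -/
lemma IsC11.hasDerivAt_comp (hΥ : IsC11 M Υ) (k : Fin K) {s : ℝ} (hs : s ∈ Ioo 0 (M.T : ℝ))
    {X : ℝ → ℝ} (hX0 : 0 < X s) {φ : ℝ} (hX : HasDerivAt X φ s) :
    HasDerivAt (fun r => Υ r (X r) k)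
      (derivWithin (fun r => Υ r (X s) k) (Icc 0 (M.T : ℝ)) s
        + deriv (fun v => Υ s v k) (X s) * φ) s := by
  have hopen : Ioo 0 (M.T : ℝ) ×ˢ Ioi (0 : ℝ) ∈ 𝓝 (s, X s) :=
    (isOpen_Ioo.prod isOpen_Ioi).mem_nhds ⟨hs, hX0⟩
  have hnhds : Icc 0 (M.T : ℝ) ×ˢ Ioi (0 : ℝ) ∈ 𝓝 (s, X s) :=
    mem_of_superset hopen (prod_mono Ioo_subset_Icc_self subset_rfl)
  let d₁ : ℝ → ℝ → ℝ := fun s x => derivWithin (fun r => Υ r x k) (Icc 0 (M.T : ℝ)) s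
  let d₂ : ℝ → ℝ → ℝ := fun s x => deriv (fun v => Υ s v k) x
  have hc₁ : ContinuousAt (fun p : ℝ × ℝ => d₁ p.1 p.2) (s, X s) :=
    (hΥ.cont_time k).continuousAt hnhds
  have hc₂ : ContinuousAt (fun p : ℝ × ℝ => d₂ p.1 p.2) (s, X s) :=
    (hΥ.cont_wealth k).continuousAt hnhds
  have hstrict := hasStrictFDerivAt_uncurry_coprod (𝕜 := ℝ) (u := (s, X s))
    (f := fun s x => Υ s x k)
    (f₁ := fun s x => ContinuousLinearMap.toSpanSingleton ℝ (d₁ s x))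
    (f₂ := fun s x => ContinuousLinearMap.toSpanSingleton ℝ (d₂ s x))
    (by
      filter_upwards [hopen] with v hv
      have h1 := (hΥ.diff_time k v.1 (Ioo_subset_Icc_self hv.1) v.2 hv.2).hasDerivWithinAt
      exact (h1.hasDerivAt (Icc_mem_nhds hv.1.1 hv.1.2)).hasFDerivAt)
    (by
      filter_upwards [hopen] with v hv
      exact (hΥ.diff_wealth k v.1 (Ioo_subset_Icc_self hv.1) v.2 hv.2).hasDerivAt.hasFDerivAt)
    ((ContinuousLinearMap.toSpanSingletonCLE (𝕜 := ℝ) (E := ℝ)).continuous.continuousAt.comp hc₁)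
    ((ContinuousLinearMap.toSpanSingletonCLE (𝕜 := ℝ) (E := ℝ)).continuous.continuousAt.comp hc₂)
  have hcomp := hstrict.hasFDerivAt.comp_hasDerivAt (f := fun r => (r, X r)) s
    ((hasDerivAt_id s).prodMk hX)
  refine hcomp.congr_deriv ?_
  simp [Function.HasUncurry.uncurry, d₁, d₂, mul_comm]

/-- The drift of `Υ(s, x, k)` along a path with velocity `v`. -/
def drift (M : Market K) (Υ : ℝ → ℝ → Fin K → ℝ) (s x v : ℝ) (k : Fin K) : ℝ :=
  derivWithin (fun r => Υ r x k) (Icc 0 (M.T : ℝ)) s + deriv (fun y => Υ s y k) x * v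

/-- The fundamental theorem of calculus for a `C^{1,1}` function along an absolutely continuous
path of positive wealth. -/
lemma IsC11.integral_drift (hΥ : IsC11 M Υ) (k : Fin K) {a b : ℝ} (ha : 0 ≤ a) (hab : a ≤ b)
    (hb : b ≤ M.T) {φ : ℝ → ℝ} (hφ : IntervalIntegrable φ volume a b) {x₀ : ℝ}
    (hpos : ∀ s ∈ Icc a b, 0 < x₀ + ∫ r in a..s, φ r) :
    IntervalIntegrable (fun s => drift M Υ s (x₀ + ∫ r in a..s, φ r) (φ s) k) volume a b ∧
    ∫ s in a..b, drift M Υ s (x₀ + ∫ r in a..s, φ r) (φ s) k =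
      Υ b (x₀ + ∫ r in a..b, φ r) k - Υ a x₀ k := by
  set X : ℝ → ℝ := fun s => x₀ + ∫ r in a..s, φ r with hX
  have hXac : AbsolutelyContinuousOnInterval X a b :=
    absolutelyContinuousOnInterval_const_add_integral x₀ hφ
  have hXc : ContinuousOn X (Icc a b) := by
    have := hXac.continuousOn
    rwa [uIcc_of_le hab] at this
  have hsub : Icc a b ⊆ Icc 0 (M.T : ℝ) := Icc_subset_Icc ha hb
  obtain ⟨sm, hsm, hmin⟩ := isCompact_Icc.exists_isMinOn (nonempty_Icc.2 hab) hXc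
  obtain ⟨sM, hsM, hmax⟩ := isCompact_Icc.exists_isMaxOn (nonempty_Icc.2 hab) hXc
  have hmem : ∀ s ∈ Icc a b, X s ∈ Icc (X sm) (X sM) := fun s hs => ⟨hmin hs, hmax hs⟩
  have hRsub : Icc a b ×ˢ Icc (X sm) (X sM) ⊆ Icc 0 (M.T : ℝ) ×ˢ Ioi 0 := fun p hp =>
    ⟨hsub hp.1, (hpos sm hsm).trans_le hp.2.1⟩
  have hRc : IsCompact (Icc a b ×ˢ Icc (X sm) (X sM)) := isCompact_Icc.prod isCompact_Icc
  obtain ⟨C, hC⟩ := hRc.exists_bound_of_continuousOn ((hΥ.cont_time k).mono hRsub)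
  obtain ⟨D, hD⟩ := hRc.exists_bound_of_continuousOn ((hΥ.cont_wealth k).mono hRsub)
  have hfac : AbsolutelyContinuousOnInterval (fun s => Υ s (X s) k) a b := by
    refine absolutelyContinuousOnInterval_of_dist_le (C := C) (D := D) hXac fun s hs r hr => ?_
    rw [uIcc_of_le hab] at hs hr
    have h1 : dist (Υ s (X s) k) (Υ r (X s) k) ≤ C * dist s r := by
      rw [dist_eq_norm, dist_eq_norm]
      refine (convex_Icc a b).norm_image_sub_le_of_norm_hasDerivWithin_le
        (f := fun q => Υ q (X s) k) (fun q hq => ((hΥ.diff_time k q (hsub hq) (X s)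
          (hpos s hs)).hasDerivWithinAt).mono hsub) (fun q hq => hC (q, X s) ⟨hq, hmem s hs⟩) hr hs
    have h2 : dist (Υ r (X s) k) (Υ r (X r) k) ≤ D * dist (X s) (X r) := by
      rw [dist_eq_norm, dist_eq_norm]
      refine (convex_Icc (X sm) (X sM)).norm_image_sub_le_of_norm_hasDerivWithin_le
        (f := fun q => Υ r q k) (fun q hq => (hΥ.diff_wealth k r (hsub hr) q
          ((hpos sm hsm).trans_le hq.1)).hasDerivAt.hasDerivWithinAt)
        (fun q hq => hD (r, q) ⟨hr, hq⟩) (hmem r hr) (hmem s hs)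
    exact (dist_triangle _ _ _).trans (add_le_add h1 h2)
  have hderiv : ∀ᵐ s, s ∈ uIoc a b →
      deriv (fun s => Υ s (X s) k) s = drift M Υ s (X s) (φ s) k := by
    have hne : ∀ᵐ s : ℝ, s ≠ b := by simp [ae_iff, measure_singleton]
    filter_upwards [hφ.ae_hasDerivAt_integral, hne] with s hs hsb hmem
    have hs' := hs (uIoc_subset_uIcc hmem) a left_mem_uIcc
    rw [uIoc_of_le hab] at hmem
    exact (hΥ.hasDerivAt_comp k ⟨ha.trans_lt hmem.1, (lt_of_le_of_ne hmem.2 hsb).trans_le hb⟩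
      (hpos s ⟨hmem.1.le, hmem.2⟩) (hs'.const_add x₀)).deriv
  refine ⟨?_, ?_⟩
  · exact hfac.intervalIntegrable_deriv.congr_ae
      ((ae_restrict_iff' measurableSet_uIoc).2 hderiv)
  · rw [← intervalIntegral.integral_congr_ae hderiv, hfac.integral_deriv_eq_sub]
    simp [hX]

/-- A positive solution of a linear integral equation stays positive: its product with
`exp (-∫ c)` is constant. -/
lemma pos_of_linear_integral_equation {X c : ℝ → ℝ} {a b : ℝ} (hab : a ≤ b)
    (hc : IntervalIntegrable c volume a b)
    (hXc : IntervalIntegrable (fun s => X s * c s) volume a b)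
    (hX : ∀ s ∈ Icc a b, X s = X a + ∫ r in a..s, X r * c r) (h0 : 0 < X a) :
    ∀ s ∈ Icc a b, 0 < X s := by
  set Z : ℝ → ℝ := fun s => X a + ∫ r in a..s, X r * c r with hZ
  set I : ℝ → ℝ := fun s => 0 + ∫ r in a..s, c r with hI
  have hZac : AbsolutelyContinuousOnInterval Z a b :=
    absolutelyContinuousOnInterval_const_add_integral _ hXc
  have hIac : AbsolutelyContinuousOnInterval I a b :=
    absolutelyContinuousOnInterval_const_add_integral _ hc
  obtain ⟨B, hB⟩ := hIac.exists_bound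
  have hEac : AbsolutelyContinuousOnInterval (fun s => Real.exp (-I s)) a b := by
    refine absolutelyContinuousOnInterval_of_dist_le (C := 0) (D := Real.exp B) hIac
      fun s hs r hr => ?_
    rw [zero_mul, zero_add, dist_eq_norm, dist_eq_norm, ← norm_neg (I s - I r)]
    have := (convex_Iic B).norm_image_sub_le_of_norm_hasDerivWithin_le (f := Real.exp)
      (f' := Real.exp) (fun q _ => (Real.hasDerivAt_exp q).hasDerivWithinAt)
      (C := Real.exp B) (fun q hq => by
        rw [Real.norm_of_nonneg (Real.exp_pos _).le]; exact Real.exp_le_exp.2 hq)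
      (x := -I r) (y := -I s) ((neg_le_abs _).trans (hB r hr)) ((neg_le_abs _).trans (hB s hs))
    rw [show -(I s - I r) = -I s - -I r by ring]
    exact this
  have hne : ∀ᵐ s : ℝ, s ≠ a ∧ s ≠ b := by
    have h1 : ∀ᵐ s : ℝ, s ≠ a := by simp [ae_iff, measure_singleton]
    have h2 : ∀ᵐ s : ℝ, s ≠ b := by simp [ae_iff, measure_singleton]
    filter_upwards [h1, h2] with s hs1 hs2 using ⟨hs1, hs2⟩
  obtain ⟨k, hk⟩ := (hZac.mul hEac).const_of_ae_hasDerivAt_zero (by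
    filter_upwards [hc.ae_hasDerivAt_integral, hXc.ae_hasDerivAt_integral] with s h1 h2 hs
    have d1 := (h1 hs a left_mem_uIcc).const_add 0
    have d2 := (h2 hs a left_mem_uIcc).const_add (X a)
    have d3 := d2.mul d1.neg.exp
    refine d3.congr_deriv ?_
    rw [uIcc_of_le hab] at hs
    have hXs : X s = X a + ∫ r in a..s, X r * c r := hX s hs
    rw [← hXs]
    simp only [Pi.neg_apply]
    ring)
  rw [uIcc_of_le hab] at hk
  intro s hs
  have h1 := hk s hs
  have h2 := hk a (left_mem_Icc.2 hab)
  simp only [Pi.mul_apply] at h1 h2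
  have h3 : 0 < Z a * Real.exp (-I a) := by simp [hZ, hI, h0]
  rw [h2, ← h1] at h3
  rw [hX s hs]
  exact pos_of_mul_pos_left h3 (Real.exp_pos _).le

end

section

/-! ### Itô's formula for paths with finitely many jumps -/

section SumIoc

variable {ι : Type*}

open Classical in
/-- The sum of `f p` over the marks `p ∈ S` with time `τ p ∈ (a, b]`. -/
def sumIoc (S : Finset ι) (τ : ι → ℝ≥0) (f : ι → ℝ) (a b : ℝ≥0) : ℝ :=
  ∑ p ∈ S.filter (fun p => τ p ∈ Ioc a b), f p

lemma sumIoc_add (S : Finset ι) (τ : ι → ℝ≥0) (f : ι → ℝ) {a c b : ℝ≥0} (hac : a ≤ c)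
    (hcb : c ≤ b) : sumIoc S τ f a c + sumIoc S τ f c b = sumIoc S τ f a b := by
  classical
  rw [sumIoc, sumIoc, sumIoc, ← Finset.sum_union]
  · congr 1
    ext p
    have := Ioc_union_Ioc_eq_Ioc hac hcb
    simp only [Finset.mem_union, Finset.mem_filter, ← this, mem_union]
    tauto
  · rw [Finset.disjoint_filter]
    exact fun p _ h1 h2 => absurd h1.2 (not_le.2 h2.1)

lemma sumIoc_self (S : Finset ι) (τ : ι → ℝ≥0) (f : ι → ℝ) (a : ℝ≥0) : sumIoc S τ f a a = 0 := by
  simp [sumIoc]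

lemma sumIoc_eq_zero {S : Finset ι} {τ : ι → ℝ≥0} (f : ι → ℝ) {a b : ℝ≥0}
    (h : ∀ p ∈ S, τ p ∉ Ioc a b) : sumIoc S τ f a b = 0 := by
  classical
  rw [sumIoc, Finset.filter_false_of_mem h, Finset.sum_empty]

lemma sumIoc_eq_single {S : Finset ι} {τ : ι → ℝ≥0} (hinj : InjOn τ S) (f : ι → ℝ) {a b : ℝ≥0}
    (hab : a < b) (h : ∀ p ∈ S, ¬ (a < τ p ∧ τ p < b)) {p : ι} (hp : p ∈ S) (hpb : τ p = b) :
    sumIoc S τ f a b = f p := by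
  classical
  rw [sumIoc]
  have : S.filter (fun p => τ p ∈ Ioc a b) = {p} := by
    ext r
    rw [Finset.mem_filter, Finset.mem_singleton]
    constructor
    · rintro ⟨hr, h1, h2⟩
      refine hinj hr hp ?_
      rw [hpb]
      exact le_antisymm h2 (not_lt.1 fun h3 => h r hr ⟨h1, h3⟩)
    · rintro rfl
      exact ⟨hp, hpb ▸ hab, hpb.le⟩
  rw [this, Finset.sum_singleton]

lemma sumIoc_eq_sum {S : Finset ι} {τ : ι → ℝ≥0} (f : ι → ℝ) {a b : ℝ≥0}
    (h : ∀ p ∈ S, τ p ∈ Ioc a b) : sumIoc S τ f a b = ∑ p ∈ S, f p := by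
  classical
  rw [sumIoc, Finset.filter_true_of_mem h]

end SumIoc

/-- A path on `[t, T]` which moves with velocity `φ`, except that it jumps by `δ p` at the times
`τ p` of finitely many marks `p ∈ S`. -/
structure IsJumpPath {ι : Type*} (t T : ℝ≥0) (x φ : ℝ≥0 → ℝ) (S : Finset ι) (τ : ι → ℝ≥0)
    (δ : ι → ℝ) : Prop where
  integrable : IntegrableOn φ (Ioc t T) leb
  eq : ∀ u ∈ Icc t T, x u = x t + ∫ s in Ioc t u, φ s ∂leb + sumIoc S τ δ t u
  injOn : InjOn τ S
  mem : ∀ p ∈ S, τ p ∈ Ioc t T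

namespace IsJumpPath

variable {ι : Type*} {t T : ℝ≥0} {x φ : ℝ≥0 → ℝ} {S : Finset ι} {τ : ι → ℝ≥0} {δ : ι → ℝ}

lemma increment (hx : IsJumpPath t T x φ S τ δ) {a b : ℝ≥0} (ha : t ≤ a) (hab : a ≤ b)
    (hb : b ≤ T) : x b = x a + ∫ s in Ioc a b, φ s ∂leb + sumIoc S τ δ a b := by
  have h1 := hx.eq a ⟨ha, hab.trans hb⟩
  have h2 := hx.eq b ⟨ha.trans hab, hb⟩
  have h3 := sumIoc_add S τ δ ha hab
  have h4 : ∫ s in Ioc t b, φ s ∂leb = ∫ s in Ioc t a, φ s ∂leb + ∫ s in Ioc a b, φ s ∂leb := by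
    rw [← Ioc_union_Ioc_eq_Ioc ha hab, setIntegral_union (Ioc_disjoint_Ioc_of_le le_rfl)
      measurableSet_Ioc (hx.integrable.mono_set (Ioc_subset_Ioc_right (hab.trans hb)))
      (hx.integrable.mono_set (Ioc_subset_Ioc ha hb))]
  rw [h2, h1, h4, ← h3]
  ring

lemma integrableOn (hx : IsJumpPath t T x φ S τ δ) {a b : ℝ≥0} (ha : t ≤ a) (hb : b ≤ T) :
    IntegrableOn φ (Ioc a b) leb :=
  hx.integrable.mono_set (Ioc_subset_Ioc ha hb)

/-- Up to the first mark after `a`, the left limits follow the continuous part of the path. -/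
lemma leftLim_eq (hx : IsJumpPath t T x φ S τ δ) {a b : ℝ≥0} (ha : t ≤ a) (hb : b ≤ T)
    (h : ∀ p ∈ S, ¬ (a < τ p ∧ τ p < b)) {s : ℝ≥0} (hs : s ∈ Ioc a b) :
    Function.leftLim x s = x a + ∫ r in Ioc a s, φ r ∂leb := by
  have := nhdsLT_neBot_of_lt hs.1
  refine leftLim_eq_of_tendsto ?_
  have hint : IntervalIntegrable (fun r : ℝ => φ r.toNNReal) volume a s :=
    (integrableOn_leb_Ioc_iff hs.1.le φ).1 (hx.integrableOn ha (hs.2.trans hb))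
  have hcont : ContinuousWithinAt (fun u : ℝ => x a + ∫ r in (a : ℝ)..u, φ r.toNNReal)
      (Icc (a : ℝ) s) s := by
    have h1 := intervalIntegral.continuousOn_primitive_interval' hint left_mem_uIcc
    rw [uIcc_of_le (by exact_mod_cast hs.1.le)] at h1
    exact (h1 s (right_mem_Icc.2 (by exact_mod_cast hs.1.le))).const_add _
  have hcoe : Tendsto ((↑) : ℝ≥0 → ℝ) (𝓝[<] s) (𝓝[Icc (a : ℝ) s] s) := by
    refine tendsto_nhdsWithin_iff.2
      ⟨(NNReal.continuous_coe.tendsto s).mono_left nhdsWithin_le_nhds, ?_⟩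
    filter_upwards [Ioo_mem_nhdsLT hs.1] with r hr
    exact ⟨by exact_mod_cast hr.1.le, by exact_mod_cast hr.2.le⟩
  rw [setIntegral_leb_Ioc hs.1.le]
  refine (hcont.tendsto.comp hcoe).congr' ?_
  filter_upwards [Ioo_mem_nhdsLT hs.1] with r hr
  rw [hx.increment ha hr.1.le (hr.2.le.trans (hs.2.trans hb)), sumIoc_eq_zero, add_zero,
    setIntegral_leb_Ioc hr.1.le, Function.comp]
  exact fun p hp hmem => h p hp ⟨hmem.1, hmem.2.trans_lt (hr.2.trans_le hs.2)⟩

lemma eq_leftLim_add (hx : IsJumpPath t T x φ S τ δ) {a b : ℝ≥0} (ha : t ≤ a) (hab : a < b)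
    (hb : b ≤ T) (h : ∀ p ∈ S, ¬ (a < τ p ∧ τ p < b)) :
    x b = Function.leftLim x b + sumIoc S τ δ a b := by
  rw [hx.leftLim_eq ha hb h ⟨hab, le_rfl⟩, hx.increment ha hab.le hb]

lemma _root_.LargeInvestor.exists_no_mark (S : Finset ι) (τ : ι → ℝ≥0) {t b : ℝ≥0} (hb : t < b) :
    ∃ a, t ≤ a ∧ a < b ∧ ∀ p ∈ S, ¬ (a < τ p ∧ τ p < b) := by
  classical
  let F : Finset ℝ≥0 := insert t ((S.image τ).filter (· < b))
  have hF : F.Nonempty := Finset.insert_nonempty _ _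
  have hmem := F.max'_mem hF
  refine ⟨F.max' hF, F.le_max' _ (Finset.mem_insert_self _ _), ?_, fun p hp hpp => ?_⟩
  · rcases Finset.mem_insert.1 hmem with h | h
    · rw [h]; exact hb
    · exact (Finset.mem_filter.1 h).2
  · refine absurd (F.le_max' (τ p) (Finset.mem_insert_of_mem (Finset.mem_filter.2
      ⟨Finset.mem_image_of_mem τ hp, hpp.2⟩))) (not_le.2 hpp.1)

lemma eq_leftLim_add_of_mem (hx : IsJumpPath t T x φ S τ δ) {p : ι} (hp : p ∈ S) :
    x (τ p) = Function.leftLim x (τ p) + δ p := by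
  obtain ⟨a, ha, hab, h⟩ := exists_no_mark S τ (hx.mem p hp).1
  rw [hx.eq_leftLim_add ha hab (hx.mem p hp).2 h, sumIoc_eq_single hx.injOn δ hab h hp rfl]

lemma eq_leftLim_of_notMem (hx : IsJumpPath t T x φ S τ δ) {b : ℝ≥0} (hb : b ∈ Ioc t T)
    (hS : ∀ p ∈ S, τ p ≠ b) : x b = Function.leftLim x b := by
  obtain ⟨a, ha, hab, h⟩ := exists_no_mark S τ hb.1
  rw [hx.eq_leftLim_add ha hab hb.2 h, sumIoc_eq_zero, add_zero]
  exact fun p hp hmem => h p hp ⟨hmem.1, lt_of_le_of_ne hmem.2 (hS p hp)⟩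

/-- A path with relative velocity `c` and relative jumps larger than `-1` remains positive. -/
lemma pos (hx : IsJumpPath t T x φ S τ δ) {c : ℝ≥0 → ℝ} (hc : IntegrableOn c (Ioc t T) leb)
    (hφ : ∀ s ∈ Ioc t T, φ s = Function.leftLim x s * c s) {g : ι → ℝ}
    (hδ : ∀ p ∈ S, δ p = Function.leftLim x (τ p) * g p) (hg : ∀ p ∈ S, 0 < 1 + g p)
    (h0 : 0 < x t) :
    (∀ s ∈ Icc t T, 0 < x s) ∧ ∀ s ∈ Ioc t T, 0 < Function.leftLim x s := by
  classical
  have hjump : ∀ s ∈ Ioc t T, 0 < Function.leftLim x s → 0 < x s := by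
    intro s hs hpos
    by_cases hex : ∃ p ∈ S, τ p = s
    · obtain ⟨p, hp, rfl⟩ := hex
      rw [hx.eq_leftLim_add_of_mem hp, hδ p hp]
      have := mul_pos hpos (hg p hp)
      linarith
    · push Not at hex
      rwa [hx.eq_leftLim_of_notMem hs hex]
  have hmain : ∀ a b, t ≤ a → a ≤ b → b ≤ T → 0 < x a →
      0 < x b ∧ ∀ s ∈ Ioc a b, 0 < Function.leftLim x s := by
    refine Icc_induction_finset (S.image τ) ?_ ?_
    · intro a c b _ _ _ _ h1 h2 ha
      refine ⟨(h2 (h1 ha).1).1, fun s hs => ?_⟩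
      rcases le_or_gt s c with h | h
      · exact (h1 ha).2 s ⟨hs.1, h⟩
      · exact (h2 (h1 ha).1).2 s ⟨h, hs.2⟩
    · intro a b hta hab hbT hS ha
      rcases hab.eq_or_lt with rfl | hlt
      · exact ⟨ha, fun s hs => absurd hs.1 (not_lt.2 hs.2)⟩
      have hS' : ∀ p ∈ S, ¬ (a < τ p ∧ τ p < b) := fun p hp =>
        hS (τ p) (Finset.mem_image_of_mem τ hp)
      let X : ℝ → ℝ := fun s => x a + ∫ r in (a : ℝ)..s, φ r.toNNReal
      have hab' : (a : ℝ) ≤ b := by exact_mod_cast hab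
      have hXl : ∀ s ∈ Ioc a b, Function.leftLim x s = X s := fun s hs => by
        rw [hx.leftLim_eq hta hbT hS' hs, setIntegral_leb_Ioc hs.1.le]
      have hXφ : ∀ r ∈ Ioc (a : ℝ) b, φ r.toNNReal = X r * c r.toNNReal := by
        intro r hr
        have hr0 : (0 : ℝ) ≤ r := a.2.trans hr.1.le
        have hr' : r.toNNReal ∈ Ioc a b :=
          ⟨Real.lt_toNNReal_iff_coe_lt.2 hr.1, Real.toNNReal_le_iff_le_coe.2 hr.2⟩
        rw [hφ _ ⟨hta.trans_lt hr'.1, hr'.2.trans hbT⟩, hXl _ hr', Real.coe_toNNReal r hr0]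
      have hint := (integrableOn_leb_Ioc_iff hab φ).1 (hx.integrableOn hta hbT)
      have hcint := (integrableOn_leb_Ioc_iff hab c).1 (hc.mono_set (Ioc_subset_Ioc hta hbT))
      have hXpos := pos_of_linear_integral_equation (X := X) (c := fun r => c r.toNNReal) hab'
        hcint (hint.congr (fun r hr => hXφ r (by rwa [uIoc_of_le hab'] at hr))) (by
          intro s hs
          change x a + _ = (x a + _) + _
          rw [intervalIntegral.integral_same, add_zero]
          congr 1
          refine intervalIntegral.integral_congr_ae (Eventually.of_forall fun r hr => ?_)
          rw [uIoc_of_le hs.1] at hr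
          exact hXφ r ⟨hr.1, hr.2.trans hs.2⟩) (by simpa [X] using ha)
      have hleft : ∀ s ∈ Ioc a b, 0 < Function.leftLim x s := fun s hs => by
        rw [hXl s hs]
        exact hXpos s ⟨by exact_mod_cast hs.1.le, by exact_mod_cast hs.2⟩
      exact ⟨hjump b ⟨hta.trans_lt hlt, hbT⟩ (hleft b ⟨hlt, le_rfl⟩), hleft⟩
  refine ⟨fun s hs => (hmain t s le_rfl hs.1 hs.2 h0).1, fun s hs => ?_⟩
  exact (hmain t T le_rfl (hs.1.le.trans hs.2) le_rfl h0).2 s hs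

variable {K : ℕ} {M : Market K} {Υ : ℝ → ℝ → Fin K → ℝ} {y : ℝ≥0 → Fin K}

/-- Itô's formula for a `C^{1,1}` function of a positive path with finitely many jumps and of the
state of a càdlàg chain, without common jumps. -/
theorem ito (hx : IsJumpPath t M.T x φ S τ δ) (hΥ : IsC11 M Υ)
    (hpos : ∀ s ∈ Icc t M.T, 0 < x s) (hposl : ∀ s ∈ Ioc t M.T, 0 < Function.leftLim x s)
    (hy : IsCadlagOn y t M.T) (hno : ∀ p ∈ S, Function.leftLim y (τ p) = y (τ p))
    (htT : t ≤ M.T) :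
    IntegrableOn (fun s : ℝ≥0 => drift M Υ s (Function.leftLim x s) (φ s)
      (Function.leftLim y s)) (Ioc t M.T) leb ∧
    Υ M.T (x M.T) (y M.T) - Υ t (x t) (y t) =
      ∫ s in Ioc t M.T, drift M Υ s (Function.leftLim x s) (φ s) (Function.leftLim y s) ∂leb
      + ∑ p ∈ S, (Υ (τ p) (Function.leftLim x (τ p) + δ p) (Function.leftLim y (τ p))
          - Υ (τ p) (Function.leftLim x (τ p)) (Function.leftLim y (τ p)))
      + ∑ j, ∑ r ∈ entryTimes y t M.T t j, (Υ r (Function.leftLim x r) j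
          - Υ r (Function.leftLim x r) (Function.leftLim y r)) := by
  classical
  set D : ℝ≥0 → ℝ := fun s => drift M Υ s (Function.leftLim x s) (φ s) (Function.leftLim y s)
  set J : Finset ℝ≥0 := hy.finite_jumps.toFinset with hJ
  have hJmem : ∀ r, r ∈ J ↔ r ∈ Ioc t M.T ∧ Function.leftLim y r ≠ y r := fun r => by
    rw [hJ, Set.Finite.mem_toFinset]; rfl
  set f : ι → ℝ := fun p => Υ (τ p) (Function.leftLim x (τ p) + δ p) (Function.leftLim y (τ p))
    - Υ (τ p) (Function.leftLim x (τ p)) (Function.leftLim y (τ p)) with hf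
  set e : ℝ≥0 → ℝ := fun r => Υ r (Function.leftLim x r) (y r)
    - Υ r (Function.leftLim x r) (Function.leftLim y r) with he
  have hmain : ∀ a b, t ≤ a → a ≤ b → b ≤ M.T → IntegrableOn D (Ioc a b) leb ∧
      Υ b (x b) (y b) - Υ a (x a) (y a) =
        ∫ s in Ioc a b, D s ∂leb + sumIoc S τ f a b + sumIoc J id e a b := by
    refine Icc_induction_finset (S.image τ ∪ J) ?_ ?_
    · rintro a c b _ hac hcb _ ⟨h1, h2⟩ ⟨h3, h4⟩
      refine ⟨?_, ?_⟩
      · rw [← Ioc_union_Ioc_eq_Ioc hac.le hcb.le]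
        exact h1.union h3
      · rw [← sumIoc_add S τ f hac.le hcb.le, ← sumIoc_add J id e hac.le hcb.le,
          ← Ioc_union_Ioc_eq_Ioc hac.le hcb.le,
          setIntegral_union (Ioc_disjoint_Ioc_of_le le_rfl) measurableSet_Ioc h1 h3]
        linarith
    · intro a b hta hab hbT hF
      rcases hab.eq_or_lt with rfl | hlt
      · simp [sumIoc_self]
      have hS : ∀ p ∈ S, ¬ (a < τ p ∧ τ p < b) := fun p hp =>
        hF (τ p) (Finset.mem_union_left _ (Finset.mem_image_of_mem τ hp))
      have hJ' : ∀ r ∈ J, ¬ (a < id r ∧ id r < b) := fun r hr =>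
        hF r (Finset.mem_union_right _ hr)
      have hynj : ∀ s ∈ Ioo a b, Function.leftLim y s = y s := fun s hs => by
        by_contra hne
        exact hJ' s ((hJmem s).2 ⟨⟨hta.trans_lt hs.1, hs.2.le.trans hbT⟩, hne⟩) hs
      have hyl : ∀ s ∈ Ioc a b, Function.leftLim y s = y a := fun s hs =>
        hy.leftLim_eq_of_no_jump hta hbT hynj hs
      have hab' : (a : ℝ) ≤ b := by exact_mod_cast hab
      let X : ℝ → ℝ := fun s => x a + ∫ r in (a : ℝ)..s, φ r.toNNReal
      have hXl : ∀ s ∈ Ioc a b, Function.leftLim x s = X s := fun s hs => by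
        rw [hx.leftLim_eq hta hbT hS hs, setIntegral_leb_Ioc hs.1.le]
      have hmemIoc : ∀ r ∈ Ioc (a : ℝ) b, r.toNNReal ∈ Ioc a b ∧ ((r.toNNReal : ℝ≥0) : ℝ) = r :=
        fun r hr => ⟨⟨Real.lt_toNNReal_iff_coe_lt.2 hr.1, Real.toNNReal_le_iff_le_coe.2 hr.2⟩,
          Real.coe_toNNReal r (a.2.trans hr.1.le)⟩
      have hint := (integrableOn_leb_Ioc_iff hab φ).1 (hx.integrableOn hta hbT)
      obtain ⟨hI, hE⟩ := hΥ.integral_drift (y a) a.2 hab' (by exact_mod_cast hbT) hint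
        (x₀ := x a) (fun s hs => by
          rcases hs.1.eq_or_lt with h | h
          · rw [← h, intervalIntegral.integral_same, add_zero]
            exact hpos a ⟨hta, hab.trans hbT⟩
          · obtain ⟨h1, h2⟩ := hmemIoc s ⟨h, hs.2⟩
            have := hposl _ ⟨hta.trans_lt h1.1, h1.2.trans hbT⟩
            rwa [hXl _ h1, h2] at this)
      have hD : ∀ r ∈ Ioc (a : ℝ) b, drift M Υ r (X r) (φ r.toNNReal) (y a) = D r.toNNReal := by
        intro r hr
        obtain ⟨h1, h2⟩ := hmemIoc r hr
        simp only [D]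
        rw [hXl _ h1, hyl _ h1, h2]
      have hbx : Function.leftLim x b = X b := hXl b ⟨hlt, le_rfl⟩
      have hby : Function.leftLim y b = y a := hyl b ⟨hlt, le_rfl⟩
      have hDint : ∫ s in Ioc a b, D s ∂leb =
          Υ b (Function.leftLim x b) (y a) - Υ a (x a) (y a) := by
        have hE' : _ = Υ b (X b) (y a) - Υ a (x a) (y a) := hE
        rw [setIntegral_leb_Ioc hab, hbx, ← hE']
        refine intervalIntegral.integral_congr_ae (Eventually.of_forall fun r hr => ?_)
        rw [uIoc_of_le hab'] at hr
        exact (hD r hr).symm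
      refine ⟨?_, ?_⟩
      · rw [integrableOn_leb_Ioc_iff hab]
        exact hI.congr fun r hr => hD r (by rwa [uIoc_of_le hab'] at hr)
      · rw [hDint]
        have hbmem : b ∈ Ioc t M.T := ⟨hta.trans_lt hlt, hbT⟩
        by_cases hex : ∃ p ∈ S, τ p = b
        · obtain ⟨p, hp, rfl⟩ := hex
          rw [sumIoc_eq_single hx.injOn f hlt hS hp rfl, sumIoc_eq_zero (S := J),
            hx.eq_leftLim_add_of_mem hp, ← hno p hp, hby]
          · simp only [hf, hby]
            ring
          · intro r hr hmem
            have hrb : r = τ p := le_antisymm hmem.2 (not_lt.1 fun h => hJ' r hr ⟨hmem.1, h⟩)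
            exact ((hJmem r).1 hr).2 (hrb ▸ hno p hp)
        · push Not at hex
          rw [sumIoc_eq_zero (S := S), hx.eq_leftLim_of_notMem hbmem hex]
          · by_cases hyb : Function.leftLim y b = y b
            · rw [sumIoc_eq_zero (S := J), ← hyb, hby]
              · ring
              · intro r hr hmem
                have hrb : r = b := le_antisymm hmem.2 (not_lt.1 fun h => hJ' r hr ⟨hmem.1, h⟩)
                exact ((hJmem r).1 hr).2 (hrb ▸ hyb)
            · rw [sumIoc_eq_single (τ := id) (injOn_id _) e hlt hJ' ((hJmem b).2 ⟨hbmem, hyb⟩) rfl,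
                he]
              simp only [hby]
              ring
          · exact fun p hp hmem => hS p hp ⟨hmem.1, lt_of_le_of_ne hmem.2 (hex p hp)⟩
  obtain ⟨h1, h2⟩ := hmain t M.T le_rfl htT le_rfl
  refine ⟨h1, ?_⟩
  rw [h2, sumIoc_eq_sum f hx.mem, sumIoc_eq_sum (τ := id) e fun r hr => ((hJmem r).1 hr).1,
    ← Finset.sum_fiberwise J y e]
  congr 1
  refine Finset.sum_congr rfl fun j _ => ?_
  have hset : J.filter (fun r => y r = j) = entryTimes y t M.T t j := by
    ext r
    rw [Finset.mem_filter, hJmem, hy.mem_entryTimes]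
    constructor
    · rintro ⟨⟨h1, h2⟩, rfl⟩; exact ⟨h1, h1.1, h2, rfl⟩
    · rintro ⟨h1, _, h2, rfl⟩; exact ⟨⟨h1, h2⟩, rfl⟩
  rw [hset]
  refine Finset.sum_congr rfl fun r hr => ?_
  rw [he]
  simp only [(hy.mem_entryTimes.1 hr).2.2.2]

end IsJumpPath

end

section

/-! ### The generator along the path -/

variable {K : ℕ}

instance (M : Market K) : IsFiniteMeasure M.ς := M.ς_finite

instance (M : Market K) : StandardBorelSpace M.Z := M.Z_meas.standardBorel

open Classical in
/-- The function `F` on `[0, T] × (0, ∞)`, extended by zero. -/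
def cutoff (M : Market K) (F : ℝ → ℝ → Fin K → ℝ) (s x : ℝ) (k : Fin K) : ℝ :=
  if s ∈ Icc 0 (M.T : ℝ) ∧ 0 < x then F s x k else 0

section Cutoff

variable {M : Market K} {F : ℝ → ℝ → Fin K → ℝ}

lemma cutoff_of_mem {s : ℝ≥0} (hs : s ≤ M.T) {x : ℝ} (hx : 0 < x) (k : Fin K) :
    cutoff M F s x k = F s x k :=
  if_pos ⟨⟨s.2, by exact_mod_cast hs⟩, hx⟩

lemma measurable_cutoff {α : Type*} [MeasurableSpace α]
    (hF : ∀ k, ContinuousOn (fun p : ℝ × ℝ => F p.1 p.2 k) (Icc 0 (M.T : ℝ) ×ˢ Ioi 0))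
    {s : α → ℝ≥0} (hs : Measurable s) {x : α → ℝ} (hx : Measurable x) {k : α → Fin K}
    (hk : Measurable k) : Measurable fun a => cutoff M F (s a) (x a) (k a) := by
  classical
  have h1 : ∀ k, Measurable fun p : ℝ × ℝ => cutoff M F p.1 p.2 k := by
    intro k
    have : (fun p : ℝ × ℝ => cutoff M F p.1 p.2 k) =
        (Icc 0 (M.T : ℝ) ×ˢ Ioi 0).piecewise (fun p : ℝ × ℝ => F p.1 p.2 k) fun _ => 0 := by
      ext p
      simp only [cutoff, Set.piecewise, mem_prod, mem_Ioi]
    rw [this]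
    exact (hF k).measurable_piecewise continuousOn_const (measurableSet_Icc.prod measurableSet_Ioi)
  have h2 : Measurable fun q : Fin K × (ℝ × ℝ) => cutoff M F q.2.1 q.2.2 q.1 :=
    measurable_from_prod_countable_right h1
  exact h2.comp (hk.prodMk ((NNReal.continuous_coe.measurable.comp hs).prodMk hx))

end Cutoff

section JumpMeasure

variable {M : Market K}

lemma Market.measurable_G (M : Market K) (s : ℝ≥0) (k : Fin K) : Measurable (M.G s k) :=
  (M.G_meas k).comp (measurable_const.prodMk measurable_id)

lemma Market.measurable_G_comp (M : Market K) {α : Type*} [MeasurableSpace α] {s : α → ℝ≥0}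
    (hs : Measurable s) {k : α → Fin K} (hk : Measurable k) {ζ : α → M.Z} (hζ : Measurable ζ) :
    Measurable fun a => M.G (s a) (k a) (ζ a) := by
  have h2 : Measurable fun q : Fin K × (ℝ≥0 × M.Z) => M.G q.2.1 q.1 q.2.2 :=
    measurable_from_prod_countable_right M.G_meas
  exact h2.comp (hk.prodMk (hs.prodMk hζ))

/-- A return jump of size `0` has no effect, hence is irrelevant in the integrals with respect to
the jump intensity. -/
lemma Market.lintegral_η (M : Market K) (s : ℝ≥0) (k : Fin K) {f : ℝ → ℝ≥0∞} (hf : Measurable f)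
    (h0 : f 0 = 0) : ∫⁻ z, f z ∂(M.η s k) = ∫⁻ ζ, f (M.G s k ζ) ∂M.ς := by
  rw [Market.η, ← lintegral_indicator (measurableSet_singleton 0).compl,
    ← lintegral_map hf (M.measurable_G s k)]
  refine lintegral_congr fun z => ?_
  by_cases hz : z = 0
  · simp [hz, h0]
  · rw [indicator_of_mem (show z ∈ ({0}ᶜ : Set ℝ) from hz)]

lemma Market.integral_η (M : Market K) (s : ℝ≥0) (k : Fin K) {f : ℝ → ℝ} (hf : Measurable f)
    (h0 : f 0 = 0) : ∫ z, f z ∂(M.η s k) = ∫ ζ, f (M.G s k ζ) ∂M.ς := by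
  rw [Market.η, ← integral_indicator (measurableSet_singleton 0).compl,
    ← integral_map (M.measurable_G s k).aemeasurable hf.aestronglyMeasurable]
  refine integral_congr_ae (Eventually.of_forall fun z => ?_)
  by_cases hz : z = 0
  · simp [hz, h0]
  · exact indicator_of_mem (show z ∈ ({0}ᶜ : Set ℝ) from hz) _

lemma Market.ae_η_iff (M : Market K) (s : ℝ≥0) (k : Fin K) {p : ℝ → Prop}
    (hp : MeasurableSet {z | p z}) (h0 : p 0) :
    (∀ᵐ z ∂(M.η s k), p z) ↔ ∀ᵐ ζ ∂M.ς, p (M.G s k ζ) := by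
  rw [Market.η, ae_restrict_iff' (measurableSet_singleton 0).compl,
    ← ae_map_iff (M.measurable_G s k).aemeasurable hp]
  refine eventually_congr (Eventually.of_forall fun z => ⟨fun h => ?_, fun h _ => h⟩)
  by_cases hz : z = 0
  · rwa [hz]
  · exact h hz

variable {Υ : ℝ → ℝ → Fin K → ℝ}

lemma IsC11.measurable_jump (hΥ : IsC11 M Υ) (s : ℝ≥0) (x a : ℝ) (k : Fin K) :
    Measurable fun z : ℝ => cutoff M Υ s (x * (1 + a * z)) k - cutoff M Υ s x k :=
  (measurable_cutoff hΥ.cont measurable_const (by fun_prop) measurable_const).sub measurable_const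

lemma jump_eq_cutoff {s : ℝ≥0} (hs : s ≤ M.T) {x : ℝ} (hx : 0 < x) {a z : ℝ} (hz : 0 < 1 + a * z)
    (k : Fin K) : Υ s (x * (1 + a * z)) k - Υ s x k =
      cutoff M Υ s (x * (1 + a * z)) k - cutoff M Υ s x k := by
  rw [cutoff_of_mem hs hx, cutoff_of_mem hs (mul_pos hx hz)]

lemma IsC11.integral_jump (hΥ : IsC11 M Υ) {s : ℝ≥0} (hs : s ≤ M.T) {x : ℝ} (hx : 0 < x) {a : ℝ}
    {k : Fin K} (ha : ∀ᵐ z ∂(M.η s k), 0 < 1 + a * z) :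
    ∫ z, (Υ s (x * (1 + a * z)) k - Υ s x k) ∂(M.η s k) =
      ∫ ζ, (cutoff M Υ s (x * (1 + a * M.G s k ζ)) k - cutoff M Υ s x k) ∂M.ς := by
  rw [← M.integral_η s k (hΥ.measurable_jump s x a k) (by simp)]
  refine integral_congr_ae ?_
  filter_upwards [ha] with z hz using jump_eq_cutoff hs hx hz k

lemma IsC11.lintegral_jump (hΥ : IsC11 M Υ) {s : ℝ≥0} (hs : s ≤ M.T) {x : ℝ} (hx : 0 < x) {a : ℝ}
    {k : Fin K} (ha : ∀ᵐ z ∂(M.η s k), 0 < 1 + a * z) :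
    ∫⁻ z, ENNReal.ofReal |Υ s (x * (1 + a * z)) k - Υ s x k| ∂(M.η s k) =
      ∫⁻ ζ, ‖cutoff M Υ s (x * (1 + a * M.G s k ζ)) k - cutoff M Υ s x k‖ₑ ∂M.ς := by
  rw [← M.lintegral_η s k (hΥ.measurable_jump s x a k).enorm (by simp)]
  refine lintegral_congr_ae ?_
  filter_upwards [ha] with z hz
  rw [jump_eq_cutoff hs hx hz k, Real.enorm_eq_ofReal_abs]

end JumpMeasure

section PathGen

variable (M : Market K) (Υ : ℝ → ℝ → Fin K → ℝ)

/-- The jump of `Υ` when the market state moves from `y` to `j`. -/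
def stateJump (s : ℝ≥0) (x : ℝ) (y j : Fin K) : ℝ := cutoff M Υ s x j - cutoff M Υ s x y

/-- The jump of `Υ` when the price jumps with mark `ζ` while the portfolio weight is `a`. -/
def priceJump (s : ℝ≥0) (x a : ℝ) (y : Fin K) (ζ : M.Z) : ℝ :=
  cutoff M Υ s (x * (1 + a * M.G s y ζ)) y - cutoff M Υ s x y

/-- The part of the generator that does not involve jumps, with the derivatives set to zero
outside the domain of `Υ`. -/
def driftCutoff (s : ℝ≥0) (x a : ℝ) (y : Fin K) : ℝ :=
  cutoff M (fun s x k => derivWithin (fun r => Υ r x k) (Icc 0 (M.T : ℝ)) s) s x y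
    + cutoff M (fun s x k => deriv (fun v => Υ s v k) x) s x y * (x * ((1 - a) * M.ρ))

/-- A version of the generator that is measurable in all its arguments. -/
def genCutoff (s : ℝ≥0) (x a : ℝ) (y : Fin K) : ℝ :=
  driftCutoff M Υ s x a y + ∑ j, stateJump M Υ s x y j * M.rate y j a
    + ∫ ζ, priceJump M Υ s x a y ζ ∂M.ς

variable {M Υ}

lemma driftCutoff_eq {s : ℝ≥0} (hs : s ≤ M.T) {x : ℝ} (hx : 0 < x) (a : ℝ) (y : Fin K) :
    driftCutoff M Υ s x a y = drift M Υ s x (x * ((1 - a) * M.ρ)) y := by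
  rw [driftCutoff, cutoff_of_mem hs hx, cutoff_of_mem hs hx, drift]

lemma genCutoff_eq_gen (hΥ : IsC11 M Υ) {s : ℝ≥0} (hs : s ≤ M.T) {x : ℝ} (hx : 0 < x) {a : ℝ}
    (haL : a ∈ Icc (-M.L) M.L) {y : Fin K} (ha : ∀ᵐ z ∂(M.η s y), 0 < 1 + a * z) :
    genCutoff M Υ s x a y = gen M Υ a s x y := by
  rw [genCutoff, gen, driftCutoff_eq hs hx, drift, hΥ.integral_jump hs hx ha, mul_assoc x]
  congr 2
  refine Finset.sum_congr rfl fun j _ => ?_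
  rw [stateJump, cutoff_of_mem hs hx, cutoff_of_mem hs hx]
  by_cases hj : y = j
  · simp [hj]
  · rw [M.rate_eq hj haL]

lemma IsC11.measurable_stateJump (hΥ : IsC11 M Υ) {α : Type*} [MeasurableSpace α] {s : α → ℝ≥0}
    (hs : Measurable s) {x : α → ℝ} (hx : Measurable x) {y : α → Fin K} (hy : Measurable y)
    (j : Fin K) : Measurable fun p => stateJump M Υ (s p) (x p) (y p) j :=
  (measurable_cutoff hΥ.cont hs hx measurable_const).sub (measurable_cutoff hΥ.cont hs hx hy)

lemma IsC11.measurable_priceJump (hΥ : IsC11 M Υ) {α : Type*} [MeasurableSpace α] {s : α → ℝ≥0}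
    (hs : Measurable s) {x : α → ℝ} (hx : Measurable x) {a : α → ℝ} (ha : Measurable a)
    {y : α → Fin K} (hy : Measurable y) {ζ : α → M.Z} (hζ : Measurable ζ) :
    Measurable fun p => priceJump M Υ (s p) (x p) (a p) (y p) (ζ p) :=
  (measurable_cutoff hΥ.cont hs (hx.mul (measurable_const.add
    (ha.mul (M.measurable_G_comp hs hy hζ)))) hy).sub (measurable_cutoff hΥ.cont hs hx hy)

lemma IsC11.measurable_genCutoff (hΥ : IsC11 M Υ) {α : Type*} [MeasurableSpace α] {s : α → ℝ≥0}
    (hs : Measurable s) {x : α → ℝ} (hx : Measurable x) {a : α → ℝ} (ha : Measurable a)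
    {y : α → Fin K} (hy : Measurable y) :
    Measurable fun p => genCutoff M Υ (s p) (x p) (a p) (y p) := by
  refine Measurable.add (Measurable.add (Measurable.add ?_ (Measurable.mul ?_ ?_))
    (Finset.measurable_sum _ fun j _ => (hΥ.measurable_stateJump hs hx hy j).mul
      (M.measurable_rate_comp j hy ha))) ?_
  · exact measurable_cutoff hΥ.cont_time hs hx hy
  · exact measurable_cutoff hΥ.cont_wealth hs hx hy
  · exact hx.mul ((measurable_const.sub ha).mul_const _)
  · have h : Measurable fun q : α × M.Z => priceJump M Υ (s q.1) (x q.1) (a q.1) (y q.1) q.2 :=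
      hΥ.measurable_priceJump (hs.comp measurable_fst) (hx.comp measurable_fst)
        (ha.comp measurable_fst) (hy.comp measurable_fst) measurable_snd
    exact h.stronglyMeasurable.integral_prod_right'.measurable

end PathGen

end

section

/-! ### Itô's formula for the state process -/

variable {K : ℕ}

/-- The properties which a path of the state process has almost surely: `N` is the realisation of
the noise, `a` the portfolio weight, `y` the market state, `x` the wealth. -/
structure IsGoodPath (M : Market K) (N : Measure (ℝ≥0 × M.Z)) (a : ℝ≥0 → ℝ) (t : ℝ≥0) (w : ℝ)
    (i : Fin K) (y : ℝ≥0 → Fin K) (x : ℝ≥0 → ℝ) : Prop where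
  cadlag_state : IsCadlagOn y t M.T
  cadlag_wealth : IsCadlagOn x t M.T
  initial : y t = i
  dynamics : ∀ u ∈ Icc t M.T, x u = w
    + ∫ s in Ioc t u, Function.leftLim x s * ((1 - a s) * M.ρ) ∂leb
    + ∫ p in Ioc t u ×ˢ (univ : Set M.Z), Function.leftLim x p.1 *
        (a p.1 * M.G p.1 (Function.leftLim y p.1) p.2) ∂N
  no_common_jumps : ∀ s ∈ Ioc t M.T, Function.leftLim y s ≠ y s → N ({s} ×ˢ univ) = 0
  solvent : ∀ s ∈ Icc 0 M.T, ∀ k, M.η s k {z : ℝ | ∃ r ∈ Icc 0 M.T, 1 + a r * z ≤ 0} = 0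
  points : ∃ S : Finset (ℝ≥0 × M.Z), (∀ p ∈ S, p.1 ∈ Ioc t M.T) ∧
    InjOn Prod.fst (S : Set (ℝ≥0 × M.Z)) ∧
    N.restrict (Ioc t M.T ×ˢ univ) = ∑ p ∈ S, Measure.dirac p

/-- The integral with respect to a point measure. -/
lemma setIntegral_eq_sumIoc {Z : Type*} [MeasurableSpace Z] [MeasurableSingletonClass Z]
    {N : Measure (ℝ≥0 × Z)} {t T : ℝ≥0} {S : Finset (ℝ≥0 × Z)}
    (hS : N.restrict (Ioc t T ×ˢ univ) = ∑ p ∈ S, Measure.dirac p) (f : ℝ≥0 × Z → ℝ) {u : ℝ≥0}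
    (hu : u ≤ T) : ∫ p in Ioc t u ×ˢ univ, f p ∂N = sumIoc S Prod.fst f t u := by
  classical
  have hB : MeasurableSet (Ioc t u ×ˢ (univ : Set Z)) := measurableSet_Ioc.prod .univ
  have hsub : Ioc t u ×ˢ (univ : Set Z) ⊆ Ioc t T ×ˢ univ :=
    prod_mono (Ioc_subset_Ioc_right hu) subset_rfl
  rw [← Measure.restrict_restrict_of_subset hsub, hS, ← integral_indicator hB,
    integral_finsetSum_measure (fun p _ => integrable_dirac (by simp)), sumIoc,
    Finset.sum_filter]
  refine Finset.sum_congr rfl fun p _ => ?_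
  rw [integral_dirac, indicator_apply]
  simp only [mem_prod, mem_univ, and_true]

namespace IsGoodPath

variable {M : Market K} {N : Measure (ℝ≥0 × M.Z)} {a : ℝ≥0 → ℝ} {t : ℝ≥0} {w : ℝ} {i : Fin K}
  {y : ℝ≥0 → Fin K} {x : ℝ≥0 → ℝ}

lemma ae_η_pos (hg : IsGoodPath M N a t w i y x) {s : ℝ≥0} (hs : s ≤ M.T) (k : Fin K) :
    ∀ᵐ z ∂(M.η s k), 0 < 1 + a s * z := by
  refine measure_mono_null (fun z hz => ?_) (hg.solvent s ⟨bot_le, hs⟩ k)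
  exact ⟨s, ⟨bot_le, hs⟩, not_lt.1 hz⟩

lemma eq_initial_wealth (hg : IsGoodPath M N a t w i y x) (htT : t ≤ M.T) : x t = w := by
  have := hg.dynamics t ⟨le_rfl, htT⟩
  simpa using this

lemma lt_top (hg : IsGoodPath M N a t w i y x) : N (Ioc t M.T ×ˢ univ) < ⊤ := by
  obtain ⟨S, -, -, hS⟩ := hg.points
  rw [← Measure.restrict_apply_univ, hS]
  exact measure_lt_top _ _

/-- Itô's formula along a path which satisfies the wealth equation. -/
theorem ito {Υ : ℝ → ℝ → Fin K → ℝ} (hΥ : IsC11 M Υ) (hg : IsGoodPath M N a t w i y x)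
    (htT : t ≤ M.T) (hw : 0 < w) (ham : Measurable a)
    (haL : ∀ s ∈ Icc 0 M.T, a s ∈ Icc (-M.L) M.L)
    (hxm : AEStronglyMeasurable (Function.leftLim x) (leb.restrict (Ioc t M.T)))
    (hjump : ∀ᵐ p ∂(N.restrict (Ioc t M.T ×ˢ univ)),
      0 < 1 + a p.1 * M.G p.1 (Function.leftLim y p.1) p.2) :
    (∀ s ∈ Icc t M.T, 0 < x s) ∧ (∀ s ∈ Ioc t M.T, 0 < Function.leftLim x s) ∧
    (∀ᵐ s ∂leb, s ∈ Ioc t M.T → Function.leftLim x s = x s) ∧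
    IntegrableOn (fun s => driftCutoff M Υ s (Function.leftLim x s) (a s) (Function.leftLim y s))
      (Ioc t M.T) leb ∧
    Υ M.T (x M.T) (y M.T) = Υ t w i
      + ∫ s in Ioc t M.T,
          driftCutoff M Υ s (Function.leftLim x s) (a s) (Function.leftLim y s) ∂leb
      + ∫ p in Ioc t M.T ×ˢ univ,
          priceJump M Υ p.1 (Function.leftLim x p.1) (a p.1) (Function.leftLim y p.1) p.2 ∂N
      + ∑ j, ∑ r ∈ entryTimes y t M.T t j,
          stateJump M Υ r (Function.leftLim x r) (Function.leftLim y r) j := by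
  classical
  obtain ⟨S, hSmem, hSinj, hS⟩ := hg.points
  have hxt := hg.eq_initial_wealth htT
  obtain ⟨B, hB0, hB⟩ := hg.cadlag_wealth.exists_bound
  have hcb : ∀ s ∈ Ioc t M.T, ‖(1 - a s) * M.ρ‖ ≤ (1 + M.L) * M.ρ := by
    intro s hs
    have h1 := haL s ⟨bot_le, hs.2⟩
    rw [norm_mul, Real.norm_of_nonneg M.ρ_pos.le]
    refine mul_le_mul_of_nonneg_right ?_ M.ρ_pos.le
    rw [Real.norm_eq_abs, abs_le]
    exact ⟨by linarith [h1.2, M.L_pos], by linarith [h1.1]⟩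
  have hcm : Measurable fun s => (1 - a s) * M.ρ := (measurable_const.sub ham).mul_const _
  have hc : IntegrableOn (fun s => (1 - a s) * M.ρ) (Ioc t M.T) leb :=
    Integrable.of_bound hcm.aestronglyMeasurable _
      ((ae_restrict_iff' measurableSet_Ioc).2 (Eventually.of_forall hcb))
  set φ : ℝ≥0 → ℝ := fun s => Function.leftLim x s * ((1 - a s) * M.ρ) with hφ
  set δ : ℝ≥0 × M.Z → ℝ := fun p => Function.leftLim x p.1 *
    (a p.1 * M.G p.1 (Function.leftLim y p.1) p.2) with hδ
  have hφint : IntegrableOn φ (Ioc t M.T) leb := by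
    refine Integrable.of_bound (hxm.mul hcm.aestronglyMeasurable) (B * ((1 + M.L) * M.ρ))
      ((ae_restrict_iff' measurableSet_Ioc).2 (Eventually.of_forall fun s hs => ?_))
    rw [norm_mul]
    exact mul_le_mul (hg.cadlag_wealth.abs_leftLim_le hB hs) (hcb s hs) (norm_nonneg _) hB0
  have hpath : IsJumpPath t M.T x φ S Prod.fst δ := by
    refine ⟨hφint, fun u hu => ?_, hSinj, hSmem⟩
    rw [hxt, hg.dynamics u hu, setIntegral_eq_sumIoc hS _ hu.2]
  have hSjump : ∀ p ∈ S, 0 < 1 + a p.1 * M.G p.1 (Function.leftLim y p.1) p.2 := by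
    intro p hp
    by_contra hneg
    rw [hS, ae_iff, Measure.finsetSum_apply] at hjump
    have := (Finset.sum_eq_zero_iff.1 hjump) p hp
    rw [Measure.dirac_apply, indicator_of_mem (show p ∈ _ from hneg)] at this
    exact one_ne_zero this
  have hSno : ∀ p ∈ S, Function.leftLim y p.1 = y p.1 := by
    intro p hp
    by_contra hne
    have h0 := hg.no_common_jumps p.1 (hSmem p hp) hne
    have h1 : (N.restrict (Ioc t M.T ×ˢ univ)) ({p.1} ×ˢ univ) = 0 :=
      le_antisymm ((Measure.restrict_apply_le _ _).trans h0.le) bot_le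
    rw [hS, Measure.finsetSum_apply] at h1
    have := (Finset.sum_eq_zero_iff.1 h1) p hp
    rw [Measure.dirac_apply_of_mem
      (show p ∈ ({p.1} ×ˢ univ : Set (ℝ≥0 × M.Z)) from ⟨rfl, mem_univ _⟩)] at this
    exact one_ne_zero this
  obtain ⟨hpos, hposl⟩ := hpath.pos (c := fun s => (1 - a s) * M.ρ) hc (fun s _ => rfl)
    (g := fun p => a p.1 * M.G p.1 (Function.leftLim y p.1) p.2) (fun p _ => rfl) hSjump
    (hxt ▸ hw)
  obtain ⟨hD, hI⟩ := hpath.ito hΥ hpos hposl hg.cadlag_state hSno htT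
  have hdrift : ∀ s ∈ Ioc t M.T,
      drift M Υ s (Function.leftLim x s) (φ s) (Function.leftLim y s) =
        driftCutoff M Υ s (Function.leftLim x s) (a s) (Function.leftLim y s) := fun s hs =>
    (driftCutoff_eq hs.2 (hposl s hs) _ _).symm
  refine ⟨hpos, hposl, ?_, hD.congr_fun hdrift measurableSet_Ioc, ?_⟩
  · have hnull : leb ((S.image Prod.fst : Finset ℝ≥0) : Set ℝ≥0) = 0 :=
      (Finset.countable_toSet _).measure_zero leb
    filter_upwards [measure_eq_zero_iff_ae_notMem.1 hnull] with s hs hmem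
    refine (hpath.eq_leftLim_of_notMem hmem fun p hp hps => hs ?_).symm
    exact Finset.mem_coe.2 (Finset.mem_image.2 ⟨p, hp, hps⟩)
  · rw [hxt, hg.initial] at hI
    rw [setIntegral_eq_sumIoc hS _ le_rfl, sumIoc_eq_sum _ hSmem,
      ← setIntegral_congr_fun measurableSet_Ioc hdrift]
    have h1 : ∀ p ∈ S, priceJump M Υ p.1 (Function.leftLim x p.1) (a p.1)
        (Function.leftLim y p.1) p.2 = Υ p.1 (Function.leftLim x p.1 + δ p)
          (Function.leftLim y p.1) - Υ p.1 (Function.leftLim x p.1) (Function.leftLim y p.1) := by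
      intro p hp
      have hp1 := hSmem p hp
      rw [priceJump, ← jump_eq_cutoff hp1.2 (hposl _ hp1) (hSjump p hp)]
      congr 2
      simp only [hδ]
      ring
    have h2 : ∀ j, ∀ r ∈ entryTimes y t M.T t j,
        stateJump M Υ r (Function.leftLim x r) (Function.leftLim y r) j =
          Υ r (Function.leftLim x r) j - Υ r (Function.leftLim x r) (Function.leftLim y r) := by
      intro j r hr
      have hr1 := (hg.cadlag_state.mem_entryTimes.1 hr).1
      rw [stateJump, cutoff_of_mem hr1.2 (hposl r hr1), cutoff_of_mem hr1.2 (hposl r hr1)]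
    rw [Finset.sum_congr rfl h1, Finset.sum_congr rfl fun j _ => Finset.sum_congr rfl (h2 j)]
    linarith

end IsGoodPath

namespace IsStateProcess

variable {M : Market K} {Ω : Type*} {mΩ : MeasurableSpace Ω} {P : Measure Ω}
  {𝓕 : Filtration ℝ≥0 mΩ} {N : Ω → Measure (ℝ≥0 × M.Z)} {h : Strategy Ω}
  {t : ℝ≥0} {w : ℝ} {i : Fin K} {Y : ℝ≥0 → Ω → Fin K} {W : ℝ≥0 → Ω → ℝ}

lemma ae_isGoodPath (hN : IsPoissonRandomMeasure P 𝓕 M.ς N) (hh : IsAdmissible M P 𝓕 h)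
    (hS : IsStateProcess M P 𝓕 N h t w i Y W) :
    ∀ᵐ ω ∂P, IsGoodPath M (N ω) (fun s => h s ω) t w i (fun s => Y s ω) (fun s => W s ω) := by
  filter_upwards [hS.chain.cadlag, hS.wealth.cadlag, hS.chain.initial, hS.wealth.dynamics,
    hS.no_common_jumps, hh.solvent, hN.ae_exists_finset t M.T] with ω h1 h2 h3 h4 h5 h6 h7
  exact ⟨h1, h2, h3, h4, h5, h6, h7⟩

end IsStateProcess

end

section

/-! ### Itô's formula and compensation along the state process -/

variable {K : ℕ}

/-- Under the usual conditions, exceptional events may be discarded at time `0`. -/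
lemma UsualConditions.measurableSet_of_ae {Ω : Type*} {mΩ : MeasurableSpace Ω} {P : Measure Ω}
    {𝓕 : Filtration ℝ≥0 mΩ} (h𝓕 : UsualConditions P 𝓕) {A : Set Ω} (hA : ∀ᵐ ω ∂P, ω ∈ A) :
    MeasurableSet[𝓕 0] A := by
  have := (h𝓕.2 Aᶜ hA).compl
  rwa [compl_compl] at this

namespace IsStateProcess

variable {M : Market K} {Ω : Type*} {mΩ : MeasurableSpace Ω} {P : Measure Ω}
  {𝓕 : Filtration ℝ≥0 mΩ} {N : Ω → Measure (ℝ≥0 × M.Z)} {h : Strategy Ω}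
  {t : ℝ≥0} {w : ℝ} {i : Fin K} {Y : ℝ≥0 → Ω → Fin K} {W : ℝ≥0 → Ω → ℝ} {A0 : Set Ω}
  {Υ : ℝ → ℝ → Fin K → ℝ}

lemma measurable_state (hS : IsStateProcess M P 𝓕 N h t w i Y W) (hA0m : MeasurableSet[𝓕 0] A0)
    (hA0 : ∀ ω ∈ A0, IsGoodPath M (N ω) (fun s => h s ω) t w i (fun s => Y s ω) fun s => W s ω) :
    Measurable[𝓕.predictable] (leftVersion Y A0 t M.T i) :=
  measurable_predictable_leftVersion hS.chain.adapted hA0m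
    (fun ω hω => (hA0 ω hω).cadlag_state) i

lemma measurable_wealth (hS : IsStateProcess M P 𝓕 N h t w i Y W)
    (hA0m : MeasurableSet[𝓕 0] A0)
    (hA0 : ∀ ω ∈ A0, IsGoodPath M (N ω) (fun s => h s ω) t w i (fun s => Y s ω) fun s => W s ω) :
    Measurable[𝓕.predictable] (leftVersion W A0 t M.T w) :=
  measurable_predictable_leftVersion hS.wealth.adapted hA0m
    (fun ω hω => (hA0 ω hω).cadlag_wealth) w

/-- Almost surely, no price jump makes the wealth nonpositive. Admissibility says this for almost
all marks; the compensation formula transfers it to the actual jumps. -/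
lemma ae_price_jump_pos [IsProbabilityMeasure P] (hN : IsPoissonRandomMeasure P 𝓕 M.ς N)
    (hh : IsAdmissible M P 𝓕 h) (hS : IsStateProcess M P 𝓕 N h t w i Y W)
    (hA0m : MeasurableSet[𝓕 0] A0) (hPA0 : ∀ᵐ ω ∂P, ω ∈ A0)
    (hA0 : ∀ ω ∈ A0, IsGoodPath M (N ω) (fun s => h s ω) t w i (fun s => Y s ω) fun s => W s ω) :
    ∀ᵐ ω ∂P, ∀ᵐ p ∂((N ω).restrict (Ioc t M.T ×ˢ univ)),
      0 < 1 + h p.1 ω * M.G p.1 (leftVersion Y A0 t M.T i (p.1, ω)) p.2 := by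
  have hY := hS.measurable_state hA0m hA0
  have hmeas : Measurable[𝓕.predictable.prod inferInstance] fun x : (ℝ≥0 × Ω) × M.Z =>
      1 + h x.1.1 x.1.2 * M.G x.1.1 (leftVersion Y A0 t M.T i x.1) x.2 := by
    have hfst := measurable_fst_predictable 𝓕
    have hhm := hh.predictable.measurable
    let m𝓟 : MeasurableSpace (ℝ≥0 × Ω) := 𝓕.predictable
    exact measurable_const.add ((hhm.comp measurable_fst).mul
      (M.measurable_G_comp (hfst.comp measurable_fst) (hY.comp measurable_fst) measurable_snd))
  refine hN.ae_of_ae_intensity (𝓕.le 0 _ hA0m) hPA0 (fun ω hω => (hA0 ω hω).lt_top)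
    (p := fun x : (ℝ≥0 × Ω) × M.Z =>
      0 < 1 + h x.1.1 x.1.2 * M.G x.1.1 (leftVersion Y A0 t M.T i x.1) x.2) ?_ ?_
  · exact hmeas measurableSet_Ioi
  · filter_upwards [hPA0] with ω hω
    have hmeas' : Measurable fun x : (ℝ≥0 × Ω) × M.Z =>
        1 + h x.1.1 x.1.2 * M.G x.1.1 (leftVersion Y A0 t M.T i x.1) x.2 :=
      Measurable.mono hmeas (sup_le_sup (MeasurableSpace.comap_mono (predictable_le_prod 𝓕))
        le_rfl) le_rfl
    have hsec : Measurable fun x : ℝ≥0 × M.Z => ((x.1, ω), x.2) :=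
      (measurable_fst.prodMk measurable_const).prodMk measurable_snd
    refine (Measure.ae_prod_iff_ae_ae (p := fun x : ℝ≥0 × M.Z =>
      0 < 1 + h x.1 ω * M.G x.1 (leftVersion Y A0 t M.T i (x.1, ω)) x.2)
      ((hmeas'.comp hsec) measurableSet_Ioi)).2 ?_
    refine (ae_restrict_iff' measurableSet_Ioc).2 (Eventually.of_forall fun s hs => ?_)
    refine (M.ae_η_iff s (leftVersion Y A0 t M.T i (s, ω)) (p := fun z => 0 < 1 + h s ω * z) ?_
      (by simp)).1 ((hA0 ω hω).ae_η_pos hs.2 _)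
    exact measurableSet_lt measurable_const (by fun_prop)

/-- Itô's formula for `Υ` along the state process, in terms of the predictable versions of its left
limits. -/
lemma ae_ito [IsProbabilityMeasure P] (hN : IsPoissonRandomMeasure P 𝓕 M.ς N)
    (hΥ : IsC11 M Υ) (htT : t ≤ M.T) (hw : 0 < w)
    (hh : IsAdmissible M P 𝓕 h) (hS : IsStateProcess M P 𝓕 N h t w i Y W)
    (hA0m : MeasurableSet[𝓕 0] A0) (hPA0 : ∀ᵐ ω ∂P, ω ∈ A0)
    (hA0 : ∀ ω ∈ A0, IsGoodPath M (N ω) (fun s => h s ω) t w i (fun s => Y s ω) fun s => W s ω) :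
    ∀ᵐ ω ∂P, (∀ s ∈ Icc t M.T, 0 < W s ω) ∧
      (∀ s ∈ Ioc t M.T, 0 < leftVersion W A0 t M.T w (s, ω)) ∧
      (∀ᵐ s ∂(leb.restrict (Ioc t M.T)), leftVersion W A0 t M.T w (s, ω) = W s ω ∧
        leftVersion Y A0 t M.T i (s, ω) = Y s ω) ∧
      IntegrableOn (fun s => driftCutoff M Υ s (leftVersion W A0 t M.T w (s, ω)) (h s ω)
        (leftVersion Y A0 t M.T i (s, ω))) (Ioc t M.T) leb ∧
      Υ M.T (W M.T ω) (Y M.T ω) = Υ t w i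
        + ∫ s in Ioc t M.T, driftCutoff M Υ s (leftVersion W A0 t M.T w (s, ω)) (h s ω)
            (leftVersion Y A0 t M.T i (s, ω)) ∂leb
        + ∫ p in Ioc t M.T ×ˢ univ, priceJump M Υ p.1 (leftVersion W A0 t M.T w (p.1, ω))
            (h p.1 ω) (leftVersion Y A0 t M.T i (p.1, ω)) p.2 ∂(N ω)
        + ∑ j, ∑ r ∈ entryTimes (fun s => Y s ω) t M.T t j,
            stateJump M Υ r (leftVersion W A0 t M.T w (r, ω))
              (leftVersion Y A0 t M.T i (r, ω)) j := by
  filter_upwards [hPA0, hS.ae_price_jump_pos hN hh hA0m hPA0 hA0] with ω hω hjump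
  have hg := hA0 ω hω
  have hW : ∀ s ∈ Ioc t M.T, leftVersion W A0 t M.T w (s, ω) =
      Function.leftLim (fun s => W s ω) s := fun s hs => leftVersion_of_mem hs hω
  have hY : ∀ s ∈ Ioc t M.T, leftVersion Y A0 t M.T i (s, ω) =
      Function.leftLim (fun s => Y s ω) s := fun s hs => leftVersion_of_mem hs hω
  have hsec : Measurable fun s : ℝ≥0 => (s, ω) := measurable_id.prodMk measurable_const
  have hWm : Measurable fun s => leftVersion W A0 t M.T w (s, ω) :=
    ((hS.measurable_wealth hA0m hA0).mono (predictable_le_prod 𝓕) le_rfl).comp hsec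
  have hhm : Measurable fun s => h s ω :=
    (hh.predictable.measurable.mono (predictable_le_prod 𝓕) le_rfl).comp hsec
  have hprod : MeasurableSet (Ioc t M.T ×ˢ (univ : Set M.Z)) := measurableSet_Ioc.prod .univ
  obtain ⟨h1, h2, h3, h4, h5⟩ := hg.ito hΥ htT hw hhm (fun s hs => hh.bounded s hs ω)
    (hWm.aestronglyMeasurable.congr ((ae_restrict_iff' measurableSet_Ioc).2
      (Eventually.of_forall hW))) (by
        filter_upwards [hjump, ae_restrict_mem hprod] with p hp hmem
        rwa [hY _ hmem.1] at hp)
  refine ⟨h1, fun s hs => by rw [hW s hs]; exact h2 s hs, ?_, ?_, ?_⟩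
  · filter_upwards [ae_restrict_of_ae h3, ae_restrict_mem measurableSet_Ioc,
      ae_restrict_of_ae (IsControlledChain.ae_leftVersion_eq (i := i)
        (fun ω hω => (hA0 ω hω).cadlag_state) hω)] with s hs hmem hs'
    exact ⟨by rw [hW s hmem, hs hmem], hs' hmem⟩
  · exact h4.congr_fun (fun s hs => by simp only [hW s hs, hY s hs]) measurableSet_Ioc
  · rw [h5]
    congr 1
    · congr 1
      · congr 1
        exact setIntegral_congr_fun measurableSet_Ioc fun s hs => by simp only [hW s hs, hY s hs]
      · exact setIntegral_congr_fun hprod fun p hp => by simp only [hW _ hp.1, hY _ hp.1]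
    · refine Finset.sum_congr rfl fun j _ => Finset.sum_congr rfl fun r hr => ?_
      have hr1 := (hg.cadlag_state.mem_entryTimes.1 hr).1
      rw [hW r hr1, hY r hr1]

/-- The compensation formula for the jumps of `Υ` caused by the chain entering the state `j`. -/
lemma compensation_state [IsProbabilityMeasure P] (hΥ : IsC11 M Υ) (htT : t ≤ M.T)
    (hh : IsAdmissible M P 𝓕 h) (hS : IsStateProcess M P 𝓕 N h t w i Y W)
    (hchain : ChainIntegrable M P Υ h t Y W)
    (hA0m : MeasurableSet[𝓕 0] A0) (hPA0 : ∀ᵐ ω ∂P, ω ∈ A0)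
    (hA0 : ∀ ω ∈ A0, IsGoodPath M (N ω) (fun s => h s ω) t w i (fun s => Y s ω) fun s => W s ω)
    (hpos : ∀ᵐ ω ∂P, ∀ s ∈ Ioc t M.T, 0 < leftVersion W A0 t M.T w (s, ω)) (j : Fin K) :
    Integrable (fun ω => ∑ r ∈ entryTimes (fun r => Y r ω) t M.T t j,
      stateJump M Υ r (leftVersion W A0 t M.T w (r, ω)) (leftVersion Y A0 t M.T i (r, ω)) j) P ∧
    Integrable (fun ω => ∫ r in Ioc t M.T, stateJump M Υ r (leftVersion W A0 t M.T w (r, ω))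
      (leftVersion Y A0 t M.T i (r, ω)) j *
        M.rate (leftVersion Y A0 t M.T i (r, ω)) j (h r ω) ∂leb) P ∧
    ∫ ω, ∑ r ∈ entryTimes (fun r => Y r ω) t M.T t j, stateJump M Υ r
      (leftVersion W A0 t M.T w (r, ω)) (leftVersion Y A0 t M.T i (r, ω)) j ∂P =
      ∫ ω, ∫ r in Ioc t M.T, stateJump M Υ r (leftVersion W A0 t M.T w (r, ω))
        (leftVersion Y A0 t M.T i (r, ω)) j *
          M.rate (leftVersion Y A0 t M.T i (r, ω)) j (h r ω) ∂leb ∂P ∧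
    ∀ᵐ ω ∂P, IntegrableOn (fun r => stateJump M Υ r (leftVersion W A0 t M.T w (r, ω))
      (leftVersion Y A0 t M.T i (r, ω)) j *
        M.rate (leftVersion Y A0 t M.T i (r, ω)) j (h r ω)) (Ioc t M.T) leb := by
  have hY := hS.measurable_state hA0m hA0
  have hW := hS.measurable_wealth hA0m hA0
  refine hS.chain.integral_sum_entryTimes hh hA0m hPA0 (fun ω hω => (hA0 ω hω).cadlag_state) htT j
    (H := fun p => stateJump M Υ p.1 (leftVersion W A0 t M.T w p) (leftVersion Y A0 t M.T i p) j)
    ?_ ?_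
  · have hfst := measurable_fst_predictable 𝓕
    let m𝓟 : MeasurableSpace (ℝ≥0 × Ω) := 𝓕.predictable
    exact hΥ.measurable_stateJump hfst hW hY j
  · refine lt_of_le_of_lt (lintegral_mono_ae ?_) hchain
    filter_upwards [hPA0, hpos] with ω hω hposω
    refine setLIntegral_mono' measurableSet_Ioc fun s hs => ?_
    have hxpos := hposω s hs
    rw [leftVersion_of_mem hs hω] at hxpos
    rw [leftVersion_of_mem hs hω, leftVersion_of_mem hs hω]
    set x := Function.leftLim (fun r => W r ω) s
    set y := Function.leftLim (fun r => Y r ω) s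
    have hhs : h s ω ∈ Icc (-M.L) M.L := hh.bounded s ⟨bot_le, hs.2⟩ ω
    by_cases hyj : y = j
    · rw [hyj, M.rate_self]
      simp
    · rw [M.rate_eq hyj hhs, Real.enorm_eq_ofReal_abs, ← ENNReal.ofReal_mul (abs_nonneg _),
        stateJump, cutoff_of_mem hs.2 hxpos, cutoff_of_mem hs.2 hxpos]
      refine ENNReal.ofReal_le_ofReal ?_
      have hterm : ∀ j', ∀ k ∈ Finset.univ.erase j',
          0 ≤ |Υ s x j' - Υ s x y| * M.q k j' (h s ω) * (if y = k then (1 : ℝ) else 0) := by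
        intro j' k hk
        refine mul_nonneg (mul_nonneg (abs_nonneg _)
          (M.q_nonneg k j' (Finset.ne_of_mem_erase hk) _ hhs)) ?_
        split_ifs <;> simp
      calc |Υ s x j - Υ s x y| * M.q y j (h s ω)
          = |Υ s x j - Υ s x y| * M.q y j (h s ω) * (if y = y then (1 : ℝ) else 0) := by simp
        _ ≤ ∑ k ∈ Finset.univ.erase j, |Υ s x j - Υ s x y| * M.q k j (h s ω) *
            (if y = k then (1 : ℝ) else 0) :=
          Finset.single_le_sum (f := fun k => |Υ s x j - Υ s x y| * M.q k j (h s ω) *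
            (if y = k then (1 : ℝ) else 0)) (hterm j)
            (Finset.mem_erase.2 ⟨hyj, Finset.mem_univ y⟩)
        _ ≤ _ := Finset.single_le_sum (f := fun j => ∑ k ∈ Finset.univ.erase j,
            |Υ s x j - Υ s x y| * M.q k j (h s ω) * (if y = k then (1 : ℝ) else 0))
            (fun j' _ => Finset.sum_nonneg (hterm j')) (Finset.mem_univ j)

/-- The compensation formula for the jumps of `Υ` caused by the price. -/
lemma compensation_price [IsProbabilityMeasure P] (hN : IsPoissonRandomMeasure P 𝓕 M.ς N)
    (hΥ : IsC11 M Υ)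
    (hh : IsAdmissible M P 𝓕 h) (hS : IsStateProcess M P 𝓕 N h t w i Y W)
    (hjump : JumpIntegrable M P Υ h t Y W)
    (hA0m : MeasurableSet[𝓕 0] A0) (hPA0 : ∀ᵐ ω ∂P, ω ∈ A0)
    (hA0 : ∀ ω ∈ A0, IsGoodPath M (N ω) (fun s => h s ω) t w i (fun s => Y s ω) fun s => W s ω)
    (hpos : ∀ᵐ ω ∂P, ∀ s ∈ Ioc t M.T, 0 < leftVersion W A0 t M.T w (s, ω)) :
    Integrable (fun ω => ∫ p in Ioc t M.T ×ˢ univ, priceJump M Υ p.1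
      (leftVersion W A0 t M.T w (p.1, ω)) (h p.1 ω) (leftVersion Y A0 t M.T i (p.1, ω)) p.2
        ∂(N ω)) P ∧
    Integrable (fun ω => ∫ r in Ioc t M.T, ∫ ζ, priceJump M Υ r
      (leftVersion W A0 t M.T w (r, ω)) (h r ω) (leftVersion Y A0 t M.T i (r, ω)) ζ
        ∂M.ς ∂leb) P ∧
    ∫ ω, ∫ p in Ioc t M.T ×ˢ univ, priceJump M Υ p.1
      (leftVersion W A0 t M.T w (p.1, ω)) (h p.1 ω) (leftVersion Y A0 t M.T i (p.1, ω)) p.2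
        ∂(N ω) ∂P =
      ∫ ω, ∫ r in Ioc t M.T, ∫ ζ, priceJump M Υ r
        (leftVersion W A0 t M.T w (r, ω)) (h r ω) (leftVersion Y A0 t M.T i (r, ω)) ζ
          ∂M.ς ∂leb ∂P ∧
    ∀ᵐ ω ∂P, IntegrableOn (fun r => ∫ ζ, priceJump M Υ r
      (leftVersion W A0 t M.T w (r, ω)) (h r ω) (leftVersion Y A0 t M.T i (r, ω)) ζ ∂M.ς)
        (Ioc t M.T) leb := by
  have hY := hS.measurable_state hA0m hA0
  have hW := hS.measurable_wealth hA0m hA0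
  refine hN.integral_compensation (𝓕.le 0 _ hA0m) hPA0 (fun ω hω => (hA0 ω hω).lt_top)
    (H := fun p => priceJump M Υ p.1.1 (leftVersion W A0 t M.T w p.1) (h p.1.1 p.1.2)
      (leftVersion Y A0 t M.T i p.1) p.2) ?_ ?_
  · have hfst := measurable_fst_predictable 𝓕
    have hhm := hh.predictable.measurable
    let m𝓟 : MeasurableSpace (ℝ≥0 × Ω) := 𝓕.predictable
    exact hΥ.measurable_priceJump (hfst.comp measurable_fst) (hW.comp measurable_fst)
      (hhm.comp measurable_fst) (hY.comp measurable_fst) measurable_snd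
  · refine lt_of_le_of_lt (lintegral_mono_ae ?_) hjump
    filter_upwards [hPA0, hpos] with ω hω hposω
    refine setLIntegral_mono' measurableSet_Ioc fun s hs => ?_
    have hxpos := hposω s hs
    rw [leftVersion_of_mem hs hω] at hxpos
    simp only [leftVersion_of_mem (c := w) hs hω, leftVersion_of_mem (c := i) hs hω]
    exact (hΥ.lintegral_jump hs.2 hxpos ((hA0 ω hω).ae_η_pos hs.2 _)).ge

end IsStateProcess

end

section

/-! ### The semimartingale decomposition of `Υ` along the state process -/

variable {K : ℕ}

/-- The HJB inequality. -/
lemma IsHJBSolution.gen_nonpos {M : Market K} {U : ℝ → ℝ} {Υ : ℝ → ℝ → Fin K → ℝ}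
    (hΥ : IsHJBSolution M U Υ) {s : ℝ≥0} (hs : s < M.T) {x : ℝ} (hx : 0 < x) {a : ℝ}
    (ha : a ∈ Icc (-M.L) M.L) (k : Fin K) : gen M Υ a s x k ≤ 0 :=
  (hΥ.hjb s ⟨bot_le, hs⟩ x hx k).1 (mem_image_of_mem _ ha)

/-- At a maximizer, the HJB inequality is an equality. -/
lemma IsHJBSolution.gen_eq_zero {M : Market K} {U : ℝ → ℝ} {Υ : ℝ → ℝ → Fin K → ℝ}
    (hΥ : IsHJBSolution M U Υ) {s : ℝ≥0} (hs : s < M.T) {x : ℝ} (hx : 0 < x) {a : ℝ}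
    (ha : a ∈ Icc (-M.L) M.L) {k : Fin K}
    (hmax : IsMaxOn (fun a => gen M Υ a s x k) (Icc (-M.L) M.L) a) : gen M Υ a s x k = 0 :=
  le_antisymm (hΥ.gen_nonpos hs hx ha k) ((hΥ.hjb s ⟨bot_le, hs⟩ x hx k).2 (by
    rintro _ ⟨b, hb, rfl⟩
    exact hmax hb))

/-- The compensated sum of all jumps, those caused by the price (`J`, with compensator `C`) and
those into each market state (`J' j`, with compensator `C' j`), is integrable and centred. -/
lemma integrable_compensated {Ω ι : Type*} {mΩ : MeasurableSpace Ω} {P : Measure Ω} [Fintype ι]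
    {J C : Ω → ℝ} (hJ : Integrable J P) (hC : Integrable C P) (hJC : ∫ ω, J ω ∂P = ∫ ω, C ω ∂P)
    {J' C' : ι → Ω → ℝ} (hJ' : ∀ j, Integrable (J' j) P) (hC' : ∀ j, Integrable (C' j) P)
    (hJC' : ∀ j, ∫ ω, J' j ω ∂P = ∫ ω, C' j ω ∂P) :
    Integrable (fun ω => (J ω - C ω) + ∑ j, (J' j ω - C' j ω)) P ∧
      ∫ ω, ((J ω - C ω) + ∑ j, (J' j ω - C' j ω)) ∂P = 0 := by
  have h1 : Integrable (fun ω => J ω - C ω) P := hJ.sub hC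
  have h2 : ∀ j, Integrable (fun ω => J' j ω - C' j ω) P := fun j => (hJ' j).sub (hC' j)
  have h3 : Integrable (fun ω => ∑ j, (J' j ω - C' j ω)) P := integrable_finsetSum _ fun j _ => h2 j
  refine ⟨h1.add h3, ?_⟩
  rw [integral_add h1 h3, integral_sub hJ hC, hJC, sub_self, zero_add,
    integral_finsetSum _ fun j _ => h2 j]
  refine Finset.sum_eq_zero fun j _ => ?_
  rw [integral_sub (hJ' j) (hC' j), hJC', sub_self]

namespace IsStateProcess

variable {M : Market K} {Ω : Type*} {mΩ : MeasurableSpace Ω} {P : Measure Ω}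
  {𝓕 : Filtration ℝ≥0 mΩ} {N : Ω → Measure (ℝ≥0 × M.Z)} {h : Strategy Ω}
  {t : ℝ≥0} {w : ℝ} {i : Fin K} {Y : ℝ≥0 → Ω → Fin K} {W : ℝ≥0 → Ω → ℝ}
  {Υ : ℝ → ℝ → Fin K → ℝ}

/-- Along the state process, the utility of the terminal wealth is `Υ(t, w, e_i)`, plus the integral
of the generator, plus a centred random variable `X`, the terminal value of the compensated sum of
jumps. The integral of the generator is nonpositive by the HJB equation, and it vanishes if the
strategy is a pointwise maximizer. -/
theorem exists_decomposition [IsProbabilityMeasure P] (h𝓕 : UsualConditions P 𝓕)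
    (hN : IsPoissonRandomMeasure P 𝓕 M.ς N) {U : ℝ → ℝ} (hΥ : IsHJBSolution M U Υ)
    (htT : t ≤ M.T) (hw : 0 < w) (hh : IsAdmissible M P 𝓕 h)
    (hS : IsStateProcess M P 𝓕 N h t w i Y W) (hjump : JumpIntegrable M P Υ h t Y W)
    (hchain : ChainIntegrable M P Υ h t Y W) :
    ∃ X I : Ω → ℝ, Integrable X P ∧ ∫ ω, X ω ∂P = 0 ∧ (∀ᵐ ω ∂P, 0 < W M.T ω) ∧
      (∀ᵐ ω ∂P, U (W M.T ω) = Υ t w i + I ω + X ω) ∧ (∀ᵐ ω ∂P, I ω ≤ 0) ∧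
      ((∀ s ∈ Ico t M.T, ∀ᵐ ω ∂P, IsMaxOn (fun a => gen M Υ a s (W s ω) (Y s ω))
        (Icc (-M.L) M.L) (h s ω)) → ∀ᵐ ω ∂P, I ω = 0) := by
  set A0 : Set Ω :=
    {ω | IsGoodPath M (N ω) (fun s => h s ω) t w i (fun s => Y s ω) fun s => W s ω} with hA0def
  have hPA0 : ∀ᵐ ω ∂P, ω ∈ A0 := hS.ae_isGoodPath hN hh
  have hA0m : MeasurableSet[𝓕 0] A0 := h𝓕.measurableSet_of_ae hPA0
  have hA0 : ∀ ω ∈ A0,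
      IsGoodPath M (N ω) (fun s => h s ω) t w i (fun s => Y s ω) fun s => W s ω :=
    fun ω hω => hω
  have hYp := hS.measurable_state hA0m hA0
  have hWp := hS.measurable_wealth hA0m hA0
  have hYm := hYp.mono (predictable_le_prod 𝓕) le_rfl
  have hWm := hWp.mono (predictable_le_prod 𝓕) le_rfl
  have hhm : Measurable fun p : ℝ≥0 × Ω => h p.1 p.2 :=
    hh.predictable.measurable.mono (predictable_le_prod 𝓕) le_rfl
  have hito := hS.ae_ito hN hΥ.smooth htT hw hh hA0m hPA0 hA0
  have hpos : ∀ᵐ ω ∂P, ∀ s ∈ Ioc t M.T, 0 < leftVersion W A0 t M.T w (s, ω) := by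
    filter_upwards [hito] with ω hω using hω.2.1
  have hstate := hS.compensation_state hΥ.smooth htT hh hchain hA0m hPA0 hA0 hpos
  obtain ⟨hp1, hp2, hp3, hp4⟩ :=
    hS.compensation_price hN hΥ.smooth hh hjump hA0m hPA0 hA0 hpos
  have hs4 : ∀ᵐ ω ∂P, ∀ j, IntegrableOn (fun r => stateJump M Υ r
      (leftVersion W A0 t M.T w (r, ω)) (leftVersion Y A0 t M.T i (r, ω)) j *
        M.rate (leftVersion Y A0 t M.T i (r, ω)) j (h r ω)) (Ioc t M.T) leb :=
    ae_all_iff.2 fun j => (hstate j).2.2.2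
  set Γ : ℝ≥0 × Ω → ℝ := fun p => genCutoff M Υ p.1 (leftVersion W A0 t M.T w p) (h p.1 p.2)
    (leftVersion Y A0 t M.T i p) with hΓ
  have hΓm : Measurable Γ := hΥ.smooth.measurable_genCutoff measurable_fst hWm hhm hYm
  -- the HJB equation is only assumed before `T`
  have hne : ∀ᵐ s ∂(leb.restrict (Ioc t M.T)), s ≠ M.T :=
    ae_restrict_of_ae (by simp [ae_iff, measure_singleton])
  have hΓgen : ∀ᵐ ω ∂P, ∀ s ∈ Ioc t M.T, Γ (s, ω) = gen M Υ (h s ω) s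
      (leftVersion W A0 t M.T w (s, ω)) (leftVersion Y A0 t M.T i (s, ω)) := by
    filter_upwards [hPA0, hpos] with ω hω hposω s hs
    exact genCutoff_eq_gen hΥ.smooth hs.2 (hposω s hs) (hh.bounded s ⟨bot_le, hs.2⟩ ω)
      ((hA0 ω hω).ae_η_pos hs.2 _)
  obtain ⟨hX, hX0⟩ := integrable_compensated hp1 hp2 hp3 (fun j => (hstate j).1)
    (fun j => (hstate j).2.1) fun j => (hstate j).2.2.1
  refine ⟨_, fun ω => ∫ s in Ioc t M.T, Γ (s, ω) ∂leb, hX, hX0, ?_, ?_, ?_, ?_⟩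
  · filter_upwards [hito] with ω hω using hω.1 M.T ⟨htT, le_rfl⟩
  · filter_upwards [hito, hp4, hs4] with ω hω hp4ω hs4ω
    obtain ⟨h1, -, -, h4, h5⟩ := hω
    rw [← hΥ.terminal _ (h1 M.T ⟨htT, le_rfl⟩) (Y M.T ω), h5]
    have hΓint : ∫ s in Ioc t M.T, Γ (s, ω) ∂leb =
        ∫ s in Ioc t M.T, driftCutoff M Υ s (leftVersion W A0 t M.T w (s, ω)) (h s ω)
            (leftVersion Y A0 t M.T i (s, ω)) ∂leb
        + ∑ j, ∫ r in Ioc t M.T, stateJump M Υ r (leftVersion W A0 t M.T w (r, ω))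
          (leftVersion Y A0 t M.T i (r, ω)) j *
            M.rate (leftVersion Y A0 t M.T i (r, ω)) j (h r ω) ∂leb
        + ∫ r in Ioc t M.T, ∫ ζ, priceJump M Υ r (leftVersion W A0 t M.T w (r, ω)) (h r ω)
        (leftVersion Y A0 t M.T i (r, ω)) ζ ∂M.ς ∂leb := by
      have hsum : Integrable (fun r => ∑ j, stateJump M Υ r (leftVersion W A0 t M.T w (r, ω))
          (leftVersion Y A0 t M.T i (r, ω)) j *
            M.rate (leftVersion Y A0 t M.T i (r, ω)) j (h r ω)) (leb.restrict (Ioc t M.T)) :=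
        integrable_finsetSum _ fun j _ => hs4ω j
      rw [← integral_finsetSum _ fun j _ => hs4ω j]
      exact (integral_add (h4.add hsum) hp4ω).trans (congrArg (· + _) (integral_add h4 hsum))
    rw [hΓint, Finset.sum_sub_distrib]
    ring
  · filter_upwards [hΓgen, hpos] with ω hω hposω
    refine integral_nonpos_of_ae ?_
    filter_upwards [ae_restrict_mem measurableSet_Ioc, hne] with s hs hsT
    rw [hω s hs]
    exact hΥ.gen_nonpos (lt_of_le_of_ne hs.2 hsT) (hposω s hs)
      (hh.bounded s ⟨bot_le, hs.2⟩ ω) _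
  · intro hmax
    -- the left limits agree with the process at almost all times, almost surely
    have hWr := measurable_rightVersion (T := M.T)
      (fun s hs => (hS.wealth.adapted s hs).mono (𝓕.le s) le_rfl) (𝓕.le 0 _ hA0m)
      (fun ω hω => (hA0 ω hω).cadlag_wealth) w
    have hYr := measurable_rightVersion (T := M.T)
      (fun s hs => (hS.chain.adapted s hs).mono (𝓕.le s) le_rfl) (𝓕.le 0 _ hA0m)
      (fun ω hω => (hA0 ω hω).cadlag_state) i
    have hlr : ∀ᵐ s ∂(leb.restrict (Ioc t M.T)), ∀ᵐ ω ∂P,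
        leftVersion W A0 t M.T w (s, ω) = rightVersion W A0 t M.T w (s, ω) ∧
          leftVersion Y A0 t M.T i (s, ω) = rightVersion Y A0 t M.T i (s, ω) := by
      refine (Measure.ae_ae_comm (μ := leb.restrict (Ioc t M.T)) (ν := P) (p := fun s ω =>
        leftVersion W A0 t M.T w (s, ω) = rightVersion W A0 t M.T w (s, ω) ∧
          leftVersion Y A0 t M.T i (s, ω) = rightVersion Y A0 t M.T i (s, ω))
        ((measurableSet_eq_fun hWm hWr).inter (measurableSet_eq_fun hYm hYr))).2 ?_
      filter_upwards [hPA0, hito] with ω hω hω'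
      filter_upwards [hω'.2.2.1, ae_restrict_mem measurableSet_Ioc, hne] with s hs hmem hsT
      have hmem' : s ∈ Ico t M.T := ⟨hmem.1.le, lt_of_le_of_ne hmem.2 hsT⟩
      rw [rightVersion_of_mem hmem' hω, rightVersion_of_mem hmem' hω]
      exact hs
    -- the maximum is attained almost surely at each time; Fubini's theorem exchanges the two
    have hzero : ∀ᵐ s ∂(leb.restrict (Ioc t M.T)), ∀ᵐ ω ∂P, Γ (s, ω) = 0 := by
      filter_upwards [hlr, ae_restrict_mem measurableSet_Ioc, hne] with s hs hmem hsT
      have hmem' : s ∈ Ico t M.T := ⟨hmem.1.le, lt_of_le_of_ne hmem.2 hsT⟩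
      filter_upwards [hs, hPA0, hpos, hΓgen, hmax s hmem'] with ω hω hωA hposω hgenω hmaxω
      rw [rightVersion_of_mem hmem' hωA, rightVersion_of_mem hmem' hωA] at hω
      have hx := hposω s hmem
      rw [hgenω s hmem, hω.1, hω.2]
      rw [hω.1] at hx
      exact hΥ.gen_eq_zero hmem'.2 hx (hh.bounded s ⟨bot_le, hmem.2⟩ ω) hmaxω
    have hzero' := (Measure.ae_ae_comm (μ := leb.restrict (Ioc t M.T)) (ν := P)
      (p := fun s ω => Γ (s, ω) = 0) (hΓm (measurableSet_singleton 0))).1 hzero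
    filter_upwards [hzero'] with ω hω
    exact integral_eq_zero_of_ae hω

end IsStateProcess

/-! ### Extended expectations -/

section ExtExpectation

variable {Ω : Type*} {mΩ : MeasurableSpace Ω} {P : Measure Ω}

lemma extExpectation_of_integrable {X : Ω → ℝ} (hX : Integrable X P) :
    extExpectation P X = ((∫ ω, X ω ∂P : ℝ) : EReal) := by
  have h1 : ∫⁻ ω, ENNReal.ofReal (X ω) ∂P ≠ ⊤ := hX.lintegral_lt_top.ne
  have h2 : ∫⁻ ω, ENNReal.ofReal (-X ω) ∂P ≠ ⊤ := hX.neg.lintegral_lt_top.ne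
  rw [extExpectation, integral_eq_lintegral_pos_part_sub_lintegral_neg_part hX, EReal.coe_sub,
    EReal.coe_ennreal_toReal h1, EReal.coe_ennreal_toReal h2]

/-- A random variable bounded above by an integrable one has an expectation in `[-∞, ∞)`. -/
lemma extExpectation_le_of_ae_le {X Z : Ω → ℝ} (hX : AEMeasurable X P) (hZ : Integrable Z P)
    (h : ∀ᵐ ω ∂P, X ω ≤ Z ω) : ∫⁻ ω, ENNReal.ofReal (X ω) ∂P < ⊤ ∧
      extExpectation P X ≤ ((∫ ω, Z ω ∂P : ℝ) : EReal) := by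
  have h1 : ∫⁻ ω, ENNReal.ofReal (X ω) ∂P < ⊤ :=
    (lintegral_mono_ae (h.mono fun ω hω => ENNReal.ofReal_le_ofReal hω)).trans_lt
      hZ.lintegral_lt_top
  refine ⟨h1, ?_⟩
  by_cases h2 : ∫⁻ ω, ENNReal.ofReal (-X ω) ∂P = ⊤
  · rw [extExpectation, h2, EReal.coe_ennreal_top, EReal.sub_top]
    exact bot_le
  · have hint : Integrable X P := by
      refine ⟨hX.aestronglyMeasurable, ?_⟩
      have : ∀ ω, ‖X ω‖ₑ = ENNReal.ofReal (X ω) + ENNReal.ofReal (-X ω) := fun ω => by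
        rw [Real.enorm_eq_ofReal_abs]
        rcases le_total 0 (X ω) with h0 | h0
        · rw [abs_of_nonneg h0, ENNReal.ofReal_of_nonpos (neg_nonpos.2 h0), add_zero]
        · rw [abs_of_nonpos h0, ENNReal.ofReal_of_nonpos h0, zero_add]
      rw [HasFiniteIntegral]
      simp_rw [this]
      rw [lintegral_add_left' hX.ennreal_ofReal]
      exact ENNReal.add_lt_top.2 ⟨h1, lt_top_iff_ne_top.2 h2⟩
    rw [extExpectation_of_integrable hint]
    exact EReal.coe_le_coe_iff.2 (integral_mono_ae hint hZ h)

end ExtExpectation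

lemma IsUtility.aemeasurable_comp {U : ℝ → ℝ} (hU : IsUtility U) {Ω : Type*}
    {mΩ : MeasurableSpace Ω} {P : Measure Ω} {X : Ω → ℝ} (hX : Measurable X)
    (hpos : ∀ᵐ ω ∂P, 0 < X ω) : AEMeasurable (fun ω => U (X ω)) P := by
  classical
  have h1 : Measurable ((Ioi 0).piecewise U fun _ => 0) :=
    hU.differentiable.continuousOn.measurable_piecewise continuousOn_const measurableSet_Ioi
  refine ⟨_, h1.comp hX, ?_⟩
  filter_upwards [hpos] with ω hω
  exact (Set.piecewise_eq_of_mem _ _ _ (show X ω ∈ Ioi 0 from hω)).symm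

end

end LargeInvestor

end

theorem theorem3p1 {K : ℕ} (M : LargeInvestor.Market K)
    {Ω : Type*} {mΩ : MeasurableSpace Ω} (P : Measure Ω) [IsProbabilityMeasure P]
    (𝓕 : Filtration ℝ≥0 mΩ) (h𝓕 : LargeInvestor.UsualConditions P 𝓕)
    (N : Ω → Measure (ℝ≥0 × M.Z)) (hN : LargeInvestor.IsPoissonRandomMeasure P 𝓕 M.ς N)
    (U : ℝ → ℝ) (hU : LargeInvestor.IsUtility U)
    -- a solution of the HJB equation
    (Υ : ℝ → ℝ → Fin K → ℝ) (hΥ : LargeInvestor.IsHJBSolution M U Υ)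
    -- the initial condition
    (t : ℝ≥0) (ht : t ≤ M.T) (w : ℝ) (hw : 0 < w) (i : Fin K)
    -- the state process of each admissible strategy, started from that initial condition
    (Y : LargeInvestor.Strategy Ω → ℝ≥0 → Ω → Fin K)
    (W : LargeInvestor.Strategy Ω → ℝ≥0 → Ω → ℝ)
    (hYW : ∀ h, LargeInvestor.IsAdmissible M P 𝓕 h →
      LargeInvestor.IsStateProcess M P 𝓕 N h t w i (Y h) (W h))
    -- the integrability conditions
    (hjump : ∀ h, LargeInvestor.IsAdmissible M P 𝓕 h →
      LargeInvestor.JumpIntegrable M P Υ h t (Y h) (W h))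
    (hchain : ∀ h, LargeInvestor.IsAdmissible M P 𝓕 h →
      LargeInvestor.ChainIntegrable M P Υ h t (Y h) (W h)) :
    -- `Υ` dominates the (well-defined) expected utility of every admissible strategy
    (∀ h, LargeInvestor.IsAdmissible M P 𝓕 h →
      ∫⁻ ω, ENNReal.ofReal (U (W h M.T ω)) ∂P < ⊤ ∧
        LargeInvestor.extExpectation P (fun ω => U (W h M.T ω)) ≤ ((Υ t w i : ℝ) : EReal)) ∧
    -- a pointwise maximizer along its own path is optimal, and `Υ` is then the value function
    (∀ h, LargeInvestor.IsAdmissible M P 𝓕 h →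
      (∀ s ∈ Ico t M.T, ∀ᵐ ω ∂P,
        IsMaxOn (fun a => LargeInvestor.gen M Υ a s (W h s ω) (Y h s ω))
          (Icc (-M.L) M.L) (h s ω)) →
      LargeInvestor.value M P 𝓕 U W = ((Υ t w i : ℝ) : EReal) ∧
        LargeInvestor.extExpectation P (fun ω => U (W h M.T ω)) =
          LargeInvestor.value M P 𝓕 U W) := by
  have hmain := fun h hh => (hYW h hh).exists_decomposition h𝓕 hN hΥ ht hw hh (hjump h hh)
    (hchain h hh)
  have hbound : ∀ h, LargeInvestor.IsAdmissible M P 𝓕 h →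
      ∫⁻ ω, ENNReal.ofReal (U (W h M.T ω)) ∂P < ⊤ ∧
        LargeInvestor.extExpectation P (fun ω => U (W h M.T ω)) ≤ ((Υ t w i : ℝ) : EReal) := by
    intro h hh
    obtain ⟨X, I, hX, hX0, hpos, heq, hI, -⟩ := hmain h hh
    have hmeas := hU.aemeasurable_comp (((hYW h hh).wealth.adapted M.T ⟨ht, le_rfl⟩).mono
      (𝓕.le _) le_rfl) hpos
    have hle : ∀ᵐ ω ∂P, U (W h M.T ω) ≤ Υ t w i + X ω := by
      filter_upwards [heq, hI] with ω h1 h2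
      linarith
    have hval : ∫ ω, (Υ t w i + X ω) ∂P = Υ t w i := by
      rw [integral_add (integrable_const _) hX, hX0]
      simp
    have := LargeInvestor.extExpectation_le_of_ae_le hmeas ((integrable_const (Υ t w i)).add hX) hle
    refine ⟨this.1, this.2.trans (le_of_eq ?_)⟩
    exact congrArg _ hval
  refine ⟨hbound, fun h hh hmax => ?_⟩
  obtain ⟨X, I, hX, hX0, -, heq, -, hI⟩ := hmain h hh
  have hval : LargeInvestor.extExpectation P (fun ω => U (W h M.T ω)) =
      ((Υ t w i : ℝ) : EReal) := by
    have hae : (fun ω => U (W h M.T ω)) =ᵐ[P] fun ω => Υ t w i + X ω := by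
      filter_upwards [heq, hI hmax] with ω h1 h2
      rw [h1, h2, add_zero]
    rw [LargeInvestor.extExpectation_of_integrable
      (((integrable_const (Υ t w i)).add hX).congr hae.symm), integral_congr_ae hae,
      integral_add (integrable_const _) hX, hX0]
    simp
  have hvalue : LargeInvestor.value M P 𝓕 U W = ((Υ t w i : ℝ) : EReal) :=
    le_antisymm (iSup₂_le fun h' hh' => (hbound h' hh').2)
      (hval ▸ le_iSup₂ (f := fun h' (_ : LargeInvestor.IsAdmissible M P 𝓕 h') =>
        LargeInvestor.extExpectation P (fun ω => U (W h' M.T ω))) h hh)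
  exact ⟨hvalue, hval.trans hvalue.symm⟩
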